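/- **Model.** Consider a target at the origin of the plane. Its nearest base station (BS), the source, is at distance $R_1>0$; given this, the other BSs form a Poisson process of intensity $\lambda_{BS}>0$ outside the disc of radius $R_1$. Let $n\ge 2$, let $R_n$ be the distance from the target to its $n$-th nearest BS (the receiver), and let $\beta\in[0,\pi]$ be the angle at the target between the source and the receiver. Each BS has $M\ge1$ beams of width $\theta_B=2\pi/M$ and gain $G_m$, and sensing and communication powers $P_s$, $P_c$; a link of length $r$ is LoS with probability $p_{LOS}(r)=e^{-\gamma r}$. The wavelength is $\lambda$, $c$ is the speed of light, and $K_BTW_b$ is the noise power (bandwidth $W_b$). With $\kappa=P_sG_m^2\lambda^2/(4\pi)^3$, the bistatic SINR is $$\mathrm{SINR}_{B_n}=\frac{\mathbb 1_{c_1}\,\kappa\,\sigma\cos(\beta/2)\,R_1^{-\eta_L}R_n^{-\eta_L}}{I_0+I_1+I_2+K_BTW_b+I_L+I_N},$$ where: - $c_1$ is the event that the target–receiver link is LoS (conditional probability $p_{LOS}(R_n)$) and that the return arrives, at a uniformly chosen beam of the receiver, on a beam other than the one using the same frequency block. The radar cross-section $\sigma$ of the target is exponential with mean $\sigma_t$.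 - $I_0=\kappa\cos(\beta/2)R_1^{-\eta_L}R_n^{-\eta_L}\sum\sigma_{x}$ (intra-clutter) sums over the points $x$ of a Poisson process of clutter of intensity $\lambda_{cl}$ that lie in the resolution cell, a region of area $A_{rb}=\dfrac{c\,R_n\theta_B}{2W_b\cos^2(\beta/2)}$; the $\sigma_x$ are i.i.d. exponential with mean $\sigma_c$. - $I_1=\kappa R_n^{-\eta_L}\cos(\beta_I/2)\sum_v R_v^{-\eta_L}\sigma_v$ and $I_2=\kappa R_n^{-\eta_L}\cos(\beta_I/2)\sum_v R_v^{-\eta_L}\sum_x\sigma_{v,x}$ (inter-clutter from the target and from clutter): $v$ runs, in each of the two sums, over a Poisson process of intensity $p_{LOS}(r)\lambda_{BS}/M$ at distance $r=R_v\ge R_{IC}$ from the target; $\sigma_v$ are i.i.d. exponential with mean $\sigma_t$; each $v$ in $I_2$ sees an independent copy of the clutter in the resolution cell. Here $R_{IC}$ is the distance from the target to its second-nearest BS in an independent copy of the BS process given $R_1$, and $\beta_I$ is uniform on $[0,\pi]$. - $I_L=\sum_i P_ch_iG_m^2C_Lr_i^{-\eta_L}$ and $I_N=\sum_i P_ch_iG_m^2C_Nr_i^{-\eta_N}$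 (direct interference): sums over Poisson processes around the receiver, at distances $r_i\ge R_d$, of intensities $p_{LOS}(r)\lambda_{BS}/M^2$ and $(1-p_{LOS}(r))\lambda_{BS}/M^2$, with i.i.d. unit-mean Gamma gains of shapes $m_L$ and $m_N$; $R_d$ is the distance from the receiver to its nearest neighbour in a Poisson process of intensity $\lambda_{BS}$. All these random elements ($(R_n,\beta)$, the link blockage, the receiving beam, $\sigma$, the clutter, $R_{IC}$, $\beta_I$, $R_d$, and the four marked interferer processes) are mutually independent. The parameters $\lambda_{BS}$, $P_s$, $G_m$, $\lambda$, $\sigma_t$, $\sigma_c$, $K_B$, $T$, $W_b$, $c$, $\eta_L$, $\eta_N$, $m_L$, $m_N$ are positive and $\lambda_{cl},\gamma,C_L,C_N,P_c$ nonnegative. **Theorem.** For every threshold $\phi_s>0$, the bistatic sensing coverage probability $\mathcal P_{B_n}(R_1)=\mathbb P(\mathrm{SINR}_{B_n}>\phi_s)$ at the $n$-th nearest BS equals $$\int_{R_1}^\infty\!\int_0^\pi \frac{p_{LOS}(R_n)(M-1)}{M}\;\exp\!\Big(-\lambda_{cl}A_{rb}\frac{\phi_s\sigma_c}{\sigma_t+\phi_s\sigma_c}\Big)\;\mathcal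 L_{IC}\!\Big(\frac{\phi_sR_1^{\eta_L}}{\sigma_t\cos(\beta/2)}\Big)\;e^{-u K_BTW_b}\;\mathcal L_D(u)\; f_n(R_n)\,\frac1\pi\,d\beta\,dR_n ,$$ with $u=\dfrac{\phi_s(4\pi)^3R_1^{\eta_L}R_n^{\eta_L}}{P_sG_m^2\lambda^2\cos(\beta/2)\,\sigma_t}$, $\;f_n(R_n)=\dfrac{2(\lambda_{BS}\pi)^{n-1}}{(n-2)!}(R_n^2-R_1^2)^{n-2}R_ne^{-\lambda_{BS}\pi(R_n^2-R_1^2)}$, $$\begin{aligned}\mathcal L_{IC}(s)=\int_{R_1}^\infty\!\int_0^\pi&\exp\!\Big(-\tfrac{2\pi\lambda_{BS}}{M}\int_{R_{IC}}^\infty p_{LOS}(r)\Big(1-\tfrac1{1+s\cos(\beta_I/2)r^{-\eta_L}\sigma_t}\Big)r\,dr\Big)\\ \times&\exp\!\Big(-\tfrac{\lambda_{BS}}{M}\int_{R_{IC}}^\infty p_{LOS}(r)\Big(1-\exp\Big(-\lambda_{cl}A_{rb}\tfrac{s\cos(\beta_I/2)r^{-\eta_L}\sigma_c}{1+s\cos(\beta_I/2)r^{-\eta_L}\sigma_c}\Big)\Big)2\pi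 r\,dr\Big)\\ \times&\,2\lambda_{BS}R_{IC}e^{-\lambda_{BS}\pi(R_{IC}^2-R_1^2)}\,d\beta_I\,dR_{IC},\end{aligned}$$ $$\begin{aligned}\mathcal L_D(s)=\int_0^\infty&\exp\!\Big(-\tfrac{2\pi\lambda_{BS}}{M^2}\int_{R_d}^\infty p_{LOS}(r)\Big(1-\big(1+\tfrac{sP_cG_m^2C_Lr^{-\eta_L}}{m_L}\big)^{-m_L}\Big)r\,dr\Big)\\ \times&\exp\!\Big(-\tfrac{2\pi\lambda_{BS}}{M^2}\int_{R_d}^\infty(1-p_{LOS}(r))\Big(1-\big(1+\tfrac{sP_cG_m^2C_Nr^{-\eta_N}}{m_N}\big)^{-m_N}\Big)r\,dr\Big)\,2\pi\lambda_{BS}R_de^{-\pi\lambda_{BS}R_d^2}\,dR_d .\end{aligned}$$ If an inner integral diverges (the interference is then infinite and the SINR zero), $e^{-\infty}=0$. -/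

import Mathlib

open MeasureTheory ProbabilityTheory
open scoped ENNReal

noncomputable section

namespace ISAC

/-! ### Poisson point processes -/

/-- `Φ` is a Poisson point process on `X` with intensity measure `μ`, seen as the random counting
measure `∑ δ_{xᵢ}` of its points: the number of points in a set of finite intensity is Poisson
distributed, and the numbers of points in disjoint sets are independent.
The sum of `f` over the points of `Φ ω` is `∫⁻ x, f x ∂(Φ ω)`. -/
structure IsPoissonProcess {Ω X : Type*} [MeasurableSpace Ω] [MeasurableSpace X]
    (P : Measure Ω) (Φ : Ω → Measure X) (μ : Measure X) : Prop where
  measurable : Measurable Φ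
  points : ∀ᵐ ω ∂P, ∃ (I : Set ℕ) (x : I → X), Φ ω = Measure.sum fun i => Measure.dirac (x i)
  poisson : ∀ B : Set X, MeasurableSet B → μ B < ∞ →
    P.map (fun ω => Φ ω B) = (poissonMeasure (μ B).toNNReal).map (fun k : ℕ => (k : ℝ≥0∞))
  indep : ∀ (m : ℕ) (B : Fin m → Set X), (∀ i, MeasurableSet (B i)) →
    Pairwise (Function.onFun Disjoint B) → iIndepFun (fun i ω => Φ ω (B i)) P

/-- `x` is the `n`-th nearest point to the origin in the planar configuration `ψ`: it is one of the
points, and exactly `n - 1` points are strictly nearer. -/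
def IsNthNearest (ψ : Measure ℂ) (n : ℕ) (x : ℂ) : Prop :=
  ψ {x} ≠ 0 ∧ ψ (Metric.ball 0 ‖x‖) + 1 = (n : ℝ≥0∞)

/-- The exponential `exp (-x)` of an extended nonnegative number, with `exp (-∞) = 0`. -/
def expNeg (x : ℝ≥0∞) : ℝ≥0∞ := EReal.exp (-(x : EReal))

/-! ### System parameters -/

/-- The numerical parameters of the network. -/
structure Params where
  /-- number of beams (and of frequency blocks) of each base station -/
  M : ℕ
  M_pos : 1 ≤ M
  /-- density of the base stations -/
  lamBS : ℝ
  lamBS_pos : 0 < lamBS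
  /-- density of the clutter scatterers -/
  lamCl : ℝ
  lamCl_nonneg : 0 ≤ lamCl
  /-- blockage parameter -/
  γ : ℝ
  γ_nonneg : 0 ≤ γ
  /-- LoS path-loss exponent -/
  ηL : ℝ
  ηL_pos : 0 < ηL
  /-- NLoS path-loss exponent -/
  ηN : ℝ
  ηN_pos : 0 < ηN
  /-- LoS path-loss intercept -/
  CL : ℝ
  CL_nonneg : 0 ≤ CL
  /-- NLoS path-loss intercept -/
  CN : ℝ
  CN_nonneg : 0 ≤ CN
  /-- LoS Nakagami shape parameter -/
  mL : ℝ
  mL_pos : 0 < mL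
  /-- NLoS Nakagami shape parameter -/
  mN : ℝ
  mN_pos : 0 < mN
  /-- power of the sensing pulse -/
  Ps : ℝ
  Ps_pos : 0 < Ps
  /-- communication power -/
  Pc : ℝ
  Pc_nonneg : 0 ≤ Pc
  /-- maximal antenna gain -/
  Gm : ℝ
  Gm_pos : 0 < Gm
  /-- wavelength -/
  wl : ℝ
  wl_pos : 0 < wl
  /-- mean radar cross-section of a target -/
  σt : ℝ
  σt_pos : 0 < σt
  /-- mean radar cross-section of a clutter scatterer -/
  σc : ℝ
  σc_pos : 0 < σc
  /-- Boltzmann constant -/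
  KB : ℝ
  KB_pos : 0 < KB
  /-- system temperature -/
  T : ℝ
  T_pos : 0 < T
  /-- bandwidth of a frequency block -/
  Wb : ℝ
  Wb_pos : 0 < Wb
  /-- speed of light -/
  c : ℝ
  c_pos : 0 < c

namespace Params

variable (p : Params)

/-- Probability that a link of length `r` is LoS. -/
def pLOS (r : ℝ) : ℝ := Real.exp (-p.γ * r)

/-- The 3-dB beamwidth `θ_B = 2π / M`. -/
def θB : ℝ := 2 * Real.pi / p.M

/-- Area `A_rb` of the bistatic resolution cell, for a target at distance `Rn` from the receiving
base station and bistatic angle `β`. -/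
def cellArea (Rn β : ℝ) : ℝ := p.c * Rn * p.θB / (2 * p.Wb * Real.cos (β / 2) ^ 2)

/-- The factor `P_s G_m² λ² / (4π)³` of the radar range equation. -/
def radarGain : ℝ := p.Ps * p.Gm ^ 2 * p.wl ^ 2 / (4 * Real.pi) ^ 3

end Params

/-! ### The stochastic model -/

/-- The random elements of the bistatic link from the source base station (at distance `R₁` from
the target) to the `n`-th nearest base station of the target. The plane is `ℂ`. The processes
`otherBS`, `clutter`, `icBS`, `icTarget`, `icClutter` are in coordinates centred at the target,
with the source base station at the point `R₁`; `nbrBS`, `dirL`, `dirN` are in coordinates centred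
at the receiving base station. -/
structure Elements (p : Params) (Ω : Type*) where
  /-- the base stations other than the source (all farther from the target than `R₁`) -/
  otherBS : Ω → Measure ℂ
  /-- the `n`-th nearest base station to the target: the receiver -/
  rx : Ω → ℂ
  /-- uniform variable that decides whether the link from the target to the receiver is LoS -/
  block : Ω → ℝ
  /-- beam of the receiver at which the bistatic return arrives -/
  beam : Ω → Fin p.M
  /-- beam of the receiver that transmits on the frequency block under analysis -/
  coBeam : Fin p.M
  /-- monostatic radar cross-section of the target -/
  rcs : Ω → ℝ
  /-- clutter scatterers, each with its monostatic radar cross-section -/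
  clutter : Ω → Measure (ℂ × ℝ)
  /-- copy of `otherBS` that determines the protection region of inter-clutter interference -/
  icBS : Ω → Measure ℂ
  /-- second-nearest base station to the target, in the copy `icBS` -/
  icNear : Ω → ℂ
  /-- bistatic angle of inter-clutter interference -/
  icAngle : Ω → ℝ
  /-- LoS co-channel base stations whose signals are reflected by the target to the receiver, each
  with a monostatic radar cross-section of the target -/
  icTarget : Ω → Measure (ℂ × ℝ)
  /-- LoS co-channel base stations whose signals are reflected by clutter to the receiver, each with
  a configuration of clutter scatterers -/
  icClutter : Ω → Measure (ℂ × Measure (ℂ × ℝ))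
  /-- base stations around the receiver, which determine the protection region of direct
  interference -/
  nbrBS : Ω → Measure ℂ
  /-- base station nearest to the receiver -/
  nbrNear : Ω → ℂ
  /-- LoS direct interferers, each with its fading gain -/
  dirL : Ω → Measure (ℂ × ℝ)
  /-- NLoS direct interferers, each with its fading gain -/
  dirN : Ω → Measure (ℂ × ℝ)

namespace Elements

variable {p : Params} {Ω : Type*} (E : Elements p Ω)

/-- Distance `R_n` from the target to the receiver. -/
def Rn (ω : Ω) : ℝ := ‖E.rx ω‖

/-- Bistatic angle `β`: the angle at the target between the source and the receiver. -/
def angle (R₁ : ℝ) (ω : Ω) : ℝ := InnerProductGeometry.angle (R₁ : ℂ) (E.rx ω)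

/-- The condition `c₁`: the target is LoS with the receiver, and its return arrives on a beam other
than the one that uses the same frequency block. -/
def c1 (ω : Ω) : Prop := E.block ω < p.pLOS (E.Rn ω) ∧ E.beam ω ≠ E.coBeam

open Classical in
/-- Received power of the target echo; the bistatic radar cross-section is the monostatic one times
`cos (β / 2)`. -/
def signal (R₁ : ℝ) (ω : Ω) : ℝ≥0∞ :=
  if E.c1 ω then
    ENNReal.ofReal (p.radarGain * (E.rcs ω * Real.cos (E.angle R₁ ω / 2)) /
      (R₁ ^ p.ηL * E.Rn ω ^ p.ηL))
  else 0

/-- Intra-clutter power: the sum over the scatterers in the resolution cell of the target. -/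
def intraClutter (cell : ℝ → ℝ → Set ℂ) (R₁ : ℝ) (ω : Ω) : ℝ≥0∞ :=
  ∫⁻ x in {x : ℂ × ℝ | x.1 ∈ cell (E.Rn ω) (E.angle R₁ ω)},
    ENNReal.ofReal (p.radarGain * (x.2 * Real.cos (E.angle R₁ ω / 2)) /
      (R₁ ^ p.ηL * E.Rn ω ^ p.ηL)) ∂(E.clutter ω)

/-- Inter-clutter power reflected by the target: the sum over the base stations outside the
protection region. -/
def interTarget (ω : Ω) : ℝ≥0∞ :=
  ∫⁻ v in {v : ℂ × ℝ | ‖E.icNear ω‖ ≤ ‖v.1‖},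
    ENNReal.ofReal (p.radarGain * (v.2 * Real.cos (E.icAngle ω / 2)) /
      (‖v.1‖ ^ p.ηL * E.Rn ω ^ p.ηL)) ∂(E.icTarget ω)

/-- Inter-clutter power reflected by clutter: the double sum over the base stations outside the
protection region and over the scatterers in the resolution cell. -/
def interClutter (cell : ℝ → ℝ → Set ℂ) (R₁ : ℝ) (ω : Ω) : ℝ≥0∞ :=
  ∫⁻ v in {v : ℂ × Measure (ℂ × ℝ) | ‖E.icNear ω‖ ≤ ‖v.1‖},
    (∫⁻ x in {x : ℂ × ℝ | x.1 ∈ cell (E.Rn ω) (E.angle R₁ ω)},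
      ENNReal.ofReal (p.radarGain * (x.2 * Real.cos (E.icAngle ω / 2)) /
        (‖v.1‖ ^ p.ηL * E.Rn ω ^ p.ηL)) ∂v.2) ∂(E.icClutter ω)

/-- LoS direct interference, from outside the protection region. -/
def directL (ω : Ω) : ℝ≥0∞ :=
  ∫⁻ v in {v : ℂ × ℝ | ‖E.nbrNear ω‖ ≤ ‖v.1‖},
    ENNReal.ofReal (p.Pc * v.2 * p.Gm ^ 2 * p.CL * ‖v.1‖ ^ (-p.ηL)) ∂(E.dirL ω)

/-- NLoS direct interference, from outside the protection region. -/
def directN (ω : Ω) : ℝ≥0∞ :=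
  ∫⁻ v in {v : ℂ × ℝ | ‖E.nbrNear ω‖ ≤ ‖v.1‖},
    ENNReal.ofReal (p.Pc * v.2 * p.Gm ^ 2 * p.CN * ‖v.1‖ ^ (-p.ηN)) ∂(E.dirN ω)

/-- The bistatic SINR at the `n`-th nearest base station. The denominator is positive (noise), and
may be infinite. -/
def SINR (cell : ℝ → ℝ → Set ℂ) (R₁ : ℝ) (ω : Ω) : ℝ≥0∞ :=
  E.signal R₁ ω /
    (E.intraClutter cell R₁ ω + E.interTarget ω + E.interClutter cell R₁ ω +
      ENNReal.ofReal (p.KB * p.T * p.Wb) + E.directL ω + E.directN ω)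

end Elements

/-- The base stations seen from the target, other than the source at distance `R₁`: homogeneous
outside the disc of radius `R₁`, as the source is the nearest one. -/
def otherIntensity (p : Params) (R₁ : ℝ) : Measure ℂ :=
  ENNReal.ofReal p.lamBS • volume.restrict {z : ℂ | R₁ < ‖z‖}

/-- Planar intensity measure with radial density `r ↦ a r`. -/
def radialIntensity (a : ℝ → ℝ) : Measure ℂ :=
  volume.withDensity fun z : ℂ => ENNReal.ofReal (a ‖z‖)

/-- The laws of the random elements, for a target at distance `R₁` from its nearest base station.
An independently marked Poisson process is a Poisson process whose intensity is the product of
the intensity of the points and of the law of the marks. -/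
structure IsBistaticModel {p : Params} {Ω : Type*} [MeasurableSpace Ω] (P : Measure Ω)
    (E : Elements p Ω) (R₁ : ℝ) (n : ℕ) : Prop where
  otherBS : IsPoissonProcess P E.otherBS (otherIntensity p R₁)
  rx_measurable : Measurable E.rx
  rx : ∀ᵐ ω ∂P, IsNthNearest (Measure.dirac (R₁ : ℂ) + E.otherBS ω) n (E.rx ω)
  block_measurable : Measurable E.block
  block : P.map E.block = volume.restrict (Set.Icc 0 1)
  beam_measurable : Measurable E.beam
  /-- the return arrives at any of the `M` beams with the same probability -/
  beam : ∀ i, P {ω | E.beam ω = i} = (p.M : ℝ≥0∞)⁻¹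
  rcs_measurable : Measurable E.rcs
  /-- Swerling I model -/
  rcs : P.map E.rcs = expMeasure (1 / p.σt)
  /-- homogeneous clutter, whose radar cross-sections are Weibull with shape parameter one -/
  clutter : IsPoissonProcess P E.clutter
    ((ENNReal.ofReal p.lamCl • (volume : Measure ℂ)).prod (expMeasure (1 / p.σc)))
  icBS : IsPoissonProcess P E.icBS (otherIntensity p R₁)
  icNear_measurable : Measurable E.icNear
  icNear : ∀ᵐ ω ∂P, IsNthNearest (Measure.dirac (R₁ : ℂ) + E.icBS ω) 2 (E.icNear ω)
  icAngle_measurable : Measurable E.icAngle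
  icAngle : P.map E.icAngle =
    ENNReal.ofReal (1 / Real.pi) • volume.restrict (Set.Icc 0 Real.pi)
  icTarget : IsPoissonProcess P E.icTarget
    ((radialIntensity fun r => p.pLOS r * p.lamBS / p.M).prod (expMeasure (1 / p.σt)))
  /-- every interfering base station sees an independent copy of the clutter -/
  icClutter : IsPoissonProcess P E.icClutter
    ((radialIntensity fun r => p.pLOS r * p.lamBS / p.M).prod (P.map E.clutter))
  nbrBS : IsPoissonProcess P E.nbrBS (ENNReal.ofReal p.lamBS • (volume : Measure ℂ))
  nbrNear_measurable : Measurable E.nbrNear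
  nbrNear : ∀ᵐ ω ∂P, IsNthNearest (E.nbrBS ω) 1 (E.nbrNear ω)
  /-- LoS interferers with unit-mean Gamma fading -/
  dirL : IsPoissonProcess P E.dirL
    ((radialIntensity fun r => p.pLOS r * (p.lamBS / p.M ^ 2)).prod (gammaMeasure p.mL p.mL))
  /-- NLoS interferers with unit-mean Gamma fading -/
  dirN : IsPoissonProcess P E.dirN
    ((radialIntensity fun r => (1 - p.pLOS r) * (p.lamBS / p.M ^ 2)).prod
      (gammaMeasure p.mN p.mN))
  /-- the different random elements are mutually independent -/
  indep : iIndep ![MeasurableSpace.comap E.rx inferInstance,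
    MeasurableSpace.comap E.block inferInstance,
    MeasurableSpace.comap E.beam inferInstance,
    MeasurableSpace.comap E.rcs inferInstance,
    MeasurableSpace.comap E.clutter inferInstance,
    MeasurableSpace.comap E.icNear inferInstance,
    MeasurableSpace.comap E.icAngle inferInstance,
    MeasurableSpace.comap E.icTarget inferInstance,
    MeasurableSpace.comap E.icClutter inferInstance,
    MeasurableSpace.comap E.nbrNear inferInstance,
    MeasurableSpace.comap E.dirL inferInstance,
    MeasurableSpace.comap E.dirN inferInstance] P

/-- `cell Rn β` is a planar region that depends measurably on `Rn` and `β` and has the area of the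
bistatic resolution cell. -/
structure IsResolutionCell (p : Params) (cell : ℝ → ℝ → Set ℂ) : Prop where
  measurable : MeasurableSet {q : ℝ × ℝ × ℂ | q.2.2 ∈ cell q.1 q.2.1}
  area : ∀ Rn β : ℝ, 0 < Rn → 0 ≤ β → β < Real.pi →
    volume (cell Rn β) = ENNReal.ofReal (p.cellArea Rn β)

/-! ### The terms of the coverage formula -/

namespace Params

variable (p : Params)

/-- Laplace transform of the bistatic intra-clutter interference. -/
def intraLT (φ Rn β : ℝ) : ℝ :=
  Real.exp (-(p.lamCl * p.cellArea Rn β * (φ * p.σc / (p.σt + φ * p.σc))))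

/-- Laplace transform at `s` of the bistatic inter-clutter interference (reflected by the target
and by clutter). -/
def interLT (R₁ Rn β s : ℝ) : ℝ≥0∞ :=
  ∫⁻ RIC in Set.Ioi R₁, ∫⁻ βI in Set.Ioo 0 Real.pi,
    expNeg (ENNReal.ofReal (2 * Real.pi * p.lamBS / p.M) *
      ∫⁻ r in Set.Ioi RIC, ENNReal.ofReal
        (p.pLOS r * (1 - 1 / (1 + s * Real.cos (βI / 2) * r ^ (-p.ηL) * p.σt)) * r)) *
    expNeg (ENNReal.ofReal (p.lamBS / p.M) *
      ∫⁻ r in Set.Ioi RIC, ENNReal.ofReal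
        (p.pLOS r * (1 - Real.exp (-(p.lamCl * p.cellArea Rn β *
          (s * Real.cos (βI / 2) * r ^ (-p.ηL) * p.σc /
            (1 + s * Real.cos (βI / 2) * r ^ (-p.ηL) * p.σc))))) * (2 * Real.pi * r))) *
    ENNReal.ofReal (2 * p.lamBS * RIC * Real.exp (-(p.lamBS * Real.pi * (RIC ^ 2 - R₁ ^ 2))))

/-- Laplace transform at `s` of the direct interference (LoS and NLoS). -/
def directLT (s : ℝ) : ℝ≥0∞ :=
  ∫⁻ Rd in Set.Ioi (0 : ℝ),
    expNeg (ENNReal.ofReal (2 * Real.pi * p.lamBS / p.M ^ 2) *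
      ∫⁻ r in Set.Ioi Rd, ENNReal.ofReal
        (p.pLOS r *
          (1 - (1 + s * p.Pc * p.Gm ^ 2 * p.CL * r ^ (-p.ηL) / p.mL) ^ (-p.mL)) * r)) *
    expNeg (ENNReal.ofReal (2 * Real.pi * p.lamBS / p.M ^ 2) *
      ∫⁻ r in Set.Ioi Rd, ENNReal.ofReal
        ((1 - p.pLOS r) *
          (1 - (1 + s * p.Pc * p.Gm ^ 2 * p.CN * r ^ (-p.ηN) / p.mN) ^ (-p.mN)) * r)) *
    ENNReal.ofReal (2 * Real.pi * p.lamBS * Rd * Real.exp (-(Real.pi * p.lamBS * Rd ^ 2)))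

/-- The scale `φ (4π)³ R₁^η_L R_n^η_L / (P_s G_m² λ² cos (β / 2) σ_t)` at which noise and direct
interference enter. -/
def noiseScale (φ R₁ Rn β : ℝ) : ℝ :=
  φ * (4 * Real.pi) ^ 3 * R₁ ^ p.ηL * Rn ^ p.ηL /
    (p.Ps * p.Gm ^ 2 * p.wl ^ 2 * Real.cos (β / 2) * p.σt)

/-- Density of the distance to the `n`-th nearest base station, given that the nearest one is at
distance `R₁`. -/
def nthDensity (n : ℕ) (R₁ Rn : ℝ) : ℝ :=
  2 * (p.lamBS * Real.pi) ^ (n - 1) / ((n - 2).factorial : ℝ) * (Rn ^ 2 - R₁ ^ 2) ^ (n - 2) * Rn *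
    Real.exp (-(p.lamBS * Real.pi * (Rn ^ 2 - R₁ ^ 2)))

end Params

end ISAC

end

namespace ISAC

open Filter Topology
open scoped NNReal

/-! Fix the position of the receiver and write `D` for the denominator of the SINR and `g` for the
gain of the echo. Coverage means that the link and the beam are favourable and that `φ D < g σ`. The
cross-section `σ` is exponential with mean `σt` and independent of `D`, so given `D` the last event
has probability `exp (-u D)` with `u = φ / (g σt)`. Coverage is therefore a Laplace transform of the
denominator (`expMeasure_signal`, `IsBistaticModel.prob_echo`). Since `D` may be infinite,
everything is done in `ℝ≥0∞` with `exp (-∞) = 0`, and no convergence condition ever appears.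

The denominator is a sum of independent groups, so its transform is a product
(`IsBistaticModel.laplace_load`). Each factor comes from the Laplace functional of a Poisson
process, `E exp (-∫ f dΦ) = exp (-∫ (1 - exp (-f)) dμ)` (`IsPoissonProcess.laplace`), applied to
marked processes (`IsPoissonProcess.laplace_radial`, `IsPoissonProcess.laplace_clutter`). The
transform of a mark is that of a Gamma or exponential variable or, for the clutter seen by an
interferer, again a Laplace functional. Protection radii and angles are held fixed first and
averaged afterwards.

What remains is the law of the distance and angle of the `n`-th nearest point. In the coordinates
"area swept" and "angle" the planar process has unit rate with independent uniform marks, and its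
`(k + 1)`-st point has a Gamma law independent of the mark (`IsPoissonProcess.map_nthPoint`). The
proof uses counts only: the probability that the point falls in a thin slice is bounded above up to
a quadratic error, the bounds add up to an integral, and an upper bound of one probability measure
by another forces equality.

Averaging over independent elements requires sums over random points to be jointly measurable in the
points and in the parameters. This is the role of `locallyFinitePart`, an s-finite kernel that
almost surely returns the process itself. -/

/-! ### The exponential on extended nonnegative numbers. -/

theorem expNeg_zero : expNeg 0 = 1 := by simp [expNeg]

theorem expNeg_top : expNeg ∞ = 0 := by simp [expNeg]

theorem expNeg_ofReal {x : ℝ} (hx : 0 ≤ x) :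
    expNeg (ENNReal.ofReal x) = ENNReal.ofReal (Real.exp (-x)) := by
  rw [expNeg, EReal.coe_ennreal_ofReal, max_eq_left hx, ← EReal.coe_neg, EReal.exp_coe]

theorem expNeg_antitone : Antitone expNeg := fun a b hab =>
  EReal.exp_monotone (EReal.neg_le_neg_iff.2 (by exact_mod_cast hab))

theorem expNeg_le_one (x : ℝ≥0∞) : expNeg x ≤ 1 := by
  rw [← expNeg_zero]; exact expNeg_antitone zero_le

theorem continuous_expNeg : Continuous expNeg :=
  ENNReal.continuous_exp.comp (continuous_neg.comp continuous_coe_ennreal_ereal)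

@[fun_prop]
theorem measurable_expNeg : Measurable expNeg := continuous_expNeg.measurable

theorem expNeg_add (x y : ℝ≥0∞) : expNeg (x + y) = expNeg x * expNeg y := by
  rw [expNeg, expNeg, expNeg, ← EReal.exp_add, EReal.coe_ennreal_add, EReal.neg_add,
    sub_eq_add_neg] <;> simp

theorem expNeg_sum {ι : Type*} (s : Finset ι) (f : ι → ℝ≥0∞) :
    expNeg (∑ i ∈ s, f i) = ∏ i ∈ s, expNeg (f i) := by
  classical
  induction s using Finset.induction_on with
  | empty => simp [expNeg_zero]
  | insert a s ha ih => rw [Finset.sum_insert ha, Finset.prod_insert ha, expNeg_add, ih]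

theorem expNeg_natCast_mul (k : ℕ) (x : ℝ≥0∞) : expNeg (k * x) = expNeg x ^ k := by
  induction k with
  | zero => simp [expNeg_zero]
  | succ k ih => rw [Nat.cast_succ, add_mul, one_mul, expNeg_add, ih, pow_succ]

/-- The exponential series. With `q = expNeg y` it is the Laplace transform of a Poisson count, the
case `y = ∞`, `q = 0` included. -/
theorem lintegral_poissonMeasure_pow (r : ℝ≥0) {q : ℝ≥0∞} (hq : q ≤ 1) :
    ∫⁻ k : ℕ, q ^ k ∂(poissonMeasure r) = expNeg (r * (1 - q)) := by
  lift q to ℝ≥0 using (hq.trans_lt ENNReal.one_lt_top).ne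
  have hq' : (q : ℝ) ≤ 1 := by exact_mod_cast hq
  rw [poissonMeasure, lintegral_sum_measure]
  simp only [lintegral_smul_measure, lintegral_dirac, smul_eq_mul]
  have h1 : (r : ℝ≥0∞) * (1 - q) = ENNReal.ofReal (r * (1 - q)) := by
    rw [ENNReal.ofReal_mul r.coe_nonneg, ENNReal.ofReal_sub _ q.coe_nonneg]
    simp
  have h2 (k : ℕ) : ENNReal.ofReal (Real.exp (-r) * r ^ k / k.factorial) * (q : ℝ≥0∞) ^ k =
      ENNReal.ofReal (Real.exp (-r) * ((r * q : ℝ) ^ k / k.factorial)) := by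
    rw [← ENNReal.ofReal_coe_nnreal (p := q), ← ENNReal.ofReal_pow q.coe_nonneg,
      ← ENNReal.ofReal_mul (by positivity)]
    congr 1
    ring
  simp_rw [h2]
  have h3 := (NormedSpace.expSeries_div_hasSum_exp (r * q : ℝ)).mul_left (Real.exp (-r))
  rw [← ENNReal.ofReal_tsum_of_nonneg (fun k => by positivity) h3.summable, h3.tsum_eq, h1,
    expNeg_ofReal (mul_nonneg r.coe_nonneg (by linarith)), ← Real.exp_eq_exp_ℝ, ← Real.exp_add]
  congr 2
  ring

/-! ### The Laplace functional of a Poisson process. -/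

section LaplaceFunctional

variable {Ω X : Type*} [MeasurableSpace Ω] [MeasurableSpace X] {P : Measure Ω}
  {Φ : Ω → Measure X} {μ : Measure X}

theorem IsPoissonProcess.measurable_apply (h : IsPoissonProcess P Φ μ) {B : Set X}
    (hB : MeasurableSet B) : Measurable fun ω => Φ ω B :=
  (Measure.measurable_coe hB).comp h.measurable

theorem IsPoissonProcess.lintegral_count (h : IsPoissonProcess P Φ μ) {B : Set X}
    (hB : MeasurableSet B) (hμ : μ B < ∞) {g : ℝ≥0∞ → ℝ≥0∞} (hg : Measurable g) :
    ∫⁻ ω, g (Φ ω B) ∂P = ∫⁻ k : ℕ, g k ∂(poissonMeasure (μ B).toNNReal) := by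
  rw [← lintegral_map hg (h.measurable_apply hB), h.poisson B hB hμ,
    lintegral_map hg measurable_from_nat]

theorem IsPoissonProcess.laplace_count (h : IsPoissonProcess P Φ μ) {B : Set X}
    (hB : MeasurableSet B) (hμ : μ B < ∞) (y : ℝ≥0∞) :
    ∫⁻ ω, expNeg (y * Φ ω B) ∂P = expNeg ((1 - expNeg y) * μ B) := by
  rw [h.lintegral_count hB hμ (g := fun t => expNeg (y * t)) (by fun_prop)]
  simp_rw [mul_comm y, expNeg_natCast_mul]
  rw [lintegral_poissonMeasure_pow _ (expNeg_le_one y), ENNReal.coe_toNNReal hμ.ne, mul_comm]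

/-- The level sets of `g` are disjoint, so the counts on them are independent and the transform is a
product of transforms of Poisson counts. -/
theorem IsPoissonProcess.laplace_simpleFunc (h : IsPoissonProcess P Φ μ) (g : SimpleFunc X ℝ≥0∞)
    (hg : ∀ y, y ≠ 0 → μ (g ⁻¹' {y}) < ∞) :
    ∫⁻ ω, expNeg (∫⁻ x, g x ∂(Φ ω)) ∂P = expNeg (∫⁻ x, (1 - expNeg (g x)) ∂μ) := by
  classical
  -- The value `0` is left out: it contributes to neither integral, and its level set may have
  -- infinite intensity, where the law of the count is not prescribed.
  set s := g.range \ {0} with hs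
  have h1 (ν : Measure X) (w : ℝ≥0∞ → ℝ≥0∞) (hw : w 0 = 0) :
      ∫⁻ x, w (g x) ∂ν = ∑ i : Fin s.card, w (s.equivFin.symm i) *
        ν (g ⁻¹' {(s.equivFin.symm i : ℝ≥0∞)}) := by
    have e1 : ∫⁻ x, w (g x) ∂ν = ∑ y ∈ g.range, w y * ν (g ⁻¹' {y}) := by
      rw [← SimpleFunc.map_lintegral, ← SimpleFunc.lintegral_eq_lintegral]; rfl
    rw [e1, Equiv.sum_comp s.equivFin.symm (fun y : s => w y * ν (g ⁻¹' {(y : ℝ≥0∞)})),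
      Finset.sum_coe_sort s (fun y => w y * ν (g ⁻¹' {y}))]
    refine (Finset.sum_subset Finset.sdiff_subset fun y hy hy' => ?_).symm
    have : y = 0 := by
      by_contra hne
      exact hy' (by simp [hne, (SimpleFunc.mem_range.1 hy)])
    simp [this, hw]
  have hne (i : Fin s.card) : (s.equivFin.symm i : ℝ≥0∞) ≠ 0 := by
    have := (s.equivFin.symm i).2
    simp only [hs, Finset.mem_sdiff, Finset.mem_singleton] at this
    exact this.2
  have hind := h.indep s.card (fun i => g ⁻¹' {(s.equivFin.symm i : ℝ≥0∞)})
    (fun i => g.measurableSet_preimage _) (fun i j hij => by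
      refine Disjoint.preimage _ (Set.disjoint_singleton.2 fun e => hij ?_)
      exact s.equivFin.symm.injective (Subtype.ext e))
  have e2 (ω : Ω) : ∫⁻ x, g x ∂(Φ ω) = _ := h1 (Φ ω) id rfl
  simp_rw [e2, id, expNeg_sum]
  rw [lintegral_prod_eq_prod_lintegral_of_indepFun Finset.univ
    (fun i ω => expNeg (s.equivFin.symm i * Φ ω (g ⁻¹' {(s.equivFin.symm i : ℝ≥0∞)})))
    (hind.comp (fun i t => expNeg (s.equivFin.symm i * t)) (fun i => by fun_prop))
    (fun i => measurable_expNeg.comp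
      ((h.measurable_apply (g.measurableSet_preimage _)).const_mul _)),
    h1 μ (fun y => 1 - expNeg y) (by simp [expNeg_zero]), expNeg_sum]
  exact Finset.prod_congr rfl fun i _ =>
    h.laplace_count (g.measurableSet_preimage _) (hg _ (hne i)) _

/-- The Laplace functional of a Poisson process. -/
theorem IsPoissonProcess.laplace [SigmaFinite μ] [IsFiniteMeasure P] (h : IsPoissonProcess P Φ μ)
    {f : X → ℝ≥0∞} (hf : Measurable f) :
    ∫⁻ ω, expNeg (∫⁻ x, f x ∂(Φ ω)) ∂P = expNeg (∫⁻ x, (1 - expNeg (f x)) ∂μ) := by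
  -- Restriction to a spanning set makes every nonzero level set of finite intensity, as the simple
  -- case requires, and keeps the approximation increasing.
  let g (n : ℕ) : SimpleFunc X ℝ≥0∞ := (SimpleFunc.eapprox f n).restrict (spanningSets μ n)
  have hgm (n : ℕ) (x : X) : g n x = (spanningSets μ n).indicator (SimpleFunc.eapprox f n) x :=
    SimpleFunc.restrict_apply _ (measurableSet_spanningSets μ n) x
  have hmono : Monotone fun n => (g n : X → ℝ≥0∞) := by
    intro m n hmn x
    simp only [hgm]
    refine (Set.indicator_le_indicator_of_subset (monotone_spanningSets μ hmn)
      (fun _ => zero_le) x).trans (Set.indicator_le_indicator ?_)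
    exact SimpleFunc.monotone_eapprox f hmn x
  have hlim (x : X) : Tendsto (fun n => g n x) atTop (𝓝 (f x)) := by
    refine (SimpleFunc.tendsto_eapprox hf x).congr' ?_
    filter_upwards [eventually_ge_atTop (spanningSetsIndex μ x)] with n hn
    rw [hgm, Set.indicator_of_mem (mem_spanningSets_of_index_le μ x hn)]
  have hfin (n : ℕ) (y : ℝ≥0∞) (hy : y ≠ 0) : μ (g n ⁻¹' {y}) < ∞ := by
    refine (measure_mono fun x hx => ?_).trans_lt (measure_spanningSets_lt_top μ n)
    by_contra hx'
    simp only [Set.mem_preimage, hgm, Set.indicator_of_notMem hx', Set.mem_singleton_iff] at hx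
    exact hy hx.symm
  have hint (ν : Measure X) : Tendsto (fun n => ∫⁻ x, g n x ∂ν) atTop (𝓝 (∫⁻ x, f x ∂ν)) :=
    lintegral_tendsto_of_tendsto_of_monotone (fun n => (g n).measurable.aemeasurable)
      (ae_of_all _ fun x m n hmn => hmono hmn x) (ae_of_all _ hlim)
  -- `expNeg` is bounded by `1` and continuous also at `∞`, so dominated convergence applies even on
  -- outcomes where the sum diverges.
  have hL : Tendsto (fun n => ∫⁻ ω, expNeg (∫⁻ x, g n x ∂(Φ ω)) ∂P) atTop
      (𝓝 (∫⁻ ω, expNeg (∫⁻ x, f x ∂(Φ ω)) ∂P)) := by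
    refine tendsto_lintegral_of_dominated_convergence (fun _ => 1) (fun n => ?_)
      (fun n => ae_of_all _ fun ω => expNeg_le_one _) (by simp)
      (ae_of_all _ fun ω => (continuous_expNeg.tendsto _).comp (hint (Φ ω)))
    exact measurable_expNeg.comp ((Measure.measurable_lintegral (g n).measurable).comp h.measurable)
  have hR : Tendsto (fun n => ∫⁻ x, (1 - expNeg (g n x)) ∂μ) atTop
      (𝓝 (∫⁻ x, (1 - expNeg (f x)) ∂μ)) := by
    refine lintegral_tendsto_of_tendsto_of_monotone (fun n => ?_)
      (ae_of_all _ fun x m n hmn => tsub_le_tsub_left (expNeg_antitone (hmono hmn x)) _)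
      (ae_of_all _ fun x => ?_)
    · exact (measurable_const.sub (measurable_expNeg.comp (g n).measurable)).aemeasurable
    · exact ENNReal.Tendsto.sub tendsto_const_nhds ((continuous_expNeg.tendsto _).comp (hlim x))
        (Or.inl ENNReal.one_ne_top)
  refine tendsto_nhds_unique hL (((continuous_expNeg.tendsto _).comp hR).congr fun n => ?_)
  exact (h.laplace_simpleFunc (g n) (hfin n)).symm

end LaplaceFunctional

/-! ### Laws and almost sure properties of the counts. -/

section PoissonBasics

variable {Ω X : Type*} [MeasurableSpace Ω] [MeasurableSpace X] {P : Measure Ω}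
  {Φ : Ω → Measure X} {μ : Measure X}

theorem IsPoissonProcess.measure_count_mem (h : IsPoissonProcess P Φ μ) {B : Set X}
    (hB : MeasurableSet B) (hμ : μ B < ∞) {S : Set ℝ≥0∞} (hS : MeasurableSet S) :
    P {ω | Φ ω B ∈ S} = poissonMeasure (μ B).toNNReal {k : ℕ | (k : ℝ≥0∞) ∈ S} := by
  have := congrArg (fun m : Measure ℝ≥0∞ => m S) (h.poisson B hB hμ)
  simp only [Measure.map_apply (h.measurable_apply hB) hS,
    Measure.map_apply measurable_from_nat hS] at this
  exact this

theorem IsPoissonProcess.measure_count_eq (h : IsPoissonProcess P Φ μ) {B : Set X}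
    (hB : MeasurableSet B) (hμ : μ B < ∞) (k : ℕ) :
    P {ω | Φ ω B = k} =
      ENNReal.ofReal (Real.exp (-(μ B).toReal) * (μ B).toReal ^ k / k.factorial) := by
  have := h.measure_count_mem hB hμ (measurableSet_singleton (k : ℝ≥0∞))
  simp only [Set.mem_singleton_iff, Nat.cast_inj, Set.ofPred_eq_eq_singleton] at this
  rw [this, poissonMeasure_singleton]
  rfl

theorem IsPoissonProcess.ae_count_lt_top (h : IsPoissonProcess P Φ μ) {B : Set X}
    (hB : MeasurableSet B) (hμ : μ B < ∞) : ∀ᵐ ω ∂P, Φ ω B < ∞ := by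
  rw [ae_iff]
  have := h.measure_count_mem hB hμ (measurableSet_singleton ∞)
  simpa using this

theorem IsPoissonProcess.ae_count_eq_nat (h : IsPoissonProcess P Φ μ) {B : Set X}
    (hB : MeasurableSet B) (hμ : μ B < ∞) : ∀ᵐ ω ∂P, ∃ k : ℕ, Φ ω B = k := by
  rw [ae_iff]
  have hS : MeasurableSet (Set.range ((↑) : ℕ → ℝ≥0∞))ᶜ :=
    (Set.countable_range _).measurableSet.compl
  have := h.measure_count_mem hB hμ hS
  simp only [Set.mem_compl_iff, Set.mem_range, not_exists] at this ⊢
  simpa [eq_comm] using this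

theorem IsPoissonProcess.ae_count_eq_zero [IsProbabilityMeasure P] (h : IsPoissonProcess P Φ μ)
    {B : Set X} (hB : MeasurableSet B) (hμ : μ B = 0) : ∀ᵐ ω ∂P, Φ ω B = 0 := by
  have := h.measure_count_eq hB (by simp [hμ]) 0
  refine (mem_ae_iff_prob_eq_one (h.measurable_apply hB (measurableSet_singleton _))).2 ?_
  simpa [hμ, Set.preimage] using this

/-- The count of a set of zero intensity is Poisson with parameter `0`, hence almost surely `0`. -/
theorem IsPoissonProcess.ae_ae [IsProbabilityMeasure P] (h : IsPoissonProcess P Φ μ)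
    {p : X → Prop} (hp : ∀ᵐ x ∂μ, p x) : ∀ᵐ ω ∂P, ∀ᵐ x ∂(Φ ω), p x := by
  filter_upwards [h.ae_count_eq_zero (measurableSet_toMeasurable μ {x | ¬ p x})
    (by rw [measure_toMeasurable]; exact hp)] with ω hω
  exact measure_mono_null (subset_toMeasurable _ _) hω

end PoissonBasics

/-! ### An s-finite kernel that reproduces locally finite configurations. -/

section LocallyFinite

variable {X : Type*} [MeasurableSpace X]

/-- The part of a measure `ν` of mass in `[k, k + 1)` on the measurable set `S`. -/
noncomputable def boundedPart {S : Set X} (hS : MeasurableSet S) (k : ℕ) :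
    Kernel (Measure X) X :=
  open Classical in
  Kernel.piecewise (s := {ν : Measure X | ν S ∈ Set.Ico (k : ℝ≥0∞) (k + 1)})
    (Measure.measurable_coe hS measurableSet_Ico)
    (Kernel.restrict ⟨id, measurable_id⟩ hS) 0

instance {S : Set X} (hS : MeasurableSet S) (k : ℕ) : IsFiniteKernel (boundedPart hS k) := by
  refine ⟨⟨k + 1, by simp, fun ν => ?_⟩⟩
  rw [boundedPart, Kernel.piecewise_apply]
  split_ifs with h
  · rw [Kernel.restrict_apply, Measure.restrict_apply_univ]
    exact h.2.le
  · simp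

/-- A transition kernel, σ-finite in the strong sense of kernels, that returns its argument on all
measures which are finite on each of the sets that exhaust `μ`. -/
noncomputable def locallyFinitePart (μ : Measure X) [SigmaFinite μ] : Kernel (Measure X) X :=
  Kernel.sum fun N => Kernel.sum fun k =>
    boundedPart (MeasurableSet.disjointed (measurableSet_spanningSets μ) N) k

instance (μ : Measure X) [SigmaFinite μ] : IsSFiniteKernel (locallyFinitePart μ) := by
  unfold locallyFinitePart
  have (N : ℕ) : IsSFiniteKernel (Kernel.sum fun k =>
      boundedPart (MeasurableSet.disjointed (measurableSet_spanningSets μ) N) k) :=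
    Kernel.isSFiniteKernel_sum
  exact Kernel.isSFiniteKernel_sum

theorem locallyFinitePart_eq (μ : Measure X) [SigmaFinite μ] {ν : Measure X}
    (hν : ∀ N, ν (disjointed (spanningSets μ) N) < ∞) : locallyFinitePart μ ν = ν := by
  classical
  ext s hs
  have hm (N : ℕ) := MeasurableSet.disjointed (measurableSet_spanningSets μ) N
  have h1 (N : ℕ) : (∑' k, boundedPart (hm N) k ν s) = ν (s ∩ disjointed (spanningSets μ) N) := by
    obtain ⟨r, hr⟩ : ∃ r : ℝ≥0, ν (disjointed (spanningSets μ) N) = r :=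
      ⟨_, (ENNReal.coe_toNNReal (hν N).ne).symm⟩
    -- The intervals `[k, k + 1)` partition the finite masses, so exactly one `k` contributes.
    rw [tsum_eq_single ⌊r⌋₊]
    · rw [boundedPart, Kernel.piecewise_apply, if_pos, Kernel.restrict_apply,
        Measure.restrict_apply hs]
      · rfl
      · simp only [Set.mem_ofPred_eq, hr]
        exact ⟨by exact_mod_cast Nat.floor_le r.2, by exact_mod_cast Nat.lt_floor_add_one r⟩
    · intro k hk
      rw [boundedPart, Kernel.piecewise_apply, if_neg]
      · simp
      · simp only [Set.mem_ofPred_eq, hr]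
        rintro ⟨h1, h2⟩
        refine hk ((Nat.floor_eq_iff r.2).2 ⟨by exact_mod_cast h1, by exact_mod_cast h2⟩).symm
  rw [locallyFinitePart, Kernel.sum_apply, Measure.sum_apply _ hs]
  simp_rw [Kernel.sum_apply, Measure.sum_apply _ hs]
  simp_rw [h1]
  rw [← measure_iUnion (fun i j hij => ((disjoint_disjointed _) hij).mono
    Set.inter_subset_right Set.inter_subset_right) (fun N => hs.inter (hm N)), ← Set.inter_iUnion,
    iUnion_disjointed, iUnion_spanningSets, Set.inter_univ]

/-- This allows every integral against `Φ ω` to be replaced by one against an s-finite kernel, for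
which integrals with parameters are measurable. -/
theorem IsPoissonProcess.ae_locallyFinitePart_eq {Ω : Type*} [MeasurableSpace Ω] {P : Measure Ω}
    {Φ : Ω → Measure X} {μ : Measure X} [SigmaFinite μ] (h : IsPoissonProcess P Φ μ) :
    ∀ᵐ ω ∂P, locallyFinitePart μ (Φ ω) = Φ ω := by
  have : ∀ᵐ ω ∂P, ∀ N, Φ ω (disjointed (spanningSets μ) N) < ∞ :=
    ae_all_iff.2 fun N => h.ae_count_lt_top
      (MeasurableSet.disjointed (measurableSet_spanningSets μ) N)
      ((measure_mono (disjointed_subset _ _)).trans_lt (measure_spanningSets_lt_top μ N))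
  filter_upwards [this] with ω hω
  exact locallyFinitePart_eq μ hω

end LocallyFinite

theorem IsPoissonProcess.map {Ω X Y : Type*} [MeasurableSpace Ω] [MeasurableSpace X]
    [MeasurableSpace Y] {P : Measure Ω} {Φ : Ω → Measure X} {μ : Measure X}
    (h : IsPoissonProcess P Φ μ) {g : X → Y} (hg : Measurable g) :
    IsPoissonProcess P (fun ω => (Φ ω).map g) (μ.map g) where
  measurable := (Measure.measurable_map g hg).comp h.measurable
  points := by
    filter_upwards [h.points] with ω ⟨I, x, hx⟩
    refine ⟨I, fun i => g (x i), ?_⟩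
    ext s hs
    rw [Measure.map_apply hg hs, hx, Measure.sum_apply _ (hg hs), Measure.sum_apply _ hs]
    simp_rw [Measure.dirac_apply' _ (hg hs), Measure.dirac_apply' _ hs]
    rfl
  poisson B hB hμ := by
    rw [Measure.map_apply hg hB] at hμ ⊢
    simp_rw [Measure.map_apply hg hB]
    exact h.poisson _ (hg hB) hμ
  indep m B hB hd := by
    have := h.indep m (fun i => g ⁻¹' B i) (fun i => hg (hB i))
      (fun i j hij => (hd hij).preimage g)
    simpa only [Measure.map_apply hg (hB _)] using this

/-! ### The law of the `(k + 1)`-st point of a marked unit-rate process. -/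

/-- Cutting `[a, b]` into `N + 1` equal pieces bounds the total increment by `C (b - a)² / (N + 1)`,
which tends to `0`. It turns the slice estimate into an integrated bound without differentiating a
distribution function. -/
theorem le_of_forall_sub_le_sq {D : ℝ → ℝ} {C a b : ℝ} (hab : a ≤ b)
    (h : ∀ x y, a ≤ x → x ≤ y → y ≤ b → D y - D x ≤ C * (y - x) ^ 2) : D b ≤ D a := by
  obtain ⟨l, hl, rfl⟩ : ∃ l, 0 ≤ l ∧ b = a + l := ⟨b - a, by linarith, by ring⟩
  have key (N : ℕ) : D (a + l) - D a ≤ C * l ^ 2 / (N + 1 : ℝ) := by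
    have hN : (0 : ℝ) < N + 1 := by positivity
    have h1 : D (a + l) - D a = ∑ i ∈ Finset.range (N + 1),
        (D (a + (i + 1 : ℕ) * (l / (N + 1))) - D (a + (i : ℕ) * (l / (N + 1)))) := by
      rw [Finset.sum_range_sub (fun i : ℕ => D (a + i * (l / (N + 1))))]
      congr 2
      · push_cast; field_simp
      · simp
    have h2 : ∀ i ∈ Finset.range (N + 1), D (a + (i + 1 : ℕ) * (l / (N + 1))) -
        D (a + (i : ℕ) * (l / (N + 1))) ≤ C * (l / (N + 1)) ^ 2 := by
      intro i hi
      have hi' : ((i + 1 : ℕ) : ℝ) ≤ N + 1 := by exact_mod_cast Finset.mem_range.1 hi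
      refine (h _ _ (le_add_of_nonneg_right (by positivity)) ?_ ?_).trans_eq ?_
      · gcongr; simp
      · calc a + ((i + 1 : ℕ) : ℝ) * (l / (N + 1)) ≤ a + (N + 1) * (l / (N + 1)) := by gcongr
          _ = a + l := by field_simp
      · push_cast; ring
    rw [h1]
    refine (Finset.sum_le_sum h2).trans_eq ?_
    rw [Finset.sum_const, Finset.card_range, nsmul_eq_mul]
    push_cast
    field_simp
  have hlim : Tendsto (fun N : ℕ => C * l ^ 2 / (N + 1 : ℝ)) atTop (𝓝 0) :=
    tendsto_const_nhds.div_atTop (tendsto_atTop_add_const_right _ _ tendsto_natCast_atTop_atTop)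
  linarith [ge_of_tendsto' hlim key]

/-- The density `e⁻ᵗ tᵏ / k!` of the `(k + 1)`-st point of a unit-rate Poisson process. -/
noncomputable def erlangDensity (k : ℕ) (t : ℝ) : ℝ := Real.exp (-t) * t ^ k / k.factorial

theorem contDiff_erlangDensity (k : ℕ) : ContDiff ℝ 1 (erlangDensity k) := by
  unfold erlangDensity
  fun_prop

theorem erlangDensity_nonneg (k : ℕ) {t : ℝ} (ht : 0 ≤ t) : 0 ≤ erlangDensity k t := by
  unfold erlangDensity
  positivity

theorem gammaMeasure_Ioc {k : ℕ} {a b : ℝ} (ha : 0 ≤ a) (hab : a ≤ b) :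
    gammaMeasure (k + 1) 1 (Set.Ioc a b) = ENNReal.ofReal (∫ t in a..b, erlangDensity k t) := by
  rw [gammaMeasure, withDensity_apply _ measurableSet_Ioc,
    intervalIntegral.integral_of_le hab, ofReal_integral_eq_lintegral_ofReal]
  · refine setLIntegral_congr_fun measurableSet_Ioc fun t ht => ?_
    rw [gammaPDF_of_nonneg (ha.trans ht.1.le), erlangDensity]
    congr 1
    simp only [add_sub_cancel_right, Real.rpow_natCast, Real.one_rpow, one_mul,
      Real.Gamma_nat_eq_factorial]
    ring
  · exact ((contDiff_erlangDensity k).continuous.integrableOn_Icc).mono_set Set.Ioc_subset_Icc_self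
  · exact (ae_restrict_iff' measurableSet_Ioc).2
      (ae_of_all _ fun t ht => erlangDensity_nonneg k (ha.trans ht.1.le))

theorem gammaMeasure_Iic_zero {a r : ℝ} : gammaMeasure a r (Set.Iic 0) = 0 := by
  rw [gammaMeasure, withDensity_apply _ measurableSet_Iic, setLIntegral_congr Iio_ae_eq_Iic.symm]
  exact lintegral_gammaPDF_of_nonpos le_rfl

section NthPoint

variable {Ω : Type*} [MeasurableSpace Ω] {P : Measure Ω} [IsProbabilityMeasure P]
  {Ψ : Ω → Measure (ℝ × ℝ)} {ρ : Measure ℝ} [IsProbabilityMeasure ρ] {y : Ω → ℝ × ℝ} {k : ℕ}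

theorem prod_restrict_Ioi_zero_Ioc {a b : ℝ} (ha : 0 ≤ a) (S : Set ℝ) :
    ((volume.restrict (Set.Ioi (0 : ℝ))).prod ρ) (Set.Ioc a b ×ˢ S) =
      ENNReal.ofReal (b - a) * ρ S := by
  rw [Measure.prod_prod, Measure.restrict_apply measurableSet_Ioc, Set.inter_eq_left.2,
    Real.volume_Ioc]
  exact fun x hx => ha.trans_lt hx.1

/-- If the point falls in the slice, then either exactly `k` points lie in `(0, a]` and the slice
has a point with mark in `S`, or an earlier point is already in the slice, which then holds at least
two points. The first event factors over disjoint sets; the second has probability at most `(b - a)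
^ 2`. -/
theorem IsPoissonProcess.slice_le
    (h : IsPoissonProcess P Ψ ((volume.restrict (Set.Ioi (0 : ℝ))).prod ρ))
    (hy : ∀ᵐ ω ∂P, Ψ ω {y ω} ≠ 0 ∧ Ψ ω {x | x.1 < (y ω).1} = k)
    {a b : ℝ} (ha : 0 ≤ a) (hab : a ≤ b) {S : Set ℝ} (hS : MeasurableSet S) :
    P.real {ω | y ω ∈ Set.Ioc a b ×ˢ S} ≤
      ρ.real S * ((b - a) * erlangDensity k a) + (b - a) ^ 2 := by
  set A : Set (ℝ × ℝ) := Set.Ioc 0 a ×ˢ Set.univ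
  set B : Set (ℝ × ℝ) := Set.Ioc a b ×ˢ Set.univ
  set C : Set (ℝ × ℝ) := Set.Ioc a b ×ˢ S
  have hAm : MeasurableSet A := measurableSet_Ioc.prod .univ
  have hBm : MeasurableSet B := measurableSet_Ioc.prod .univ
  have hCm : MeasurableSet C := measurableSet_Ioc.prod hS
  have hA := prod_restrict_Ioi_zero_Ioc (ρ := ρ) (b := a) le_rfl Set.univ
  have hB := prod_restrict_Ioi_zero_Ioc (ρ := ρ) (b := b) ha Set.univ
  have hC := prod_restrict_Ioi_zero_Ioc (ρ := ρ) (b := b) ha S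
  rw [measure_univ, mul_one, sub_zero] at hA
  rw [measure_univ, mul_one] at hB
  set μ := (volume.restrict (Set.Ioi (0 : ℝ))).prod ρ
  have hAf : μ A < ∞ := by rw [hA]; simp
  have hBf : μ B < ∞ := by rw [hB]; simp
  have hCf : μ C < ∞ := by rw [hC]; exact ENNReal.mul_lt_top (by simp) (measure_lt_top _ _)
  have hNm : MeasurableSet {x : ℝ × ℝ | x.1 ≤ 0} := measurableSet_le measurable_fst measurable_const
  have hN : μ {x | x.1 ≤ 0} = 0 := by
    have : {x : ℝ × ℝ | x.1 ≤ 0} = Set.Iic 0 ×ˢ Set.univ := by ext; simp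
    rw [this, Measure.prod_prod, Measure.restrict_apply measurableSet_Iic, Set.Iic_inter_Ioi,
      Set.Ioc_self, measure_empty, zero_mul]
  have hsub : ∀ᵐ ω ∂P, y ω ∈ C → (Ψ ω A = k ∧ Ψ ω C ≠ 0) ∨ (Ψ ω B ≠ 0 ∧ Ψ ω B ≠ 1) := by
    filter_upwards [hy, h.ae_count_eq_nat hAm hAf, h.ae_count_eq_nat hBm hBf,
      h.ae_count_eq_zero hNm hN] with ω ⟨h1, h2⟩ ⟨i, hi⟩ ⟨j, hj⟩ h0 hyC
    have hCne : Ψ ω C ≠ 0 := fun e => h1 (measure_mono_null (Set.singleton_subset_iff.2 hyC) e)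
    by_cases hk : Ψ ω A = k
    · exact Or.inl ⟨hk, hCne⟩
    right
    have hBne : Ψ ω B ≠ 0 := fun e => hCne
      (measure_mono_null (Set.prod_mono_right (Set.subset_univ _)) e)
    refine ⟨hBne, fun hB1 => ?_⟩
    have hyB : y ω ∈ B := ⟨hyC.1, trivial⟩
    -- Points of the slice before the selected one. With fewer than `k` points in `A`, `L` has mass
    -- at least `1`; adding the selected point contradicts mass `1` on the slice.
    set L : Set (ℝ × ℝ) := {x | a < x.1 ∧ x.1 < (y ω).1} with hL
    have hLm : MeasurableSet L := (measurableSet_lt measurable_const measurable_fst).inter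
      (measurableSet_lt measurable_fst measurable_const)
    have hle : Ψ ω L + Ψ ω {y ω} ≤ Ψ ω B := by
      rw [← measure_union _ (measurableSet_singleton _)]
      · refine measure_mono (Set.union_subset ?_ (Set.singleton_subset_iff.2 hyB))
        exact fun x hx => ⟨⟨hx.1, hx.2.le.trans hyC.1.2⟩, trivial⟩
      · rw [Set.disjoint_singleton_right]
        exact fun hx => lt_irrefl _ hx.2
    have hsplit : Ψ ω {x | x.1 < (y ω).1} ≤ Ψ ω A + Ψ ω L := by
      have hss : {x : ℝ × ℝ | x.1 < (y ω).1} ⊆ {x | x.1 ≤ 0} ∪ (A ∪ L) := by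
        intro x hx
        by_cases hx0 : x.1 ≤ 0
        · exact Or.inl hx0
        by_cases hxa : x.1 ≤ a
        · exact Or.inr (Or.inl ⟨⟨not_le.1 hx0, hxa⟩, trivial⟩)
        · exact Or.inr (Or.inr ⟨not_le.1 hxa, hx⟩)
      refine (measure_mono hss).trans ((measure_union_le _ _).trans ?_)
      rw [h0, zero_add]
      exact measure_union_le _ _
    have hAk : Ψ ω A ≤ k := by
      rw [← h2]
      exact measure_mono fun x hx => (hx.1.2.trans_lt hyC.1.1)
    have hik : i < k := by
      rw [hi] at hAk hk
      exact lt_of_le_of_ne (by exact_mod_cast hAk) (by exact_mod_cast hk)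
    have h1L : 1 ≤ Ψ ω L := by
      rw [h2, hi] at hsplit
      by_contra hlt
      have hlt' : (i : ℝ≥0∞) + Ψ ω L < i + 1 :=
        ENNReal.add_lt_add_left (ENNReal.natCast_ne_top i) (not_le.1 hlt)
      have : (k : ℝ≥0∞) < (i + 1 : ℕ) := by
        push_cast; exact hsplit.trans_lt hlt'
      have := Nat.cast_lt.1 this
      omega
    have : Ψ ω L + Ψ ω {y ω} ≤ Ψ ω L := by rw [hB1] at hle; exact hle.trans h1L
    have hLtop : Ψ ω L ≠ ∞ := ne_top_of_le_ne_top (by simp [hB1]) ((le_self_add).trans hle)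
    have h3 : Ψ ω {y ω} ≤ 0 := by
      rw [← ENNReal.add_le_add_iff_left hLtop, add_zero]; exact this
    exact h1 (le_antisymm h3 zero_le)
  have hindep : IndepFun (fun ω => Ψ ω A) (fun ω => Ψ ω C) P := by
    have := (h.indep 2 ![A, C] (by
      intro i; fin_cases i <;> assumption) (by
      have hd : Disjoint A C := by
        refine Set.disjoint_left.2 fun x hx hx' => ?_
        exact absurd hx.1.2 (not_le.2 hx'.1.1)
      intro i j hij
      fin_cases i <;> fin_cases j <;>
        first | exact absurd rfl hij | exact hd | exact hd.symm)).indepFun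
        (show (0 : Fin 2) ≠ 1 by decide)
    simpa using this
  have e1 : P {ω | Ψ ω A = k ∧ Ψ ω C ≠ 0} = P {ω | Ψ ω A = k} * P {ω | Ψ ω C ≠ 0} :=
    hindep.measure_inter_preimage_eq_mul _ _ (measurableSet_singleton (k : ℝ≥0∞))
      (measurableSet_singleton (0 : ℝ≥0∞)).compl
  have e2 : P {ω | Ψ ω A = k} = ENNReal.ofReal (erlangDensity k a) := by
    rw [h.measure_count_eq hAm hAf, hA, ENNReal.toReal_ofReal ha, erlangDensity]
  have e3 : P.real {ω | Ψ ω C ≠ 0} ≤ ρ.real S * (b - a) := by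
    have hc : P.real {ω | Ψ ω C = 0} = Real.exp (-(μ C).toReal) := by
      have := h.measure_count_eq hCm hCf 0
      simp only [Nat.cast_zero, pow_zero, mul_one, Nat.factorial_zero, Nat.cast_one,
        div_one] at this
      rw [measureReal_def, this, ENNReal.toReal_ofReal (Real.exp_pos _).le]
    have : P.real {ω | Ψ ω C ≠ 0} = 1 - P.real {ω | Ψ ω C = 0} := by
      have hm : MeasurableSet {ω | Ψ ω C = 0} :=
        h.measurable_apply hCm (measurableSet_singleton 0)
      rw [← probReal_compl_eq_one_sub hm]
      rfl
    rw [this, hc, hC, ENNReal.toReal_mul, ENNReal.toReal_ofReal (by linarith)]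
    have := Real.add_one_le_exp (-((b - a) * (ρ S).toReal))
    rw [measureReal_def]
    linarith
  have e4 : P.real {ω | Ψ ω B ≠ 0 ∧ Ψ ω B ≠ 1} ≤ (b - a) ^ 2 := by
    have hc (i : ℕ) : P.real {ω | Ψ ω B = i} = erlangDensity i (b - a) := by
      have hab' : 0 ≤ b - a := by linarith
      rw [measureReal_def, h.measure_count_eq hBm hBf, hB, ENNReal.toReal_ofReal hab']
      exact ENNReal.toReal_ofReal (erlangDensity_nonneg i hab')
    have hm (i : ℕ) : MeasurableSet {ω | Ψ ω B = i} :=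
      h.measurable_apply hBm (measurableSet_singleton (i : ℝ≥0∞))
    have h01 : P.real ({ω | Ψ ω B = (0 : ℕ)} ∪ {ω | Ψ ω B = (1 : ℕ)}) =
        erlangDensity 0 (b - a) + erlangDensity 1 (b - a) := by
      rw [measureReal_union _ (hm 1), hc, hc]
      refine Set.disjoint_left.2 fun ω h0 h1 => ?_
      simp only [Set.mem_ofPred_eq] at h0 h1
      rw [h0] at h1
      exact absurd (Nat.cast_injective h1) (by decide)
    have : {ω | Ψ ω B ≠ 0 ∧ Ψ ω B ≠ 1} = ({ω | Ψ ω B = (0 : ℕ)} ∪ {ω | Ψ ω B = (1 : ℕ)})ᶜ := by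
      ext ω; simp
    rw [this, probReal_compl_eq_one_sub ((hm 0).union (hm 1)), h01]
    have hx : 0 ≤ b - a := by linarith
    simp only [erlangDensity, pow_zero, pow_one, Nat.factorial]
    -- With `x = b - a`, multiplying `1 - x ≤ exp (-x)` by `1 + x` gives `1 - (1 + x) exp (-x) ≤ x ^
    -- 2`.
    have := Real.add_one_le_exp (-(b - a))
    push_cast
    nlinarith [mul_le_mul_of_nonneg_right this (show 0 ≤ 1 + (b - a) by linarith)]
  calc P.real {ω | y ω ∈ C}
      ≤ P.real ({ω | Ψ ω A = k ∧ Ψ ω C ≠ 0} ∪ {ω | Ψ ω B ≠ 0 ∧ Ψ ω B ≠ 1}) := by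
        rw [measureReal_def, measureReal_def]
        exact ENNReal.toReal_mono (measure_ne_top _ _) (measure_mono_ae (by
          filter_upwards [hsub] with ω hω hC using hω hC))
    _ ≤ _ := measureReal_union_le _ _
    _ ≤ _ := by
      refine add_le_add ?_ e4
      rw [measureReal_def, e1, e2, ENNReal.toReal_mul, ENNReal.toReal_ofReal
        (erlangDensity_nonneg k ha), ← measureReal_def]
      calc _ ≤ erlangDensity k a * (ρ.real S * (b - a)) :=
            mul_le_mul_of_nonneg_left e3 (erlangDensity_nonneg k ha)
        _ = _ := by ring

theorem IsPoissonProcess.ae_nthPoint_pos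
    (h : IsPoissonProcess P Ψ ((volume.restrict (Set.Ioi (0 : ℝ))).prod ρ))
    (hy : ∀ᵐ ω ∂P, Ψ ω {y ω} ≠ 0 ∧ Ψ ω {x | x.1 < (y ω).1} = k) :
    ∀ᵐ ω ∂P, 0 < (y ω).1 := by
  have hNm : MeasurableSet {x : ℝ × ℝ | x.1 ≤ 0} := measurableSet_le measurable_fst measurable_const
  have hN : ((volume.restrict (Set.Ioi (0 : ℝ))).prod ρ) {x | x.1 ≤ 0} = 0 := by
    have : {x : ℝ × ℝ | x.1 ≤ 0} = Set.Iic 0 ×ˢ Set.univ := by ext; simp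
    rw [this, Measure.prod_prod, Measure.restrict_apply measurableSet_Iic, Set.Iic_inter_Ioi,
      Set.Ioc_self, measure_empty, zero_mul]
  filter_upwards [hy, h.ae_count_eq_zero hNm hN] with ω h1 h2
  by_contra hle
  exact h1.1 (measure_mono_null (Set.singleton_subset_iff.2
    (show (y ω).1 ≤ 0 from not_lt.1 hle)) h2)

/-- The slice estimates over a fine partition add up to a Riemann sum of the Erlang density, and the
quadratic errors vanish in the limit. -/
theorem IsPoissonProcess.nthPoint_Ioc_le
    (h : IsPoissonProcess P Ψ ((volume.restrict (Set.Ioi (0 : ℝ))).prod ρ)) (hym : Measurable y)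
    (hy : ∀ᵐ ω ∂P, Ψ ω {y ω} ≠ 0 ∧ Ψ ω {x | x.1 < (y ω).1} = k)
    {a b : ℝ} (ha : 0 ≤ a) (hab : a ≤ b) {S : Set ℝ} (hS : MeasurableSet S) :
    (P.map y).real (Set.Ioc a b ×ˢ S) ≤ (gammaMeasure (k + 1) 1).real (Set.Ioc a b) * ρ.real S := by
  have : IsProbabilityMeasure (P.map y) := Measure.isProbabilityMeasure_map hym.aemeasurable
  obtain ⟨L, hL⟩ := ((contDiff_erlangDensity k).contDiffOn (s := Set.Icc a b)).locallyLipschitzOn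
    (convex_Icc a b) |>.exists_lipschitzOnWith_of_compact isCompact_Icc
  have hcont := (contDiff_erlangDensity k).continuous
  -- In `1 + L`, the `1` pays for two points in one slice and the Lipschitz constant `L` for
  -- replacing the density on the slice by its value at the left endpoint.
  have hD := le_of_forall_sub_le_sq (C := 1 + L) hab (D := fun x =>
    (P.map y).real (Set.Ioc a x ×ˢ S) - ρ.real S * ∫ t in a..x, erlangDensity k t) (by
      intro u v hu huv hvb
      have h1 : (P.map y).real (Set.Ioc a v ×ˢ S) = (P.map y).real (Set.Ioc a u ×ˢ S) +
          (P.map y).real (Set.Ioc u v ×ˢ S) := by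
        rw [← measureReal_union _ (measurableSet_Ioc.prod hS), ← Set.union_prod,
          Set.Ioc_union_Ioc_eq_Ioc hu huv]
        refine Set.disjoint_left.2 fun x h1 h2 => ?_
        exact absurd h1.1.2 (not_le.2 h2.1.1)
      have h2 : (∫ t in a..v, erlangDensity k t) = (∫ t in a..u, erlangDensity k t) +
          ∫ t in u..v, erlangDensity k t :=
        (intervalIntegral.integral_add_adjacent_intervals (hcont.intervalIntegrable _ _)
          (hcont.intervalIntegrable _ _)).symm
      have h3 : (v - u) * (erlangDensity k u - L * (v - u)) ≤ ∫ t in u..v, erlangDensity k t := by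
        have := intervalIntegral.integral_mono_on huv
          (intervalIntegrable_const (c := erlangDensity k u - L * (v - u)) (μ := volume))
          (hcont.intervalIntegrable u v) (fun x hx => by
            have hd := hL.dist_le_mul u ⟨hu, huv.trans hvb⟩ x ⟨hu.trans hx.1, hx.2.trans hvb⟩
            rw [Real.dist_eq, Real.dist_eq, abs_sub_comm u x,
              abs_of_nonneg (sub_nonneg.2 hx.1)] at hd
            have h4 := (le_abs_self _).trans hd
            have h5 : (L : ℝ) * (x - u) ≤ L * (v - u) := by
              gcongr
              exact hx.2
            linarith)
        rwa [intervalIntegral.integral_const, smul_eq_mul] at this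
      have h4 : (P.map y).real (Set.Ioc u v ×ˢ S) ≤
          ρ.real S * ((v - u) * erlangDensity k u) + (v - u) ^ 2 := by
        rw [map_measureReal_apply hym (measurableSet_Ioc.prod hS)]
        exact h.slice_le hy (ha.trans hu) huv hS
      have h5 : ρ.real S ≤ 1 := measureReal_le_one
      have h6 : 0 ≤ ρ.real S := measureReal_nonneg
      have h7 : 0 ≤ (L : ℝ) * (v - u) ^ 2 := by positivity
      simp only [h1, h2]
      nlinarith [mul_le_mul_of_nonneg_left h3 h6, mul_le_mul_of_nonneg_right h5 h7])
  simp only [Set.Ioc_self, Set.empty_prod, measureReal_empty, intervalIntegral.integral_same,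
    mul_zero, sub_zero] at hD
  rw [measureReal_def (gammaMeasure _ _), gammaMeasure_Ioc ha hab, ENNReal.toReal_ofReal]
  · linarith
  · exact intervalIntegral.integral_nonneg hab fun t ht => erlangDensity_nonneg k (ha.trans ht.1)

/-- The `(k + 1)`-st point, in the order of the first coordinate, of a Poisson process of unit rate
in the first coordinate with independent marks of law `ρ` in the second. -/
theorem IsPoissonProcess.map_nthPoint
    (h : IsPoissonProcess P Ψ ((volume.restrict (Set.Ioi (0 : ℝ))).prod ρ)) (hym : Measurable y)
    (hy : ∀ᵐ ω ∂P, Ψ ω {y ω} ≠ 0 ∧ Ψ ω {x | x.1 < (y ω).1} = k) :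
    P.map y = (gammaMeasure (k + 1) 1).prod ρ := by
  have : IsProbabilityMeasure (gammaMeasure ((k : ℝ) + 1) 1) :=
    isProbabilityMeasure_gammaMeasure (by positivity) one_pos
  have : IsProbabilityMeasure (P.map y) := Measure.isProbabilityMeasure_map hym.aemeasurable
  have hle {a b : ℝ} (ha : 0 ≤ a) (hab : a ≤ b) {S : Set ℝ} (hS : MeasurableSet S) :=
    h.nthPoint_Ioc_le hym hy ha hab hS
  set G := gammaMeasure ((k : ℝ) + 1) 1
  set ν := P.map y with hν
  have hν0 : ∀ S : Set ℝ, ν (Set.Iic 0 ×ˢ S) = 0 := by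
    intro S
    refine measure_mono_null (t := Set.Iic 0 ×ˢ Set.univ)
      (Set.prod_mono_right (Set.subset_univ S)) ?_
    rw [Measure.map_apply hym (measurableSet_Iic.prod .univ)]
    have := h.ae_nthPoint_pos hy
    rw [ae_iff] at this
    simpa [Set.preimage, Set.mem_prod] using this
  have hmono : Monotone fun n : ℕ => Set.Ioc (0 : ℝ) n := fun m n hmn =>
    Set.Ioc_subset_Ioc_right (by exact_mod_cast hmn)
  have hU : (⋃ n : ℕ, Set.Ioc (0 : ℝ) n) = Set.Ioi 0 := by
    ext x
    simp only [Set.mem_iUnion, Set.mem_Ioc, Set.mem_Ioi, exists_and_left, and_iff_left_iff_imp]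
    exact fun _ => exists_nat_ge x
  have hG1 : Tendsto (fun n : ℕ => G.real (Set.Ioc 0 (n : ℝ))) atTop (𝓝 1) := by
    have := tendsto_measure_iUnion_atTop (μ := G) hmono
    rw [hU, ← Set.compl_Iic, prob_compl_eq_one_sub measurableSet_Iic, gammaMeasure_Iic_zero,
      tsub_zero] at this
    exact (ENNReal.tendsto_toReal ENNReal.one_ne_top).comp this
  have hν1 : Tendsto (fun n : ℕ => ν.real (Set.Ioc 0 (n : ℝ) ×ˢ Set.univ)) atTop (𝓝 1) := by
    have := tendsto_measure_iUnion_atTop (μ := ν)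
      (s := fun n : ℕ => Set.Ioc (0 : ℝ) n ×ˢ (Set.univ : Set ℝ))
      (fun m n hmn => Set.prod_mono_left (hmono hmn))
    have hc : Set.Ioi (0 : ℝ) ×ˢ (Set.univ : Set ℝ) = (Set.Iic 0 ×ˢ Set.univ)ᶜ := by
      ext; simp
    rw [← Set.iUnion_prod_const, hU, hc,
      prob_compl_eq_one_sub (measurableSet_Iic.prod .univ), hν0, tsub_zero] at this
    exact (ENNReal.tendsto_toReal ENNReal.one_ne_top).comp this
  -- The reverse inequality comes from total mass: `(0, n] × univ` is split into the given rectangle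
  -- and two others, the upper bound is applied to those two, and as `n → ∞` both total masses tend
  -- to `1`.
  have heq {b : ℝ} (hb : 0 ≤ b) {S : Set ℝ} (hS : MeasurableSet S) :
      ν.real (Set.Ioc 0 b ×ˢ S) = G.real (Set.Ioc 0 b) * ρ.real S := by
    refine le_antisymm (hle le_rfl hb hS) ?_
    have key : ∀ᶠ n : ℕ in atTop, ν.real (Set.Ioc 0 (n : ℝ) ×ˢ Set.univ) ≤
        ν.real (Set.Ioc 0 b ×ˢ S) + (G.real (Set.Ioc 0 (n : ℝ)) - G.real (Set.Ioc 0 b) * ρ.real S) := by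
      obtain ⟨N, hN⟩ := exists_nat_ge b
      filter_upwards [eventually_ge_atTop N] with n hn
      have hbn : b ≤ n := hN.trans (by exact_mod_cast hn)
      have e1 : ν.real (Set.Ioc 0 (n : ℝ) ×ˢ Set.univ) ≤ ν.real (Set.Ioc 0 b ×ˢ S) +
          ν.real (Set.Ioc 0 b ×ˢ Sᶜ) + ν.real (Set.Ioc b n ×ˢ Set.univ) := by
        rw [← Set.Ioc_union_Ioc_eq_Ioc hb hbn, Set.union_prod]
        refine (measureReal_union_le _ _).trans (add_le_add_left ?_ _)
        rw [← Set.union_compl_self S, Set.prod_union]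
        exact measureReal_union_le _ _
      have e2 : G.real (Set.Ioc 0 (n : ℝ)) = G.real (Set.Ioc 0 b) + G.real (Set.Ioc b n) := by
        rw [← Set.Ioc_union_Ioc_eq_Ioc hb hbn, measureReal_union _ measurableSet_Ioc]
        exact Set.disjoint_left.2 fun x h1 h2 => absurd h1.2 (not_le.2 h2.1)
      have e3 := hle le_rfl hb hS.compl
      have e4 := hle hb hbn (S := Set.univ) .univ
      rw [probReal_compl_eq_one_sub hS] at e3
      rw [probReal_univ] at e4
      linarith
    have := le_of_tendsto_of_tendsto hν1 (tendsto_const_nhds.add (hG1.sub tendsto_const_nhds)) key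
    linarith
  refine (Measure.prod_eq fun s S hs hS => ?_).symm
  -- For fixed `S` both sides are finite measures of the first coordinate, determined by their
  -- values on half-lines.
  suffices hmeas : (ν.restrict (Set.univ ×ˢ S)).map Prod.fst = ρ S • G by
    have := congrArg (fun m : Measure ℝ => m s) hmeas
    simp only [Measure.map_apply measurable_fst hs, Measure.restrict_apply (measurable_fst hs),
      Measure.smul_apply, smul_eq_mul] at this
    rw [mul_comm, ← this]
    congr 1
    ext; simp
  have : IsFiniteMeasure ((ν.restrict (Set.univ ×ˢ S)).map Prod.fst) := inferInstance
  refine Measure.ext_of_Iic _ _ fun b => ?_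
  rw [Measure.map_apply measurable_fst measurableSet_Iic,
    Measure.restrict_apply (measurable_fst measurableSet_Iic), Measure.smul_apply, smul_eq_mul]
  have hset : Prod.fst ⁻¹' Set.Iic b ∩ Set.univ ×ˢ S = Set.Iic b ×ˢ S := by ext; simp
  rw [hset]
  rcases le_total b 0 with hb | hb
  · rw [measure_mono_null (Set.prod_mono_left (Set.Iic_subset_Iic.2 hb)) (hν0 S),
      measure_mono_null (Set.Iic_subset_Iic.2 hb) gammaMeasure_Iic_zero, mul_zero]
  · have h1 : ν (Set.Iic b ×ˢ S) = ν (Set.Ioc 0 b ×ˢ S) := by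
      refine le_antisymm ?_ (measure_mono (Set.prod_mono_left Set.Ioc_subset_Iic_self))
      rw [← Set.Iic_union_Ioc_eq_Iic hb, Set.union_prod]
      refine (measure_union_le _ _).trans ?_
      rw [hν0, zero_add]
    have h2 : G (Set.Iic b) = G (Set.Ioc 0 b) := by
      refine le_antisymm ?_ (measure_mono Set.Ioc_subset_Iic_self)
      rw [← Set.Iic_union_Ioc_eq_Iic hb]
      refine (measure_union_le _ _).trans ?_
      rw [gammaMeasure_Iic_zero, zero_add]
    rw [h1, h2, mul_comm, ← ENNReal.toReal_eq_toReal_iff' (measure_ne_top _ _)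
      (ENNReal.mul_ne_top (measure_ne_top _ _) (measure_ne_top _ _)), ENNReal.toReal_mul]
    exact heq hb hS

end NthPoint

/-! ### Distance and angle of the `n`-th nearest point in the plane. -/

theorem measurable_angle (c : ℂ) : Measurable fun z : ℂ => InnerProductGeometry.angle c z := by
  unfold InnerProductGeometry.angle
  fun_prop

theorem angle_ofReal_left {c : ℝ} (hc : 0 < c) {z : ℂ} (hz : z ≠ 0) :
    InnerProductGeometry.angle (c : ℂ) z = |z.arg| := by
  have h : (c : ℂ) = c • (1 : ℂ) := by simp
  rw [h, InnerProductGeometry.angle_smul_left_of_pos _ _ hc, Complex.angle_one_left hz]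

/-- The unsigned angle with the positive real axis is `|arg z|`, so folding `(-π, π)` onto `(0, π)`
doubles the density. -/
theorem setLIntegral_abs_Ioo (G : ℝ → ℝ≥0∞) :
    ∫⁻ θ in Set.Ioo (-Real.pi) Real.pi, G |θ| = 2 * ∫⁻ θ in Set.Ioo 0 Real.pi, G θ := by
  have hpi := Real.pi_pos
  have h1 : Set.Ioo (-Real.pi) Real.pi = Set.Ioc (-Real.pi) 0 ∪ Set.Ioo 0 Real.pi :=
    (Set.Ioc_union_Ioo_eq_Ioo (by linarith) hpi).symm
  have hd : Disjoint (Set.Ioc (-Real.pi) 0) (Set.Ioo 0 Real.pi) :=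
    Set.disjoint_left.2 fun x hx hx' => absurd hx.2 (not_le.2 hx'.1)
  have hR : ∫⁻ θ in Set.Ioo 0 Real.pi, G |θ| = ∫⁻ θ in Set.Ioo 0 Real.pi, G θ :=
    setLIntegral_congr_fun measurableSet_Ioo fun θ hθ => by rw [abs_of_pos hθ.1]
  have hL : ∫⁻ θ in Set.Ioc (-Real.pi) 0, G |θ| = ∫⁻ θ in Set.Ioo 0 Real.pi, G θ := by
    rw [setLIntegral_congr Ioo_ae_eq_Ioc.symm, ← hR]
    have := (Measure.measurePreserving_neg (volume : Measure ℝ)).setLIntegral_comp_preimage_emb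
      (MeasurableEquiv.neg ℝ).measurableEmbedding (fun θ => G |θ|) (Set.Ioo 0 Real.pi)
    rw [← this]
    simp
  rw [h1, lintegral_union measurableSet_Ioo hd, hL, hR, two_mul]

theorem lintegral_norm_angle {c : ℝ} (hc : 0 < c) {F : ℝ × ℝ → ℝ≥0∞} (hF : Measurable F) :
    ∫⁻ z : ℂ, F (‖z‖, InnerProductGeometry.angle (c : ℂ) z) =
      ∫⁻ r in Set.Ioi (0 : ℝ), ENNReal.ofReal r * (2 * ∫⁻ θ in Set.Ioo 0 Real.pi, F (r, θ)) := by
  rw [← Complex.lintegral_comp_polarCoord_symm, polarCoord_target]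
  have h1 : ∫⁻ p in Set.Ioi (0 : ℝ) ×ˢ Set.Ioo (-Real.pi) Real.pi, ENNReal.ofReal p.1 •
      F (‖Complex.polarCoord.symm p‖,
        InnerProductGeometry.angle (c : ℂ) (Complex.polarCoord.symm p)) =
      ∫⁻ p in Set.Ioi (0 : ℝ) ×ˢ Set.Ioo (-Real.pi) Real.pi,
        ENNReal.ofReal p.1 * F (p.1, |p.2|) := by
    refine setLIntegral_congr_fun (measurableSet_Ioi.prod measurableSet_Ioo) fun p hp => ?_
    have hp1 : 0 < p.1 := hp.1
    have hn : ‖Complex.polarCoord.symm p‖ = p.1 := by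
      rw [Complex.norm_polarCoord_symm, abs_of_pos hp1]
    have hne : Complex.polarCoord.symm p ≠ 0 := by
      rw [← norm_ne_zero_iff, hn]; exact hp1.ne'
    have ha : (Complex.polarCoord.symm p).arg = p.2 := by
      rw [Complex.polarCoord_symm_apply, Complex.ofReal_cos, Complex.ofReal_sin,
        Complex.arg_mul_cos_add_sin_mul_I hp1 ⟨hp.2.1, hp.2.2.le⟩]
    simp only [smul_eq_mul]
    rw [angle_ofReal_left hc hne, hn, ha]
  rw [h1, Measure.volume_eq_prod, ← Measure.prod_restrict, lintegral_prod _ (by fun_prop)]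
  refine lintegral_congr fun r => ?_
  rw [← setLIntegral_abs_Ioo fun θ => F (r, θ)]
  dsimp only
  exact lintegral_const_mul' _ _ ENNReal.ofReal_ne_top

theorem lintegral_comp_norm {F : ℝ → ℝ≥0∞} (hF : Measurable F) :
    ∫⁻ z : ℂ, F ‖z‖ = ∫⁻ r in Set.Ioi (0 : ℝ), ENNReal.ofReal (2 * Real.pi * r) * F r := by
  rw [lintegral_norm_angle (c := 1) one_pos (F := fun p => F p.1) (by fun_prop)]
  refine setLIntegral_congr_fun measurableSet_Ioi fun r hr => ?_
  simp only [setLIntegral_const, Real.volume_Ioo, sub_zero]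
  rw [ENNReal.ofReal_mul (by positivity), ENNReal.ofReal_mul (by positivity), ENNReal.ofReal_ofNat]
  ring

/-- The radial change of variables that maps area to length. -/
theorem lintegral_Ioi_area {a R : ℝ} (ha : 0 < a) (hR : 0 ≤ R) (H : ℝ → ℝ≥0∞) :
    ∫⁻ t in Set.Ioi (0 : ℝ), H t =
      ∫⁻ r in Set.Ioi R, ENNReal.ofReal (2 * a * r) * H (a * (r ^ 2 - R ^ 2)) := by
  have himg : (fun r : ℝ => a * (r ^ 2 - R ^ 2)) '' Set.Ioi R = Set.Ioi 0 := by
    ext t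
    simp only [Set.mem_image, Set.mem_Ioi]
    constructor
    · rintro ⟨r, hr, rfl⟩
      exact mul_pos ha (by nlinarith)
    · intro ht
      have h1 : 0 < t / a := div_pos ht ha
      refine ⟨√(t / a + R ^ 2), Real.lt_sqrt_of_sq_lt (by linarith), ?_⟩
      rw [Real.sq_sqrt (by positivity)]
      field_simp
      ring
  rw [← himg, lintegral_image_eq_lintegral_deriv_mul_of_monotoneOn measurableSet_Ioi
    (f' := fun r => 2 * a * r)]
  · intro r _
    refine ((((hasDerivAt_pow 2 r).sub_const (R ^ 2)).const_mul a).congr_deriv ?_).hasDerivWithinAt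
    push_cast
    ring
  · intro r hr s hs hrs
    have hr' : R < r := hr
    have : r ^ 2 ≤ s ^ 2 := by gcongr; linarith
    change a * (r ^ 2 - R ^ 2) ≤ a * (s ^ 2 - R ^ 2)
    gcongr

/-- The uniform law of the angle, on `[0, π]`. -/
noncomputable def angleLaw : Measure ℝ :=
  ENNReal.ofReal (1 / Real.pi) • volume.restrict (Set.Icc 0 Real.pi)

instance : IsProbabilityMeasure angleLaw := by
  refine ⟨?_⟩
  rw [angleLaw, Measure.smul_apply, Measure.restrict_apply_univ, Real.volume_Icc, smul_eq_mul,
    ← ENNReal.ofReal_mul (by positivity), sub_zero, one_div_mul_cancel Real.pi_ne_zero,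
    ENNReal.ofReal_one]

theorem lintegral_angleLaw (F : ℝ → ℝ≥0∞) :
    ∫⁻ θ, F θ ∂angleLaw = ENNReal.ofReal (1 / Real.pi) * ∫⁻ θ in Set.Ioo 0 Real.pi, F θ := by
  rw [angleLaw, lintegral_smul_measure, setLIntegral_congr Ioo_ae_eq_Icc.symm, smul_eq_mul]

/-- Coordinates in which a planar homogeneous process of intensity `ℓ` outside the disc of radius
`R` has unit rate in the first coordinate. -/
noncomputable def areaAngle (ℓ R c : ℝ) (z : ℂ) : ℝ × ℝ :=
  (ℓ * Real.pi * (‖z‖ ^ 2 - R ^ 2), InnerProductGeometry.angle (c : ℂ) z)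

theorem measurable_areaAngle (ℓ R c : ℝ) : Measurable (areaAngle ℓ R c) :=
  Measurable.prodMk (by fun_prop) (measurable_angle _)

/-- After folding, the intensity is `2 ℓ r dr dθ` on `0 < θ < π`. With `t = ℓ π (r² - R²)` it
becomes `dt` times `dθ / π`. -/
theorem map_areaAngle {ℓ R c : ℝ} (hℓ : 0 < ℓ) (hR : 0 ≤ R) (hc : 0 < c) :
    (ENNReal.ofReal ℓ • (volume : Measure ℂ).restrict {z : ℂ | R < ‖z‖}).map (areaAngle ℓ R c) =
      (volume.restrict (Set.Ioi (0 : ℝ))).prod angleLaw := by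
  have hpi := Real.pi_pos
  refine Measure.ext_of_lintegral _ fun F hF => ?_
  have hset : MeasurableSet {z : ℂ | R < ‖z‖} := measurableSet_lt measurable_const measurable_norm
  rw [lintegral_map hF (measurable_areaAngle ℓ R c), lintegral_smul_measure,
    ← lintegral_indicator hset, lintegral_prod _ hF.aemeasurable,
    lintegral_Ioi_area (mul_pos hℓ hpi) hR]
  have hI (G : ℝ → ℝ≥0∞) : ∫⁻ r in Set.Ioi R, G r =
      ∫⁻ r in Set.Ioi 0, (Set.Ioi R).indicator G r := by
    rw [setLIntegral_indicator measurableSet_Ioi, Set.inter_eq_left.2 (Set.Ioi_subset_Ioi hR)]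
  have h1 : ∫⁻ z : ℂ, {z : ℂ | R < ‖z‖}.indicator (fun z => F (areaAngle ℓ R c z)) z =
      ∫⁻ z : ℂ, (fun p : ℝ × ℝ => (Set.Ioi R ×ˢ Set.univ).indicator
        (fun p : ℝ × ℝ => F (ℓ * Real.pi * (p.1 ^ 2 - R ^ 2), p.2)) p)
        (‖z‖, InnerProductGeometry.angle (c : ℂ) z) := by
    refine lintegral_congr fun z => ?_
    by_cases hz : R < ‖z‖
    · simp [Set.indicator, hz, areaAngle]
    · simp [Set.indicator, hz]
  rw [h1, lintegral_norm_angle hc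
    (Measurable.indicator (by fun_prop) (measurableSet_Ioi.prod MeasurableSet.univ)),
    smul_eq_mul, ← lintegral_const_mul' _ _ ENNReal.ofReal_ne_top, hI]
  refine setLIntegral_congr_fun measurableSet_Ioi fun r hr => ?_
  have hr' : 0 < r := hr
  by_cases hRr : R < r
  · simp only [Set.indicator, Set.mem_prod, Set.mem_Ioi, hRr, Set.mem_univ, and_self, if_true]
    rw [lintegral_angleLaw, ← mul_assoc, ← mul_assoc, ← mul_assoc]
    congr 1
    rw [← ENNReal.ofReal_mul (by positivity), ← ENNReal.ofReal_mul (by positivity),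
      ← ENNReal.ofReal_ofNat 2, ← ENNReal.ofReal_mul (by positivity)]
    congr 1
    field_simp
  · simp [Set.indicator, hRr]

theorem lintegral_gammaMeasure_erlang {k : ℕ} (H : ℝ → ℝ≥0∞) :
    ∫⁻ t, H t ∂(gammaMeasure (k + 1) 1) =
      ∫⁻ t in Set.Ioi (0 : ℝ), ENNReal.ofReal (erlangDensity k t) * H t := by
  have hm : Measurable (gammaPDF ((k : ℝ) + 1) 1) :=
    (measurable_gammaPDFReal _ _).ennreal_ofReal
  have hG : gammaMeasure ((k : ℝ) + 1) 1 =
      (volume.restrict (Set.Ioi (0 : ℝ))).withDensity (gammaPDF ((k : ℝ) + 1) 1) := by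
    rw [← restrict_withDensity measurableSet_Ioi]
    refine (Measure.restrict_eq_self_of_ae_mem ?_).symm
    have := gammaMeasure_Iic_zero (a := (k : ℝ) + 1) (r := 1)
    rw [ae_iff]
    convert this using 2
    ext; simp
  rw [hG, lintegral_withDensity_eq_lintegral_mul_non_measurable₀ _ hm.aemeasurable
      (ae_of_all _ fun t => by simp [gammaPDF])]
  refine setLIntegral_congr_fun measurableSet_Ioi fun t ht => ?_
  have ht' : 0 < t := ht
  simp only [Pi.mul_apply]
  rw [gammaPDF_of_nonneg ht'.le, erlangDensity]
  congr 2
  simp only [add_sub_cancel_right, Real.rpow_natCast, Real.one_rpow, one_mul,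
    Real.Gamma_nat_eq_factorial]
  ring

/-- The joint law of the distance and the angle of the `(k + 1)`-st nearest point of a planar
homogeneous Poisson process outside the disc of radius `R`. -/
theorem IsPoissonProcess.lintegral_nthNearest {Ω : Type*} [MeasurableSpace Ω] {P : Measure Ω}
    [IsProbabilityMeasure P] {Φ : Ω → Measure ℂ} {ℓ R c : ℝ} (hℓ : 0 < ℓ) (hR : 0 ≤ R) (hc : 0 < c)
    (h : IsPoissonProcess P Φ (ENNReal.ofReal ℓ • (volume : Measure ℂ).restrict {z : ℂ | R < ‖z‖}))
    {y : Ω → ℂ} (hym : Measurable y) {k : ℕ}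
    (hy : ∀ᵐ ω ∂P, Φ ω {y ω} ≠ 0 ∧ Φ ω (Metric.ball 0 ‖y ω‖) = k)
    {H : ℝ × ℝ → ℝ≥0∞} (hH : Measurable H) :
    ∫⁻ ω, H (‖y ω‖, InnerProductGeometry.angle (c : ℂ) (y ω)) ∂P =
      ∫⁻ r in Set.Ioi R, ∫⁻ β in Set.Ioo 0 Real.pi, H (r, β) *
        ENNReal.ofReal (2 * (ℓ * Real.pi) * r * erlangDensity k (ℓ * Real.pi * (r ^ 2 - R ^ 2))) *
        ENNReal.ofReal (1 / Real.pi) := by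
  have hpi := Real.pi_pos
  have hg := measurable_areaAngle ℓ R c
  have hmap := h.map hg
  rw [map_areaAngle hℓ hR hc] at hmap
  -- The first coordinate is strictly increasing in the norm, so "nearer" and "smaller first
  -- coordinate" agree and the rank is preserved.
  have hlaw := hmap.map_nthPoint (y := fun ω => areaAngle ℓ R c (y ω)) (k := k) (hg.comp hym) (by
    filter_upwards [hy] with ω ⟨h1, h2⟩
    constructor
    · intro h0
      rw [Measure.map_apply hg (measurableSet_singleton _)] at h0
      exact h1 (measure_mono_null (by intro z hz; rw [Set.mem_singleton_iff.1 hz]; rfl) h0)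
    · rw [Measure.map_apply hg (measurableSet_lt measurable_fst measurable_const), ← h2]
      congr 1
      ext z
      simp only [Set.mem_preimage, Set.mem_ofPred_eq, Metric.mem_ball, dist_zero_right, areaAngle]
      rw [mul_lt_mul_iff_right₀ (by positivity), sub_lt_sub_iff_right,
        sq_lt_sq₀ (norm_nonneg _) (norm_nonneg _)])
  -- This inverts the area coordinate and recovers the norm.
  set Ψ : ℝ × ℝ → ℝ × ℝ := fun p => (√(p.1 / (ℓ * Real.pi) + R ^ 2), p.2) with hΨ
  have hΨm : Measurable Ψ := by fun_prop
  have e1 (ω : Ω) : H (‖y ω‖, InnerProductGeometry.angle (c : ℂ) (y ω)) =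
      H (Ψ (areaAngle ℓ R c (y ω))) := by
    rw [hΨ, areaAngle]
    simp only
    rw [mul_div_cancel_left₀ _ (by positivity), sub_add_cancel, Real.sqrt_sq (norm_nonneg _)]
  simp_rw [e1]
  rw [← lintegral_map (f := fun p => H (Ψ p)) (hH.comp hΨm) (g := fun ω => areaAngle ℓ R c (y ω))
      (hg.comp hym), hlaw,
    lintegral_prod (fun p => H (Ψ p)) (hH.comp hΨm).aemeasurable, lintegral_gammaMeasure_erlang,
    lintegral_Ioi_area (mul_pos hℓ hpi) hR]
  refine setLIntegral_congr_fun measurableSet_Ioi fun r hr => ?_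
  have hr' : R < r := hr
  have hr0 : 0 ≤ r := hR.trans hr'.le
  have hs : √(ℓ * Real.pi * (r ^ 2 - R ^ 2) / (ℓ * Real.pi) + R ^ 2) = r := by
    rw [mul_div_cancel_left₀ _ (by positivity), sub_add_cancel, Real.sqrt_sq (by linarith)]
  simp only [hΨ, hs]
  rw [lintegral_angleLaw, lintegral_mul_const _ (by fun_prop), lintegral_mul_const _ (by fun_prop),
    ENNReal.ofReal_mul (p := 2 * (ℓ * Real.pi) * r) (by positivity)]
  ring

/-- Almost surely no other station lies in the closed disc of radius `R₁`. The source is thus the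
nearest point, and of the `n - 1` points nearer than the receiver `n - 2` belong to `Φ`. -/
theorem otherIntensity_nthNearest {Ω : Type*} [MeasurableSpace Ω] {P : Measure Ω}
    [IsProbabilityMeasure P] {p : Params} {Φ : Ω → Measure ℂ} {R₁ : ℝ} (hR₁ : 0 < R₁)
    (h : IsPoissonProcess P Φ (otherIntensity p R₁)) {y : Ω → ℂ} {n : ℕ} (hn : 2 ≤ n)
    (hy : ∀ᵐ ω ∂P, IsNthNearest (Measure.dirac (R₁ : ℂ) + Φ ω) n (y ω)) :
    ∀ᵐ ω ∂P, Φ ω {y ω} ≠ 0 ∧ Φ ω (Metric.ball 0 ‖y ω‖) = (n - 2 : ℕ) ∧ R₁ < ‖y ω‖ := by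
  have hN : MeasurableSet {z : ℂ | ‖z‖ ≤ R₁} := measurableSet_le measurable_norm measurable_const
  have h0 : otherIntensity p R₁ {z | ‖z‖ ≤ R₁} = 0 := by
    rw [otherIntensity, Measure.smul_apply, Measure.restrict_apply hN]
    have : {z : ℂ | ‖z‖ ≤ R₁} ∩ {z | R₁ < ‖z‖} = ∅ := by
      ext z; simp
    simp [this]
  filter_upwards [hy, h.ae_count_eq_zero hN h0] with ω ⟨h1, h2⟩ h3
  have hRn : ‖(R₁ : ℂ)‖ = R₁ := by simp [abs_of_pos hR₁]
  have hlt : R₁ < ‖y ω‖ := by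
    by_contra hle
    rw [not_lt] at hle
    have hb : Φ ω (Metric.ball 0 ‖y ω‖) = 0 := by
      refine measure_mono_null (fun z hz => ?_) h3
      rw [mem_ball_zero_iff] at hz
      exact hz.le.trans hle
    have hd : (Measure.dirac (R₁ : ℂ)) (Metric.ball 0 ‖y ω‖) = 0 := by
      rw [Measure.dirac_apply' _ measurableSet_ball, Set.indicator_of_notMem]
      rw [mem_ball_zero_iff, hRn]
      exact not_lt.2 hle
    -- At distance at most `R₁` the open ball contains neither the source nor another station, which
    -- would make the rank `1`.
    rw [Measure.add_apply, hb, hd, zero_add, zero_add] at h2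
    have : 1 = n := by exact_mod_cast h2
    omega
  refine ⟨?_, ?_, hlt⟩
  · rw [Measure.add_apply, Measure.dirac_apply' _ (measurableSet_singleton _),
      Set.indicator_of_notMem, zero_add] at h1
    · exact h1
    · intro he
      rw [Set.mem_singleton_iff.1 he] at hRn
      exact hlt.ne' hRn
  · rw [Measure.add_apply, Measure.dirac_apply' _ measurableSet_ball, Set.indicator_of_mem] at h2
    · have h5 : (n : ℝ≥0∞) = (n - 2 : ℕ) + 2 := by
        exact_mod_cast (by omega : n = n - 2 + 2)
      rw [h5, Pi.one_apply, add_comm (1 : ℝ≥0∞), add_assoc, one_add_one_eq_two] at h2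
      exact (ENNReal.add_left_inj (by simp)).1 h2
    · rw [mem_ball_zero_iff, hRn]; exact hlt

theorem lintegral_nthNearest_other {Ω : Type*} [MeasurableSpace Ω] {P : Measure Ω}
    [IsProbabilityMeasure P] {p : Params} {Φ : Ω → Measure ℂ} {R₁ : ℝ} (hR₁ : 0 < R₁)
    (h : IsPoissonProcess P Φ (otherIntensity p R₁)) {y : Ω → ℂ} (hym : Measurable y) {n : ℕ}
    (hn : 2 ≤ n) (hy : ∀ᵐ ω ∂P, IsNthNearest (Measure.dirac (R₁ : ℂ) + Φ ω) n (y ω))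
    {H : ℝ × ℝ → ℝ≥0∞} (hH : Measurable H) :
    ∫⁻ ω, H (‖y ω‖, InnerProductGeometry.angle (R₁ : ℂ) (y ω)) ∂P =
      ∫⁻ r in Set.Ioi R₁, ∫⁻ β in Set.Ioo 0 Real.pi, H (r, β) *
        ENNReal.ofReal (p.nthDensity n R₁ r) * ENNReal.ofReal (1 / Real.pi) := by
  rw [IsPoissonProcess.lintegral_nthNearest p.lamBS_pos hR₁.le hR₁ h hym
    ((otherIntensity_nthNearest hR₁ h hn hy).mono fun ω hω => ⟨hω.1, hω.2.1⟩) hH]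
  refine lintegral_congr fun r => lintegral_congr fun β => ?_
  congr 3
  -- `nthDensity` is the Erlang density of order `n - 2` in the area coordinate, times the
  -- derivative of that coordinate.
  obtain ⟨k, rfl⟩ : ∃ k, n = k + 2 := ⟨n - 2, by omega⟩
  have e : k + 2 - 1 = k + 1 := rfl
  rw [Params.nthDensity, erlangDensity, Nat.add_sub_cancel, e, mul_pow, pow_succ]
  ring

/-- The case `R = 0`, `k = 0`: the complement of the origin has full measure, the reference
direction is arbitrary, and the angle integrates out. -/
theorem lintegral_nearest {Ω : Type*} [MeasurableSpace Ω] {P : Measure Ω}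
    [IsProbabilityMeasure P] {ℓ : ℝ} (hℓ : 0 < ℓ) {Φ : Ω → Measure ℂ}
    (h : IsPoissonProcess P Φ (ENNReal.ofReal ℓ • (volume : Measure ℂ))) {y : Ω → ℂ}
    (hym : Measurable y) (hy : ∀ᵐ ω ∂P, IsNthNearest (Φ ω) 1 (y ω))
    {H : ℝ → ℝ≥0∞} (hH : Measurable H) :
    ∫⁻ ω, H ‖y ω‖ ∂P = ∫⁻ r in Set.Ioi (0 : ℝ), H r *
        ENNReal.ofReal (2 * Real.pi * ℓ * r * Real.exp (-(Real.pi * ℓ * r ^ 2))) := by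
  have hv : (volume : Measure ℂ).restrict {z : ℂ | 0 < ‖z‖} = volume := by
    refine Measure.restrict_eq_self_of_ae_mem ?_
    rw [ae_iff]
    have : {z : ℂ | z ∉ {z : ℂ | 0 < ‖z‖}} = {0} := by ext; simp
    rw [this, measure_singleton]
  rw [← hv] at h
  rw [IsPoissonProcess.lintegral_nthNearest hℓ le_rfl one_pos h hym (k := 0)
    (hy.mono fun ω hω => ⟨hω.1, ?_⟩) (H := fun q => H q.1) (by fun_prop)]
  · refine lintegral_congr fun r => ?_
    simp only [lintegral_const, MeasurableSet.univ, Measure.restrict_apply, Set.univ_inter,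
      Real.volume_Ioo, sub_zero]
    rw [mul_assoc, ← ENNReal.ofReal_mul (by positivity), one_div_mul_cancel Real.pi_ne_zero,
      ENNReal.ofReal_one, mul_one, erlangDensity]
    congr 2
    simp
    ring_nf
  · have := hω.2
    simpa using this

/-! ### Gamma and exponential variables. -/

/-- Exponential tilting: `exp (-b x)` times the Gamma density of rate `r` is a constant times the
Gamma density of rate `r + b`, which integrates to `1`. -/
theorem lintegral_expNeg_gammaMeasure {m r b : ℝ} (hm : 0 < m) (hr : 0 < r) (hb : 0 ≤ b) :
    ∫⁻ x, expNeg (ENNReal.ofReal (b * x)) ∂(gammaMeasure m r) =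
      ENNReal.ofReal ((1 + b / r) ^ (-m)) := by
  have hmeas (r : ℝ) : Measurable (gammaPDF m r) := (measurable_gammaPDFReal _ _).ennreal_ofReal
  rw [gammaMeasure, lintegral_withDensity_eq_lintegral_mul _ (hmeas r) (by fun_prop)]
  have key (x : ℝ) : (gammaPDF m r * fun x => expNeg (ENNReal.ofReal (b * x))) x =
      ENNReal.ofReal ((1 + b / r) ^ (-m)) * gammaPDF m (r + b) x := by
    rw [Pi.mul_apply]
    rcases lt_or_ge x 0 with hx | hx
    · rw [gammaPDF_of_neg hx, gammaPDF_of_neg hx, zero_mul, mul_zero]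
    · have hrb : 0 < r + b := by linarith
      rw [gammaPDF_of_nonneg hx, gammaPDF_of_nonneg hx, expNeg_ofReal (by positivity),
        ← ENNReal.ofReal_mul (by have := Real.Gamma_pos_of_pos hm; positivity),
        ← ENNReal.ofReal_mul (by positivity)]
      congr 1
      have h1 : 1 + b / r = (r + b) / r := by field_simp
      rw [h1, Real.rpow_neg (by positivity), Real.div_rpow hrb.le hr.le,
        show -((r + b) * x) = -(r * x) + -(b * x) by ring, Real.exp_add]
      have h2 : 0 < (r + b) ^ m := Real.rpow_pos_of_pos hrb m
      have h3 : 0 < r ^ m := Real.rpow_pos_of_pos hr m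
      field_simp
  simp_rw [key]
  rw [lintegral_const_mul _ (hmeas _), lintegral_gammaPDF_eq_one hm (by linarith), mul_one]

theorem lintegral_expNeg_expMeasure {σ b : ℝ} (hσ : 0 < σ) (hb : 0 ≤ b) :
    ∫⁻ x, expNeg (ENNReal.ofReal (b * x)) ∂(expMeasure (1 / σ)) =
      ENNReal.ofReal (1 / (1 + b * σ)) := by
  rw [expMeasure, lintegral_expNeg_gammaMeasure one_pos (by positivity) hb, Real.rpow_neg_one,
    one_div, one_div, div_inv_eq_mul]

theorem expMeasure_Ioi {r y : ℝ} (hr : 0 < r) (hy : 0 ≤ y) :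
    expMeasure r (Set.Ioi y) = ENNReal.ofReal (Real.exp (-(r * y))) := by
  have := isProbabilityMeasure_expMeasure hr
  rw [← Set.compl_Iic, prob_compl_eq_one_sub measurableSet_Iic, ← ofReal_cdf,
    cdf_expMeasure_eq hr, if_pos hy, ← ENNReal.ofReal_one, ← ENNReal.ofReal_sub]
  · congr 1; ring
  · have : Real.exp (-(r * y)) ≤ 1 := Real.exp_le_one_iff.2 (by simpa using by positivity)
    linarith

/-- An exponential signal exceeds a possibly infinite threshold. -/
theorem expMeasure_signal {σ g : ℝ} (hσ : 0 < σ) (hg : 0 < g) (d : ℝ≥0∞) :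
    expMeasure (1 / σ) {x | d < ENNReal.ofReal (g * x)} =
      expNeg (ENNReal.ofReal (1 / (g * σ)) * d) := by
  induction d using ENNReal.recTopCoe with
  | top =>
    have : 0 < 1 / (g * σ) := by positivity
    rw [ENNReal.mul_top (ENNReal.ofReal_pos.2 this).ne', expNeg_top]
    simp
  | coe d =>
    have h : {x : ℝ | (d : ℝ≥0∞) < ENNReal.ofReal (g * x)} = Set.Ioi (d / g) := by
      ext x
      rw [Set.mem_ofPred_eq, ← ENNReal.ofReal_coe_nnreal, ENNReal.ofReal_lt_ofReal_iff_of_nonneg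
        d.coe_nonneg, Set.mem_Ioi, div_lt_iff₀' hg]
    rw [h, expMeasure_Ioi (by positivity) (by positivity), ← ENNReal.ofReal_coe_nnreal,
      ← ENNReal.ofReal_mul (by positivity), expNeg_ofReal (by positivity)]
    congr 3
    field_simp

/-! ### Laplace transforms of sums over marked Poisson processes. -/

section Reg

variable {Ω X A : Type*} [MeasurableSpace Ω] [MeasurableSpace X] [MeasurableSpace A]
  {P : Measure Ω} {Φ : Ω → Measure X} {μ : Measure X}

theorem measurable_lintegral_locallyFinitePart (μ : Measure X) [SigmaFinite μ]
    {Ψ : A → Measure X} (hΨ : Measurable Ψ) {f : A × X → ℝ≥0∞} (hf : Measurable f) :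
    Measurable fun a => ∫⁻ x, f (a, x) ∂(locallyFinitePart μ (Ψ a)) :=
  Measurable.lintegral_kernel_prod_right' (κ := Kernel.comap (locallyFinitePart μ) Ψ hΨ) hf

theorem measurable_setLIntegral_locallyFinitePart (μ : Measure X) [SigmaFinite μ]
    {Ψ : A → Measure X} (hΨ : Measurable Ψ) {s : A → Set X}
    (hs : MeasurableSet {q : A × X | q.2 ∈ s q.1}) {f : A × X → ℝ≥0∞} (hf : Measurable f) :
    Measurable fun a => ∫⁻ x in s a, f (a, x) ∂(locallyFinitePart μ (Ψ a)) := by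
  have h (a : A) : ∫⁻ x in s a, f (a, x) ∂(locallyFinitePart μ (Ψ a)) =
      ∫⁻ x, {q : A × X | q.2 ∈ s q.1}.indicator f (a, x) ∂(locallyFinitePart μ (Ψ a)) := by
    have hsa : MeasurableSet (s a) := measurable_prodMk_left (x := a) hs
    rw [← lintegral_indicator hsa]
    rfl
  simp_rw [h]
  exact measurable_lintegral_locallyFinitePart μ hΨ (hf.indicator hs)

theorem IsPoissonProcess.laplace_setLIntegral [SigmaFinite μ] [IsFiniteMeasure P]
    (h : IsPoissonProcess P Φ μ) {s : Set X} (hs : MeasurableSet s) {f : X → ℝ≥0∞}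
    (hf : Measurable f) :
    ∫⁻ ω, expNeg (∫⁻ x in s, f x ∂(locallyFinitePart μ (Φ ω))) ∂P =
      expNeg (∫⁻ x in s, (1 - expNeg (f x)) ∂μ) := by
  have h1 : ∫⁻ ω, expNeg (∫⁻ x in s, f x ∂(locallyFinitePart μ (Φ ω))) ∂P =
      ∫⁻ ω, expNeg (∫⁻ x, s.indicator f x ∂(Φ ω)) ∂P := by
    refine lintegral_congr_ae ?_
    filter_upwards [h.ae_locallyFinitePart_eq] with ω hω
    rw [hω, lintegral_indicator hs]
  rw [h1, h.laplace (hf.indicator hs), ← lintegral_indicator hs]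
  congr 1
  refine lintegral_congr fun x => ?_
  by_cases hx : x ∈ s <;> simp [hx, expNeg_zero]

end Reg

instance (m r : ℝ) : SigmaFinite (gammaMeasure m r) :=
  SigmaFinite.withDensity_ofReal _

instance (r : ℝ) : SigmaFinite (expMeasure r) :=
  inferInstanceAs (SigmaFinite (gammaMeasure 1 r))

instance (c : ℝ) : SigmaFinite (ENNReal.ofReal c • (volume : Measure ℂ)) :=
  inferInstanceAs (SigmaFinite (c.toNNReal • (volume : Measure ℂ)))

instance (a : ℝ → ℝ) : SigmaFinite (radialIntensity a) :=
  SigmaFinite.withDensity_ofReal _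

/-- The Laplace transform of the sum over the points, outside a disc, of an independently marked
Poisson process with radial intensity. -/
theorem IsPoissonProcess.laplace_radial {Ω Y : Type*} [MeasurableSpace Ω] [MeasurableSpace Y]
    {P : Measure Ω} [IsProbabilityMeasure P] {a : ℝ → ℝ} (ha : Measurable a) {θ : Measure Y}
    [IsProbabilityMeasure θ] {Ψ : Ω → Measure (ℂ × Y)}
    (h : IsPoissonProcess P Ψ ((radialIntensity a).prod θ)) {ρ : ℝ} (hρ : 0 ≤ ρ)
    {F : ℝ × Y → ℝ≥0∞} (hF : Measurable F) :
    ∫⁻ ω, expNeg (∫⁻ v in {v : ℂ × Y | ρ ≤ ‖v.1‖}, F (‖v.1‖, v.2)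
        ∂(locallyFinitePart ((radialIntensity a).prod θ) (Ψ ω))) ∂P =
      expNeg (∫⁻ r in Set.Ioi ρ, ENNReal.ofReal (2 * Real.pi * r) *
        (ENNReal.ofReal (a r) * (1 - ∫⁻ y, expNeg (F (r, y)) ∂θ))) := by
  have hs : MeasurableSet {v : ℂ × Y | ρ ≤ ‖v.1‖} :=
    measurableSet_le measurable_const (by fun_prop)
  have hset : {v : ℂ × Y | ρ ≤ ‖v.1‖} = {z : ℂ | ρ ≤ ‖z‖} ×ˢ Set.univ := by ext; simp
  have hsz : MeasurableSet {z : ℂ | ρ ≤ ‖z‖} := measurableSet_le measurable_const measurable_norm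
  have hG : Measurable fun r : ℝ => ∫⁻ y, expNeg (F (r, y)) ∂θ :=
    (measurable_expNeg.comp hF).lintegral_prod_right'
  rw [h.laplace_setLIntegral hs (by fun_prop)]
  congr 1
  rw [hset, ← Measure.prod_restrict, Measure.restrict_univ, lintegral_prod _ (by fun_prop)]
  have h1 (z : ℂ) : ∫⁻ y, (1 - expNeg (F (‖z‖, y))) ∂θ = 1 - ∫⁻ y, expNeg (F (‖z‖, y)) ∂θ := by
    rw [lintegral_sub (by fun_prop) _ (ae_of_all _ fun y => expNeg_le_one _)]
    · simp
    · refine ne_top_of_le_ne_top ENNReal.one_ne_top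
        ((lintegral_mono fun y => expNeg_le_one _).trans ?_)
      simp
  simp only [h1]
  rw [← lintegral_indicator hsz, radialIntensity, lintegral_withDensity_eq_lintegral_mul _
    (by fun_prop) (Measurable.indicator (by fun_prop) hsz)]
  have h2 (z : ℂ) : ((fun z : ℂ => ENNReal.ofReal (a ‖z‖)) * {z : ℂ | ρ ≤ ‖z‖}.indicator
      fun z => 1 - ∫⁻ y, expNeg (F (‖z‖, y)) ∂θ) z =
      (fun r : ℝ => (Set.Ici ρ).indicator
        (fun r => ENNReal.ofReal (a r) * (1 - ∫⁻ y, expNeg (F (r, y)) ∂θ)) r) ‖z‖ := by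
    by_cases hz : ρ ≤ ‖z‖ <;> simp [hz]
  simp_rw [h2]
  rw [lintegral_comp_norm (Measurable.indicator (by fun_prop) measurableSet_Ici)]
  have h3 (r : ℝ) : ENNReal.ofReal (2 * Real.pi * r) * (Set.Ici ρ).indicator
        (fun r => ENNReal.ofReal (a r) * (1 - ∫⁻ y, expNeg (F (r, y)) ∂θ)) r =
      (Set.Ici ρ).indicator (fun r => ENNReal.ofReal (2 * Real.pi * r) *
        (ENNReal.ofReal (a r) * (1 - ∫⁻ y, expNeg (F (r, y)) ∂θ))) r := by
    by_cases hr : ρ ≤ r <;> simp [hr]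
  simp_rw [h3]
  rw [setLIntegral_indicator measurableSet_Ici]
  refine setLIntegral_congr ?_
  refine (Filter.EventuallyEq.inter Ioi_ae_eq_Ici.symm (ae_eq_refl _)).trans ?_
  rw [Set.inter_eq_left.2 (Set.Ioi_subset_Ioi hρ)]
  exact ae_eq_refl _

/-- The Laplace transform of the intra-clutter sum over a region of the clutter process. -/
theorem IsPoissonProcess.laplace_clutter {Ω : Type*} [MeasurableSpace Ω] {P : Measure Ω}
    [IsProbabilityMeasure P] {lam σ : ℝ} (hlam : 0 ≤ lam) (hσ : 0 < σ)
    {Φ : Ω → Measure (ℂ × ℝ)}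
    (h : IsPoissonProcess P Φ
      ((ENNReal.ofReal lam • (volume : Measure ℂ)).prod (expMeasure (1 / σ))))
    {C : Set ℂ} (hC : MeasurableSet C) {A : ℝ} (hA : 0 ≤ A) (hCA : volume C = ENNReal.ofReal A)
    {b : ℝ} (hb : 0 ≤ b) :
    ∫⁻ ω, expNeg (∫⁻ x in {x : ℂ × ℝ | x.1 ∈ C}, ENNReal.ofReal (b * x.2) ∂(locallyFinitePart
        ((ENNReal.ofReal lam • (volume : Measure ℂ)).prod (expMeasure (1 / σ))) (Φ ω))) ∂P =
      ENNReal.ofReal (Real.exp (-(lam * A * (b * σ / (1 + b * σ))))) := by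
  have := isProbabilityMeasure_expMeasure (one_div_pos.2 hσ)
  have hset : {x : ℂ × ℝ | x.1 ∈ C} = C ×ˢ Set.univ := by ext; simp
  have hm : MeasurableSet {x : ℂ × ℝ | x.1 ∈ C} := measurable_fst hC
  rw [h.laplace_setLIntegral hm (by fun_prop), hset, ← Measure.prod_restrict,
    Measure.restrict_univ, lintegral_prod _ (by fun_prop)]
  have h1 : ∫⁻ y, (1 - expNeg (ENNReal.ofReal (b * y))) ∂(expMeasure (1 / σ)) =
      ENNReal.ofReal (b * σ / (1 + b * σ)) := by
    rw [lintegral_sub (by fun_prop) _ (ae_of_all _ fun y => expNeg_le_one _),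
      lintegral_expNeg_expMeasure hσ hb, lintegral_one, measure_univ, ← ENNReal.ofReal_one,
      ← ENNReal.ofReal_sub _ (by positivity)]
    · congr 1
      field_simp
      ring
    · rw [lintegral_expNeg_expMeasure hσ hb]; exact ENNReal.ofReal_ne_top
  simp only [h1, lintegral_const, Measure.restrict_apply_univ, Measure.smul_apply, smul_eq_mul, hCA]
  rw [← ENNReal.ofReal_mul hlam, ← ENNReal.ofReal_mul (by positivity),
    expNeg_ofReal (by positivity)]
  congr 3
  ring

/-! ### The received powers for a fixed geometry, and their Laplace transforms. -/

namespace Params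

variable (p : Params)

/-- Intensity of the clutter, marked with its radar cross-sections. -/
noncomputable abbrev clutterIntensity : Measure (ℂ × ℝ) :=
  (ENNReal.ofReal p.lamCl • (volume : Measure ℂ)).prod (expMeasure (1 / p.σc))

/-- Intensity of the LoS co-channel base stations around the target. -/
noncomputable abbrev icIntensity : Measure ℂ :=
  radialIntensity fun r => p.pLOS r * p.lamBS / p.M

/-- The gain of the echo per unit of monostatic radar cross-section, for a receiver at `z`. -/
noncomputable def echoGain (R₁ : ℝ) (z : ℂ) : ℝ :=
  p.radarGain * Real.cos (InnerProductGeometry.angle (R₁ : ℂ) z / 2) / (R₁ ^ p.ηL * ‖z‖ ^ p.ηL)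

/-- Intra-clutter power at a receiver at `z`, for the clutter configuration `m`. -/
noncomputable def intraPower (cell : ℝ → ℝ → Set ℂ) (R₁ : ℝ) (z : ℂ) (m : Measure (ℂ × ℝ)) : ℝ≥0∞ :=
  ∫⁻ x in {x : ℂ × ℝ | x.1 ∈ cell ‖z‖ (InnerProductGeometry.angle (R₁ : ℂ) z)},
    ENNReal.ofReal (p.radarGain * (x.2 * Real.cos (InnerProductGeometry.angle (R₁ : ℂ) z / 2)) /
      (R₁ ^ p.ηL * ‖z‖ ^ p.ηL)) ∂m

/-- Inter-clutter power reflected by the target to a receiver at `z`, from the base stations of `m`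
at least as far as `w`. -/
noncomputable def targetPower (z w : ℂ) (θ : ℝ) (m : Measure (ℂ × ℝ)) : ℝ≥0∞ :=
  ∫⁻ v in {v : ℂ × ℝ | ‖w‖ ≤ ‖v.1‖},
    ENNReal.ofReal (p.radarGain * (v.2 * Real.cos (θ / 2)) / (‖v.1‖ ^ p.ηL * ‖z‖ ^ p.ηL)) ∂m

/-- Inter-clutter power reflected by clutter to a receiver at `z`, from the base stations of `m`
at least as far as `w`, each of which sees its own clutter through the map `k`. -/
noncomputable def clutterPower (cell : ℝ → ℝ → Set ℂ) (R₁ : ℝ)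
    (k : Measure (ℂ × ℝ) → Measure (ℂ × ℝ))
    (z w : ℂ) (θ : ℝ) (m : Measure (ℂ × Measure (ℂ × ℝ))) : ℝ≥0∞ :=
  ∫⁻ v in {v : ℂ × Measure (ℂ × ℝ) | ‖w‖ ≤ ‖v.1‖},
    (∫⁻ x in {x : ℂ × ℝ | x.1 ∈ cell ‖z‖ (InnerProductGeometry.angle (R₁ : ℂ) z)},
      ENNReal.ofReal (p.radarGain * (x.2 * Real.cos (θ / 2)) /
        (‖v.1‖ ^ p.ηL * ‖z‖ ^ p.ηL)) ∂(k v.2)) ∂m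

/-- Direct interference from the points of `m` at least as far as `w`. -/
noncomputable def directPower (C η : ℝ) (w : ℂ) (m : Measure (ℂ × ℝ)) : ℝ≥0∞ :=
  ∫⁻ v in {v : ℂ × ℝ | ‖w‖ ≤ ‖v.1‖},
    ENNReal.ofReal (p.Pc * v.2 * p.Gm ^ 2 * C * ‖v.1‖ ^ (-η)) ∂m

variable {p}

theorem radarGain_pos : 0 < p.radarGain := by
  have := p.Ps_pos
  have := p.Gm_pos
  have := p.wl_pos
  unfold radarGain
  positivity

theorem pLOS_pos (r : ℝ) : 0 < p.pLOS r := Real.exp_pos _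

theorem pLOS_le_one {r : ℝ} (hr : 0 ≤ r) : p.pLOS r ≤ 1 :=
  Real.exp_le_one_iff.2 (by nlinarith [mul_nonneg p.γ_nonneg hr])

@[fun_prop]
theorem measurable_pLOS : Measurable p.pLOS := by
  unfold pLOS
  fun_prop

theorem cellArea_nonneg {r β : ℝ} (hr : 0 ≤ r) : 0 ≤ p.cellArea r β := by
  have := p.c_pos
  have := p.Wb_pos
  have := Real.pi_pos
  unfold cellArea θB
  positivity

theorem cos_half_pos {β : ℝ} (h0 : 0 ≤ β) (h1 : β < Real.pi) : 0 < Real.cos (β / 2) :=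
  Real.cos_pos_of_mem_Ioo ⟨by linarith [Real.pi_pos], by linarith⟩

theorem cos_half_nonneg {β : ℝ} (h0 : 0 ≤ β) (h1 : β ≤ Real.pi) : 0 ≤ Real.cos (β / 2) :=
  Real.cos_nonneg_of_mem_Icc ⟨by linarith [Real.pi_pos], by linarith⟩

end Params

section Laplace

variable {Ω : Type*} [MeasurableSpace Ω] {P : Measure Ω} [IsProbabilityMeasure P] {p : Params}
  {cell : ℝ → ℝ → Set ℂ} {R₁ : ℝ}

theorem IsResolutionCell.measurableSet (h : IsResolutionCell p cell) (r β : ℝ) :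
    MeasurableSet (cell r β) :=
  (measurable_prodMk_left (x := r)).comp (measurable_prodMk_left (x := β)) h.measurable

/-- All scatterers of the cell share the gain of the target echo, so the scaled power is `b` times
the sum of their cross-sections. -/
theorem laplace_intraPower (hcell : IsResolutionCell p cell) {Φ : Ω → Measure (ℂ × ℝ)}
    (h : IsPoissonProcess P Φ p.clutterIntensity) {z : ℂ} (hz : 0 < ‖z‖)
    (hβ : InnerProductGeometry.angle (R₁ : ℂ) z < Real.pi) {a b : ℝ} (ha : 0 ≤ a) (hb : 0 ≤ b)
    (hab : a * p.echoGain R₁ z = b) :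
    ∫⁻ ω, expNeg (ENNReal.ofReal a * p.intraPower cell R₁ z
        (locallyFinitePart p.clutterIntensity (Φ ω))) ∂P =
      ENNReal.ofReal (Real.exp (-(p.lamCl *
        p.cellArea ‖z‖ (InnerProductGeometry.angle (R₁ : ℂ) z) * (b * p.σc / (1 + b * p.σc))))) := by
  rw [← h.laplace_clutter p.lamCl_nonneg p.σc_pos (hcell.measurableSet _ _)
    (Params.cellArea_nonneg hz.le) (hcell.area _ _ hz (InnerProductGeometry.angle_nonneg _ _) hβ) hb]
  refine lintegral_congr fun ω => ?_
  rw [Params.intraPower, ← lintegral_const_mul' _ _ ENNReal.ofReal_ne_top]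
  congr 1
  refine lintegral_congr fun x => ?_
  rw [← ENNReal.ofReal_mul ha, ← hab, Params.echoGain]
  congr 1
  ring

/-- Brings the integrand produced by `laplace_radial` to the shape of the formula, with the constant
outside; `x` is the transform of the mark. -/
theorem ofReal_radial_mul {c q x y r A : ℝ} (hr : 0 ≤ r) (hc : 0 ≤ c) (hq : 0 ≤ q) (hx : 0 ≤ x)
    (hy : y = q * (1 - x)) (hA : A = q * c) :
    ENNReal.ofReal (2 * Real.pi * r) * (ENNReal.ofReal A * (1 - ENNReal.ofReal x)) =
      ENNReal.ofReal (2 * Real.pi * c) * ENNReal.ofReal (y * r) := by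
  rw [hA, hy, ← ENNReal.ofReal_one, ← ENNReal.ofReal_sub _ hx, ← ENNReal.ofReal_mul (by positivity),
    ← ENNReal.ofReal_mul (by positivity), ← ENNReal.ofReal_mul (by positivity)]
  congr 1
  ring

theorem laplace_targetPower {Ψ : Ω → Measure (ℂ × ℝ)}
    (h : IsPoissonProcess P Ψ (p.icIntensity.prod (expMeasure (1 / p.σt)))) (z w : ℂ) {θ a s : ℝ}
    (hθ : 0 ≤ Real.cos (θ / 2)) (ha : 0 ≤ a) (hs : a * p.radarGain / ‖z‖ ^ p.ηL = s) :
    ∫⁻ ω, expNeg (ENNReal.ofReal a * p.targetPower z w θ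
        (locallyFinitePart (p.icIntensity.prod (expMeasure (1 / p.σt))) (Ψ ω))) ∂P =
      expNeg (ENNReal.ofReal (2 * Real.pi * p.lamBS / p.M) *
        ∫⁻ r in Set.Ioi ‖w‖, ENNReal.ofReal
          (p.pLOS r * (1 - 1 / (1 + s * Real.cos (θ / 2) * r ^ (-p.ηL) * p.σt)) * r)) := by
  have := isProbabilityMeasure_expMeasure (one_div_pos.2 p.σt_pos)
  have hs0 : 0 ≤ s := by
    have := p.radarGain_pos
    rw [← hs]; positivity
  have hlam := p.lamBS_pos
  have hσt := p.σt_pos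
  have hM : (0 : ℝ) < p.M := by exact_mod_cast p.M_pos
  have h1 := h.laplace_radial (by fun_prop) (norm_nonneg w)
    (F := fun v => ENNReal.ofReal (s * Real.cos (θ / 2) * v.1 ^ (-p.ηL) * v.2)) (by fun_prop)
  have h2 (ω : Ω) : ENNReal.ofReal a * p.targetPower z w θ
        (locallyFinitePart (p.icIntensity.prod (expMeasure (1 / p.σt))) (Ψ ω)) =
      ∫⁻ v in {v : ℂ × ℝ | ‖w‖ ≤ ‖v.1‖},
        ENNReal.ofReal (s * Real.cos (θ / 2) * ‖v.1‖ ^ (-p.ηL) * v.2)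
        ∂(locallyFinitePart (p.icIntensity.prod (expMeasure (1 / p.σt))) (Ψ ω)) := by
    rw [Params.targetPower, ← lintegral_const_mul' _ _ ENNReal.ofReal_ne_top]
    refine lintegral_congr fun x => ?_
    rw [← ENNReal.ofReal_mul ha, ← hs, Real.rpow_neg (norm_nonneg _)]
    congr 1
    ring
  simp_rw [h2]
  rw [h1, ← lintegral_const_mul' _ _ ENNReal.ofReal_ne_top]
  congr 1
  refine setLIntegral_congr_fun measurableSet_Ioi fun r hr => ?_
  have hr0 : 0 ≤ r := (norm_nonneg w).trans (le_of_lt hr)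
  simp only
  rw [lintegral_expNeg_expMeasure p.σt_pos (by positivity), mul_div_assoc (2 * Real.pi)]
  exact ofReal_radial_mul hr0 (by positivity) (p.pLOS_pos r).le (by positivity) rfl (by ring)

/-- A cluster process: the mark of an interferer is a whole clutter configuration, and the transform
of that mark is itself given by `laplace_clutter`. The Laplace functional is thus used twice, one
inside the other. -/
theorem laplace_clutterPower (hcell : IsResolutionCell p cell) {Φ : Ω → Measure (ℂ × ℝ)}
    (hΦ : IsPoissonProcess P Φ p.clutterIntensity) {Ψ : Ω → Measure (ℂ × Measure (ℂ × ℝ))}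
    (h : IsPoissonProcess P Ψ (p.icIntensity.prod (P.map Φ))) {z : ℂ} (hz : 0 < ‖z‖)
    (hβ : InnerProductGeometry.angle (R₁ : ℂ) z < Real.pi) (w : ℂ) {θ a s : ℝ}
    (hθ : 0 ≤ Real.cos (θ / 2)) (ha : 0 ≤ a) (hs : a * p.radarGain / ‖z‖ ^ p.ηL = s) :
    ∫⁻ ω, expNeg (ENNReal.ofReal a * p.clutterPower cell R₁ (locallyFinitePart p.clutterIntensity)
        z w θ (locallyFinitePart (p.icIntensity.prod (P.map Φ)) (Ψ ω))) ∂P =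
      expNeg (ENNReal.ofReal (p.lamBS / p.M) *
        ∫⁻ r in Set.Ioi ‖w‖, ENNReal.ofReal
          (p.pLOS r * (1 - Real.exp (-(p.lamCl *
            p.cellArea ‖z‖ (InnerProductGeometry.angle (R₁ : ℂ) z) *
            (s * Real.cos (θ / 2) * r ^ (-p.ηL) * p.σc /
              (1 + s * Real.cos (θ / 2) * r ^ (-p.ηL) * p.σc))))) * (2 * Real.pi * r))) := by
  have : IsProbabilityMeasure (P.map Φ) :=
    Measure.isProbabilityMeasure_map hΦ.measurable.aemeasurable
  have hs0 : 0 ≤ s := by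
    have := p.radarGain_pos
    rw [← hs]; positivity
  have hlam := p.lamBS_pos
  have hσc := p.σc_pos
  have hM : (0 : ℝ) < p.M := by exact_mod_cast p.M_pos
  set C := {x : ℂ × ℝ | x.1 ∈ cell ‖z‖ (InnerProductGeometry.angle (R₁ : ℂ) z)} with hC
  have hCm : MeasurableSet C := measurable_fst (hcell.measurableSet _ _)
  have hin : Measurable fun m : Measure (ℂ × ℝ) =>
      ∫⁻ x in C, ENNReal.ofReal x.2 ∂(locallyFinitePart p.clutterIntensity m) :=
    measurable_setLIntegral_locallyFinitePart (A := Measure (ℂ × ℝ)) (Ψ := id)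
      (s := fun _ => C) p.clutterIntensity measurable_id (measurable_snd hCm)
      (f := fun q => ENNReal.ofReal q.2.2) (by fun_prop)
  have h1 := h.laplace_radial (by fun_prop) (norm_nonneg w)
    (F := fun v => ENNReal.ofReal (s * Real.cos (θ / 2) * v.1 ^ (-p.ηL)) *
      ∫⁻ x in C, ENNReal.ofReal x.2 ∂(locallyFinitePart p.clutterIntensity v.2))
    (Measurable.mul (by fun_prop) (hin.comp measurable_snd))
  have hpull (b : ℝ) (hb : 0 ≤ b) (m : Measure (ℂ × ℝ)) :
      ENNReal.ofReal b * ∫⁻ x in C, ENNReal.ofReal x.2 ∂(locallyFinitePart p.clutterIntensity m) =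
      ∫⁻ x in C, ENNReal.ofReal (b * x.2) ∂(locallyFinitePart p.clutterIntensity m) := by
    rw [← lintegral_const_mul' _ _ ENNReal.ofReal_ne_top]
    simp_rw [ENNReal.ofReal_mul hb]
  have h2 (ω : Ω) : ENNReal.ofReal a * p.clutterPower cell R₁
        (locallyFinitePart p.clutterIntensity) z w θ
        (locallyFinitePart (p.icIntensity.prod (P.map Φ)) (Ψ ω)) =
      ∫⁻ v in {v : ℂ × Measure (ℂ × ℝ) | ‖w‖ ≤ ‖v.1‖},
        ENNReal.ofReal (s * Real.cos (θ / 2) * ‖v.1‖ ^ (-p.ηL)) *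
          ∫⁻ x in C, ENNReal.ofReal x.2 ∂(locallyFinitePart p.clutterIntensity v.2)
        ∂(locallyFinitePart (p.icIntensity.prod (P.map Φ)) (Ψ ω)) := by
    rw [Params.clutterPower, ← lintegral_const_mul' _ _ ENNReal.ofReal_ne_top]
    refine lintegral_congr fun v => ?_
    rw [hpull _ (by positivity), ← lintegral_const_mul' _ _ ENNReal.ofReal_ne_top]
    refine lintegral_congr fun x => ?_
    rw [← ENNReal.ofReal_mul ha, ← hs, Real.rpow_neg (norm_nonneg _)]
    congr 1
    ring
  simp_rw [h2]
  rw [h1, ← lintegral_const_mul' _ _ ENNReal.ofReal_ne_top]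
  congr 1
  refine setLIntegral_congr_fun measurableSet_Ioi fun r hr => ?_
  have hr0 : 0 ≤ r := (norm_nonneg w).trans (le_of_lt hr)
  have hb : 0 ≤ s * Real.cos (θ / 2) * r ^ (-p.ηL) := by positivity
  have h3 := hΦ.laplace_clutter p.lamCl_nonneg p.σc_pos (hcell.measurableSet _ _)
    (Params.cellArea_nonneg hz.le) (hcell.area _ _ hz (InnerProductGeometry.angle_nonneg _ _) hβ) hb
  have h4 : ∫⁻ m, expNeg (ENNReal.ofReal (s * Real.cos (θ / 2) * r ^ (-p.ηL)) *
      ∫⁻ x in C, ENNReal.ofReal x.2 ∂(locallyFinitePart p.clutterIntensity m)) ∂(P.map Φ) =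
      ENNReal.ofReal (Real.exp (-(p.lamCl *
            p.cellArea ‖z‖ (InnerProductGeometry.angle (R₁ : ℂ) z) *
            (s * Real.cos (θ / 2) * r ^ (-p.ηL) * p.σc /
              (1 + s * Real.cos (θ / 2) * r ^ (-p.ηL) * p.σc))))) := by
    rw [lintegral_map (by fun_prop) hΦ.measurable, ← h3]
    simp_rw [hpull _ hb]
    rfl
  simp only
  rw [h4, ofReal_radial_mul (c := p.lamBS / p.M) (q := p.pLOS r) hr0 (by positivity)
    (p.pLOS_pos r).le (Real.exp_pos _).le rfl (by ring), mul_comm (2 * Real.pi) (p.lamBS / p.M),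
    ENNReal.ofReal_mul (by positivity), mul_assoc, ← ENNReal.ofReal_mul (by positivity)]
  congr 2
  ring

theorem laplace_directPower {q : ℝ → ℝ} (hqm : Measurable q) (hq : ∀ r, 0 ≤ r → 0 ≤ q r) {m : ℝ}
    (hm : 0 < m) {Ψ : Ω → Measure (ℂ × ℝ)}
    (h : IsPoissonProcess P Ψ
      ((radialIntensity fun r => q r * (p.lamBS / p.M ^ 2)).prod (gammaMeasure m m)))
    {C η : ℝ} (hC : 0 ≤ C) (w : ℂ) {a : ℝ} (ha : 0 ≤ a) :
    ∫⁻ ω, expNeg (ENNReal.ofReal a * p.directPower C η w (locallyFinitePart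
        ((radialIntensity fun r => q r * (p.lamBS / p.M ^ 2)).prod (gammaMeasure m m)) (Ψ ω))) ∂P =
      expNeg (ENNReal.ofReal (2 * Real.pi * p.lamBS / p.M ^ 2) *
        ∫⁻ r in Set.Ioi ‖w‖, ENNReal.ofReal
          (q r * (1 - (1 + a * p.Pc * p.Gm ^ 2 * C * r ^ (-η) / m) ^ (-m)) * r)) := by
  have := isProbabilityMeasure_gammaMeasure hm hm
  have hlam := p.lamBS_pos
  have hPc := p.Pc_nonneg
  have h1 := h.laplace_radial (by fun_prop) (norm_nonneg w)
    (F := fun v => ENNReal.ofReal (a * p.Pc * p.Gm ^ 2 * C * v.1 ^ (-η) * v.2)) (by fun_prop)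
  have h2 (ω : Ω) : ENNReal.ofReal a * p.directPower C η w (locallyFinitePart
        ((radialIntensity fun r => q r * (p.lamBS / p.M ^ 2)).prod (gammaMeasure m m)) (Ψ ω)) =
      ∫⁻ v in {v : ℂ × ℝ | ‖w‖ ≤ ‖v.1‖},
        ENNReal.ofReal (a * p.Pc * p.Gm ^ 2 * C * ‖v.1‖ ^ (-η) * v.2)
        ∂(locallyFinitePart
          ((radialIntensity fun r => q r * (p.lamBS / p.M ^ 2)).prod (gammaMeasure m m)) (Ψ ω)) := by
    rw [Params.directPower, ← lintegral_const_mul' _ _ ENNReal.ofReal_ne_top]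
    refine lintegral_congr fun x => ?_
    rw [← ENNReal.ofReal_mul ha]
    congr 1
    ring
  simp_rw [h2]
  rw [h1, ← lintegral_const_mul' _ _ ENNReal.ofReal_ne_top]
  congr 1
  refine setLIntegral_congr_fun measurableSet_Ioi fun r hr => ?_
  have hr0 : 0 ≤ r := (norm_nonneg w).trans (le_of_lt hr)
  simp only
  rw [lintegral_expNeg_gammaMeasure hm hm (by positivity), mul_div_assoc (2 * Real.pi)]
  exact ofReal_radial_mul hr0 (by positivity) (hq r hr0) (by positivity) rfl rfl

end Laplace

/-! ### Joint measurability of the powers and of their transforms. -/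

@[fun_prop]
theorem measurable_angle_comp {B : Type*} [MeasurableSpace B] (c : ℂ) {z : B → ℂ}
    (hz : Measurable z) : Measurable fun b => InnerProductGeometry.angle c (z b) :=
  (measurable_angle c).comp hz

section PowerMeasurability

variable {B : Type*} [MeasurableSpace B] {p : Params} {cell : ℝ → ℝ → Set ℂ} {R₁ : ℝ}

theorem IsResolutionCell.measurableSet_mem (hcell : IsResolutionCell p cell) {Y : Type*}
    [MeasurableSpace Y] {z : Y → ℂ} (hz : Measurable z) {x : Y → ℂ} (hx : Measurable x) :
    MeasurableSet {q : Y | x q ∈ cell ‖z q‖ (InnerProductGeometry.angle (R₁ : ℂ) (z q))} := by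
  have h : Measurable fun q => (‖z q‖, InnerProductGeometry.angle (R₁ : ℂ) (z q), x q) :=
    hz.norm.prodMk (((measurable_angle _).comp hz).prodMk hx)
  exact h hcell.measurable

/-- In this lemma and the next ones the space `B` is arbitrary: it may be a product of frozen
parameters with `Ω`, and `Ω` may carry a smaller σ-algebra. -/
theorem measurable_intraPower (hcell : IsResolutionCell p cell) (R₁ : ℝ) (μ : Measure (ℂ × ℝ))
    [SigmaFinite μ] {z : B → ℂ} (hz : Measurable z) {Φ : B → Measure (ℂ × ℝ)} (hΦ : Measurable Φ) :
    Measurable fun b => p.intraPower cell R₁ (z b) (locallyFinitePart μ (Φ b)) :=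
  measurable_setLIntegral_locallyFinitePart μ hΦ
    (hcell.measurableSet_mem (Y := B × ℂ × ℝ) (hz.comp measurable_fst)
      (x := fun q => q.2.1) (by fun_prop))
    (f := fun q : B × ℂ × ℝ => ENNReal.ofReal (p.radarGain *
      (q.2.2 * Real.cos (InnerProductGeometry.angle (R₁ : ℂ) (z q.1) / 2)) /
      (R₁ ^ p.ηL * ‖z q.1‖ ^ p.ηL))) (by fun_prop)

theorem measurable_targetPower (μ : Measure (ℂ × ℝ)) [SigmaFinite μ] {z w : B → ℂ}
    (hz : Measurable z) (hw : Measurable w) {θ : B → ℝ} (hθ : Measurable θ)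
    {Φ : B → Measure (ℂ × ℝ)} (hΦ : Measurable Φ) :
    Measurable fun b => p.targetPower (z b) (w b) (θ b) (locallyFinitePart μ (Φ b)) :=
  measurable_setLIntegral_locallyFinitePart μ hΦ (s := fun b => {v : ℂ × ℝ | ‖w b‖ ≤ ‖v.1‖})
    (measurableSet_le (f := fun q : B × ℂ × ℝ => ‖w q.1‖) (g := fun q => ‖q.2.1‖)
      (by fun_prop) (by fun_prop))
    (f := fun q : B × ℂ × ℝ => ENNReal.ofReal (p.radarGain * (q.2.2 * Real.cos (θ q.1 / 2)) /
      (‖q.2.1‖ ^ p.ηL * ‖z q.1‖ ^ p.ηL))) (by fun_prop)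

theorem measurable_clutterPower (hcell : IsResolutionCell p cell) (R₁ : ℝ) (ν : Measure (ℂ × ℝ))
    [SigmaFinite ν] (μ : Measure (ℂ × Measure (ℂ × ℝ))) [SigmaFinite μ] {z w : B → ℂ}
    (hz : Measurable z) (hw : Measurable w) {θ : B → ℝ} (hθ : Measurable θ)
    {Φ : B → Measure (ℂ × Measure (ℂ × ℝ))} (hΦ : Measurable Φ) :
    Measurable fun b => p.clutterPower cell R₁ (locallyFinitePart ν) (z b) (w b) (θ b)
      (locallyFinitePart μ (Φ b)) := by
  refine measurable_setLIntegral_locallyFinitePart μ hΦ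
    (s := fun b => {v : ℂ × Measure (ℂ × ℝ) | ‖w b‖ ≤ ‖v.1‖})
    (measurableSet_le (f := fun q : B × ℂ × Measure (ℂ × ℝ) => ‖w q.1‖) (g := fun q => ‖q.2.1‖)
      (by fun_prop) (by fun_prop))
    (f := fun q : B × ℂ × Measure (ℂ × ℝ) =>
      ∫⁻ x in {x : ℂ × ℝ | x.1 ∈ cell ‖z q.1‖ (InnerProductGeometry.angle (R₁ : ℂ) (z q.1))},
        ENNReal.ofReal (p.radarGain * (x.2 * Real.cos (θ q.1 / 2)) /
        (‖q.2.1‖ ^ p.ηL * ‖z q.1‖ ^ p.ηL)) ∂(locallyFinitePart ν q.2.2)) ?_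
  exact measurable_setLIntegral_locallyFinitePart ν (A := B × ℂ × Measure (ℂ × ℝ))
    (Ψ := fun q => q.2.2) (by fun_prop)
    (hcell.measurableSet_mem (Y := (B × ℂ × Measure (ℂ × ℝ)) × ℂ × ℝ)
      (z := fun q => z q.1.1) (by fun_prop) (x := fun q => q.2.1) (by fun_prop))
    (f := fun q => ENNReal.ofReal (p.radarGain * (q.2.2 * Real.cos (θ q.1.1 / 2)) /
        (‖q.1.2.1‖ ^ p.ηL * ‖z q.1.1‖ ^ p.ηL))) (by fun_prop)

theorem measurable_directPower (C η : ℝ) (μ : Measure (ℂ × ℝ)) [SigmaFinite μ] {w : B → ℂ}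
    (hw : Measurable w) {Φ : B → Measure (ℂ × ℝ)} (hΦ : Measurable Φ) :
    Measurable fun b => p.directPower C η (w b) (locallyFinitePart μ (Φ b)) :=
  measurable_setLIntegral_locallyFinitePart μ hΦ (s := fun b => {v : ℂ × ℝ | ‖w b‖ ≤ ‖v.1‖})
    (measurableSet_le (f := fun q : B × ℂ × ℝ => ‖w q.1‖) (g := fun q => ‖q.2.1‖)
      (by fun_prop) (by fun_prop))
    (f := fun q : B × ℂ × ℝ =>
      ENNReal.ofReal (p.Pc * q.2.2 * p.Gm ^ 2 * C * ‖q.2.1‖ ^ (-η))) (by fun_prop)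

end PowerMeasurability

theorem measurable_setLIntegral_Ioi {B : Type*} [MeasurableSpace B] {ρ : B → ℝ} (hρ : Measurable ρ)
    {f : B × ℝ → ℝ≥0∞} (hf : Measurable f) :
    Measurable fun b => ∫⁻ r in Set.Ioi (ρ b), f (b, r) := by
  have h (b : B) : ∫⁻ r in Set.Ioi (ρ b), f (b, r) =
      ∫⁻ r, {q : B × ℝ | ρ q.1 < q.2}.indicator f (b, r) := by
    rw [← lintegral_indicator measurableSet_Ioi]
    rfl
  simp_rw [h]
  exact (hf.indicator (measurableSet_lt (by fun_prop) (by fun_prop))).lintegral_prod_right'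

namespace Params

variable (p : Params)

/-- Laplace transform of the echoes of the target, given the protection radius and the angle. -/
noncomputable def targetLT (s ρ θ : ℝ) : ℝ≥0∞ :=
  expNeg (ENNReal.ofReal (2 * Real.pi * p.lamBS / p.M) *
    ∫⁻ r in Set.Ioi ρ, ENNReal.ofReal
      (p.pLOS r * (1 - 1 / (1 + s * Real.cos (θ / 2) * r ^ (-p.ηL) * p.σt)) * r))

/-- Laplace transform of the echoes of clutter cells of area `A`, given the protection radius and
the angle. -/
noncomputable def clutterLT (A s ρ θ : ℝ) : ℝ≥0∞ :=
  expNeg (ENNReal.ofReal (p.lamBS / p.M) *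
    ∫⁻ r in Set.Ioi ρ, ENNReal.ofReal
      (p.pLOS r * (1 - Real.exp (-(p.lamCl * A *
        (s * Real.cos (θ / 2) * r ^ (-p.ηL) * p.σc /
          (1 + s * Real.cos (θ / 2) * r ^ (-p.ηL) * p.σc))))) * (2 * Real.pi * r)))

/-- Laplace transform of the direct interference of one type of link with probability `q`, given the
protection radius. -/
noncomputable def directLinkLT (q : ℝ → ℝ) (C η m s ρ : ℝ) : ℝ≥0∞ :=
  expNeg (ENNReal.ofReal (2 * Real.pi * p.lamBS / p.M ^ 2) *
    ∫⁻ r in Set.Ioi ρ, ENNReal.ofReal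
      (q r * (1 - (1 + s * p.Pc * p.Gm ^ 2 * C * r ^ (-η) / m) ^ (-m)) * r))

variable {p} {B : Type*} [MeasurableSpace B]

@[fun_prop]
theorem measurable_cellArea {r β : B → ℝ} (hr : Measurable r) (hβ : Measurable β) :
    Measurable fun b => p.cellArea (r b) (β b) := by
  unfold cellArea
  fun_prop

@[fun_prop]
theorem measurable_targetLT {s ρ θ : B → ℝ} (hs : Measurable s) (hρ : Measurable ρ)
    (hθ : Measurable θ) : Measurable fun b => p.targetLT (s b) (ρ b) (θ b) :=
  measurable_expNeg.comp ((measurable_setLIntegral_Ioi hρ (f := fun q : B × ℝ => ENNReal.ofReal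
      (p.pLOS q.2 * (1 - 1 / (1 + s q.1 * Real.cos (θ q.1 / 2) * q.2 ^ (-p.ηL) * p.σt)) * q.2))
    (by fun_prop)).const_mul _)

@[fun_prop]
theorem measurable_clutterLT {A s ρ θ : B → ℝ} (hA : Measurable A) (hs : Measurable s)
    (hρ : Measurable ρ) (hθ : Measurable θ) :
    Measurable fun b => p.clutterLT (A b) (s b) (ρ b) (θ b) :=
  measurable_expNeg.comp ((measurable_setLIntegral_Ioi hρ (f := fun q : B × ℝ => ENNReal.ofReal
      (p.pLOS q.2 * (1 - Real.exp (-(p.lamCl * A q.1 *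
        (s q.1 * Real.cos (θ q.1 / 2) * q.2 ^ (-p.ηL) * p.σc /
          (1 + s q.1 * Real.cos (θ q.1 / 2) * q.2 ^ (-p.ηL) * p.σc))))) * (2 * Real.pi * q.2)))
    (by fun_prop)).const_mul _)

theorem measurable_directLinkLT {q : ℝ → ℝ} (hq : Measurable q) (C η m : ℝ) {s ρ : B → ℝ}
    (hs : Measurable s) (hρ : Measurable ρ) :
    Measurable fun b => p.directLinkLT q C η m (s b) (ρ b) :=
  measurable_expNeg.comp ((measurable_setLIntegral_Ioi hρ (f := fun x : B × ℝ => ENNReal.ofReal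
      (q x.2 * (1 - (1 + s x.1 * p.Pc * p.Gm ^ 2 * C * x.2 ^ (-η) / m) ^ (-m)) * x.2))
    (by fun_prop)).const_mul _)

theorem interLT_eq (R₁ Rn β s : ℝ) : p.interLT R₁ Rn β s =
    ∫⁻ RIC in Set.Ioi R₁, ∫⁻ βI in Set.Ioo 0 Real.pi,
      p.targetLT s RIC βI * p.clutterLT (p.cellArea Rn β) s RIC βI *
      ENNReal.ofReal (2 * p.lamBS * RIC * Real.exp (-(p.lamBS * Real.pi * (RIC ^ 2 - R₁ ^ 2)))) :=
  rfl

theorem directLT_eq (s : ℝ) : p.directLT s =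
    ∫⁻ Rd in Set.Ioi (0 : ℝ), p.directLinkLT p.pLOS p.CL p.ηL p.mL s Rd *
      p.directLinkLT (fun r => 1 - p.pLOS r) p.CN p.ηN p.mN s Rd *
      ENNReal.ofReal (2 * Real.pi * p.lamBS * Rd * Real.exp (-(Real.pi * p.lamBS * Rd ^ 2))) :=
  rfl

theorem measurable_interLT (R₁ : ℝ) {r β s : B → ℝ} (hr : Measurable r) (hβ : Measurable β)
    (hs : Measurable s) : Measurable fun b => p.interLT R₁ (r b) (β b) (s b) := by
  simp_rw [interLT_eq]
  have h : Measurable fun x : (B × ℝ) × ℝ => p.targetLT (s x.1.1) x.1.2 x.2 *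
      p.clutterLT (p.cellArea (r x.1.1) (β x.1.1)) (s x.1.1) x.1.2 x.2 *
      ENNReal.ofReal (2 * p.lamBS * x.1.2 *
        Real.exp (-(p.lamBS * Real.pi * (x.1.2 ^ 2 - R₁ ^ 2)))) := by fun_prop
  exact (h.lintegral_prod_right' (ν := volume.restrict (Set.Ioo 0 Real.pi))).lintegral_prod_right'
    (f := fun x : B × ℝ => _) (ν := volume.restrict (Set.Ioi R₁))

theorem measurable_directLT {s : B → ℝ} (hs : Measurable s) :
    Measurable fun b => p.directLT (s b) := by
  simp_rw [directLT_eq]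
  have h : Measurable fun x : B × ℝ => p.directLinkLT p.pLOS p.CL p.ηL p.mL (s x.1) x.2 *
      p.directLinkLT (fun r => 1 - p.pLOS r) p.CN p.ηN p.mN (s x.1) x.2 *
      ENNReal.ofReal (2 * Real.pi * p.lamBS * x.2 * Real.exp (-(Real.pi * p.lamBS * x.2 ^ 2))) :=
    ((measurable_directLinkLT (by fun_prop) _ _ _ (by fun_prop) measurable_snd).mul
      (measurable_directLinkLT (by fun_prop) _ _ _ (by fun_prop) measurable_snd)).mul (by fun_prop)
  exact h.lintegral_prod_right' (ν := volume.restrict (Set.Ioi (0 : ℝ)))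

end Params

/-! ### Freezing: averaging over independent blocks of random elements. -/

/-- Integrating out one of two independent random elements. -/
theorem lintegral_of_indepFun {Ω A B : Type*} [MeasurableSpace Ω] [MeasurableSpace A]
    [MeasurableSpace B] {P : Measure Ω} [IsProbabilityMeasure P] {X : Ω → A} {Y : Ω → B}
    (hX : Measurable X) (hY : Measurable Y) (hind : IndepFun X Y P) {F : A × B → ℝ≥0∞}
    (hF : Measurable F) :
    ∫⁻ ω, F (X ω, Y ω) ∂P = ∫⁻ ω, ∫⁻ ω', F (X ω, Y ω') ∂P ∂P := by
  have : IsProbabilityMeasure (P.map Y) := Measure.isProbabilityMeasure_map hY.aemeasurable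
  rw [← lintegral_map (f := F) (g := fun ω => (X ω, Y ω)) hF (hX.prodMk hY),
    hind.map_prod_eq_prod_map_map hX.aemeasurable hY.aemeasurable, lintegral_prod _ hF.aemeasurable,
    lintegral_map hF.lintegral_prod_right' hX]
  refine lintegral_congr fun ω => ?_
  rw [lintegral_map (f := fun y => F (X ω, y)) (by fun_prop) hY]

/-- Integrating out one of two independent sources of randomness. -/
theorem lintegral_freeze {Ω A : Type*} {mX mY mΩ : MeasurableSpace Ω} [MeasurableSpace A]
    {P : Measure Ω} [IsProbabilityMeasure P] (hmX : mX ≤ mΩ) (hmY : mY ≤ mΩ)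
    (hind : Indep mX mY P) {X : Ω → A} (hX : Measurable[mX] X) {F : A × Ω → ℝ≥0∞}
    (hF : Measurable[Prod.instMeasurableSpace (m₂ := mY)] F) :
    ∫⁻ ω, F (X ω, ω) ∂P = ∫⁻ ω, ∫⁻ ω', F (X ω, ω') ∂P ∂P := by
  -- The second random element is the identity, with values in `Ω` equipped with the smaller
  -- σ-algebra `mY`; the σ-algebra it generates is `mY`.
  refine @lintegral_of_indepFun Ω A Ω mΩ _ mY P _ X id (hX.mono hmX le_rfl) (measurable_id'' hmY) ?_
    F hF
  refine indep_of_indep_of_le_right (indep_of_indep_of_le_left hind hX.comap_le) ?_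
  exact MeasurableSpace.comap_id.le

namespace Elements

variable {p : Params} {Ω : Type*} (E : Elements p Ω)

/-- The σ-algebras generated by the random elements of the model. -/
@[reducible] noncomputable def sigma : Fin 12 → MeasurableSpace Ω :=
  ![MeasurableSpace.comap E.rx inferInstance,
    MeasurableSpace.comap E.block inferInstance,
    MeasurableSpace.comap E.beam inferInstance,
    MeasurableSpace.comap E.rcs inferInstance,
    MeasurableSpace.comap E.clutter inferInstance,
    MeasurableSpace.comap E.icNear inferInstance,
    MeasurableSpace.comap E.icAngle inferInstance,
    MeasurableSpace.comap E.icTarget inferInstance,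
    MeasurableSpace.comap E.icClutter inferInstance,
    MeasurableSpace.comap E.nbrNear inferInstance,
    MeasurableSpace.comap E.dirL inferInstance,
    MeasurableSpace.comap E.dirN inferInstance]

/-- The joint information of the random elements with indices from `a` to `b`. -/
@[reducible] noncomputable def info (a b : Fin 12) : MeasurableSpace Ω :=
  ⨆ i ∈ Set.Icc a b, E.sigma i

variable {E}

theorem measurable_info {β : Type*} {mβ : MeasurableSpace β} {X : Ω → β} (i : Fin 12)
    (hi : E.sigma i = mβ.comap X) {a b : Fin 12} (ha : a ≤ i) (hb : i ≤ b) :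
    Measurable[E.info a b] X := by
  have h : E.sigma i ≤ E.info a b :=
    le_iSup₂ (f := fun i (_ : i ∈ Set.Icc a b) => E.sigma i) i ⟨ha, hb⟩
  rw [hi] at h
  exact measurable_iff_comap_le.2 h

end Elements

section Model

variable {p : Params} {Ω : Type*} [mΩ : MeasurableSpace Ω] {P : Measure Ω} {E : Elements p Ω}
  {R₁ : ℝ} {n : ℕ}

theorem IsBistaticModel.sigma_le (hE : IsBistaticModel P E R₁ n) (i : Fin 12) : E.sigma i ≤ mΩ := by
  fin_cases i
  exacts [hE.rx_measurable.comap_le, hE.block_measurable.comap_le, hE.beam_measurable.comap_le,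
    hE.rcs_measurable.comap_le, hE.clutter.measurable.comap_le, hE.icNear_measurable.comap_le,
    hE.icAngle_measurable.comap_le, hE.icTarget.measurable.comap_le,
    hE.icClutter.measurable.comap_le, hE.nbrNear_measurable.comap_le,
    hE.dirL.measurable.comap_le, hE.dirN.measurable.comap_le]

theorem IsBistaticModel.info_le (hE : IsBistaticModel P E R₁ n) (a b : Fin 12) :
    E.info a b ≤ mΩ :=
  iSup₂_le fun i _ => hE.sigma_le i

/-- The elements are listed in `sigma` so that every independence needed is between two disjoint
intervals of indices. -/
theorem IsBistaticModel.indep_info (hE : IsBistaticModel P E R₁ n) {a b c d : Fin 12} (h : b < c) :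
    Indep (E.info a b) (E.info c d) P :=
  indep_iSup_of_disjoint hE.sigma_le hE.indep
    (Set.disjoint_left.2 fun _ hx hx' => absurd (hx'.1.trans hx.2) (not_le.2 h))

theorem IsBistaticModel.lintegral_mul (hE : IsBistaticModel P E R₁ n) {a b c d : Fin 12} (h : b < c)
    {f g : Ω → ℝ≥0∞} (hf : Measurable[E.info a b] f) (hg : Measurable[E.info c d] g) :
    ∫⁻ ω, f ω * g ω ∂P = (∫⁻ ω, f ω ∂P) * ∫⁻ ω, g ω ∂P :=
  lintegral_mul_eq_lintegral_mul_lintegral_of_independent_measurableSpace (hE.info_le a b)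
    (hE.info_le c d) (hE.indep_info h) hf hg

theorem IsBistaticModel.lintegral_freeze [IsProbabilityMeasure P] (hE : IsBistaticModel P E R₁ n)
    {a b c d : Fin 12} (h : b < c) {A : Type*} [MeasurableSpace A] {X : Ω → A}
    (hX : Measurable[E.info a b] X) {F : A × Ω → ℝ≥0∞}
    (hF : Measurable[Prod.instMeasurableSpace (m₂ := E.info c d)] F) :
    ∫⁻ ω, F (X ω, ω) ∂P = ∫⁻ ω, ∫⁻ ω', F (X ω, ω') ∂P ∂P :=
  ISAC.lintegral_freeze (hE.info_le a b) (hE.info_le c d) (hE.indep_info h) hX hF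

end Model

/-! ### The denominator of the SINR as a measurable functional. -/

namespace Elements

variable {p : Params} {Ω : Type*} (E : Elements p Ω)

/-- The inter-clutter power at a receiver at `z`, computed from the locally finite parts of the
processes; `ν` is the law of the clutter. -/
noncomputable def interLoad (ν : Measure (Measure (ℂ × ℝ))) [SigmaFinite ν]
    (cell : ℝ → ℝ → Set ℂ) (R₁ : ℝ) (z w : ℂ) (θ : ℝ) (ω : Ω) : ℝ≥0∞ :=
  p.targetPower z w θ (locallyFinitePart (p.icIntensity.prod (expMeasure (1 / p.σt))) (E.icTarget ω)) +
  p.clutterPower cell R₁ (locallyFinitePart p.clutterIntensity) z w θ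
    (locallyFinitePart (p.icIntensity.prod ν) (E.icClutter ω))

/-- The direct interference outside the distance of `w`, computed from the locally finite parts of
the processes. -/
noncomputable def directLoad (w : ℂ) (ω : Ω) : ℝ≥0∞ :=
  p.directPower p.CL p.ηL w (locallyFinitePart ((radialIntensity fun r =>
    p.pLOS r * (p.lamBS / p.M ^ 2)).prod (gammaMeasure p.mL p.mL)) (E.dirL ω)) +
  p.directPower p.CN p.ηN w (locallyFinitePart ((radialIntensity fun r =>
    (1 - p.pLOS r) * (p.lamBS / p.M ^ 2)).prod (gammaMeasure p.mN p.mN)) (E.dirN ω))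

/-- The denominator of the SINR at a receiver at `z`, computed from the locally finite parts of the
processes; `ν` is the law of the clutter. -/
noncomputable def load (ν : Measure (Measure (ℂ × ℝ))) [SigmaFinite ν]
    (cell : ℝ → ℝ → Set ℂ) (R₁ : ℝ) (z : ℂ) (ω : Ω) : ℝ≥0∞ :=
  p.intraPower cell R₁ z (locallyFinitePart p.clutterIntensity (E.clutter ω)) +
  (E.interLoad ν cell R₁ z (E.icNear ω) (E.icAngle ω) ω +
  (ENNReal.ofReal (p.KB * p.T * p.Wb) + E.directLoad (E.nbrNear ω) ω))

variable {E} {cell : ℝ → ℝ → Set ℂ}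

/-- Applied with `Ω` carrying a σ-algebra `info a b` smaller than that of `P`. For this reason the
law of the clutter enters as a bare measure `ν`. -/
theorem measurable_interLoad {B : Type*} [MeasurableSpace Ω] [MeasurableSpace B]
    (hcell : IsResolutionCell p cell) (ν : Measure (Measure (ℂ × ℝ))) [SigmaFinite ν] (R₁ : ℝ)
    (hT : Measurable E.icTarget) (hC : Measurable E.icClutter) {z w : B → ℂ} (hz : Measurable z)
    (hw : Measurable w) {θ : B → ℝ} (hθ : Measurable θ) {o : B → Ω} (ho : Measurable o) :
    Measurable fun q => E.interLoad ν cell R₁ (z q) (w q) (θ q) (o q) :=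
  (measurable_targetPower _ hz hw hθ (hT.comp ho)).add
    (measurable_clutterPower hcell _ _ _ hz hw hθ (hC.comp ho))

theorem measurable_directLoad {B : Type*} [MeasurableSpace Ω] [MeasurableSpace B]
    (hL : Measurable E.dirL) (hN : Measurable E.dirN) {w : B → ℂ} (hw : Measurable w)
    {o : B → Ω} (ho : Measurable o) :
    Measurable fun q => E.directLoad (w q) (o q) :=
  (measurable_directPower _ _ _ hw (hL.comp ho)).add
    (measurable_directPower _ _ _ hw (hN.comp ho))

theorem measurable_load {B : Type*} [MeasurableSpace Ω] [MeasurableSpace B]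
    (hcell : IsResolutionCell p cell) (ν : Measure (Measure (ℂ × ℝ))) [SigmaFinite ν] (R₁ : ℝ)
    (hcl : Measurable E.clutter) (hw : Measurable E.icNear) (hθ : Measurable E.icAngle)
    (hT : Measurable E.icTarget) (hC : Measurable E.icClutter) (hn : Measurable E.nbrNear)
    (hL : Measurable E.dirL) (hN : Measurable E.dirN) {z : B → ℂ} (hz : Measurable z)
    {o : B → Ω} (ho : Measurable o) :
    Measurable fun q => E.load ν cell R₁ (z q) (o q) :=
  (measurable_intraPower hcell _ _ hz (hcl.comp ho)).add
    ((measurable_interLoad hcell ν R₁ hT hC hz (hw.comp ho) (hθ.comp ho) ho).add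
      (measurable_const.add (measurable_directLoad hL hN (hn.comp ho) ho)))

end Elements

namespace Elements

variable {p : Params} {Ω : Type*} {E : Elements p Ω} {cell : ℝ → ℝ → Set ℂ} {R₁ : ℝ}

theorem lt_SINR_iff {D : ℝ≥0∞} {ω : Ω} {φ : ℝ} (hφ : 0 < φ)
    (hD : D = E.intraClutter cell R₁ ω + E.interTarget ω + E.interClutter cell R₁ ω +
      ENNReal.ofReal (p.KB * p.T * p.Wb) + E.directL ω + E.directN ω) :
    ENNReal.ofReal φ < E.SINR cell R₁ ω ↔
      E.block ω < p.pLOS ‖E.rx ω‖ ∧ E.beam ω ≠ E.coBeam ∧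
        ENNReal.ofReal φ * D < ENNReal.ofReal (p.echoGain R₁ (E.rx ω) * E.rcs ω) := by
  have hD0 : D ≠ 0 := by
    have h1 : 0 < ENNReal.ofReal (p.KB * p.T * p.Wb) :=
      ENNReal.ofReal_pos.2 (mul_pos (mul_pos p.KB_pos p.T_pos) p.Wb_pos)
    rw [hD]
    simp [h1.ne']
  rw [Elements.SINR, ← hD, Elements.signal]
  split_ifs with hc
  · have e : p.radarGain * (E.rcs ω * Real.cos (E.angle R₁ ω / 2)) / (R₁ ^ p.ηL * E.Rn ω ^ p.ηL) =
        p.echoGain R₁ (E.rx ω) * E.rcs ω := by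
      rw [Params.echoGain, Elements.Rn, Elements.angle]
      ring
    -- Noise makes `D` nonzero; `φ ≠ 0` covers `D = ∞`, where both sides fail.
    rw [e, ENNReal.lt_div_iff_mul_lt (Or.inl hD0) (Or.inr (ENNReal.ofReal_pos.2 hφ).ne')]
    exact ⟨fun h => ⟨hc.1, hc.2, h⟩, fun h => h.2.2⟩
  · simp only [ENNReal.zero_div, not_lt_zero, false_iff]
    exact fun h => hc ⟨h.1, h.2.1⟩

end Elements

section Coverage

variable {p : Params} {Ω : Type*} [MeasurableSpace Ω] {P : Measure Ω} [IsProbabilityMeasure P]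
  {E : Elements p Ω} {cell : ℝ → ℝ → Set ℂ} {R₁ : ℝ} {n : ℕ}

/-- Clutter configurations that are not locally finite form a null set of the mark law, and a
Poisson process almost surely has no point over such a set. -/
theorem IsPoissonProcess.ae_mark_locallyFinitePart_eq {Φ : Ω → Measure (ℂ × ℝ)}
    {ν : Measure (ℂ × ℝ)} [SigmaFinite ν] (hΦ : IsPoissonProcess P Φ ν) {μ : Measure ℂ}
    {Ψ : Ω → Measure (ℂ × Measure (ℂ × ℝ))}
    (h : IsPoissonProcess P Ψ (μ.prod (P.map Φ))) :
    ∀ᵐ ω ∂P, ∀ᵐ v ∂(Ψ ω), locallyFinitePart ν v.2 = v.2 := by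
  refine h.ae_ae ?_
  have h1 : ∀ᵐ m ∂(P.map Φ), locallyFinitePart ν m = m := by
    have hm (N : ℕ) := MeasurableSet.disjointed (measurableSet_spanningSets ν) N
    have h2 : ∀ᵐ m ∂(P.map Φ), ∀ N, m (disjointed (spanningSets ν) N) < ∞ := by
      refine ae_all_iff.2 fun N => ?_
      rw [ae_map_iff hΦ.measurable.aemeasurable
        (measurableSet_lt (Measure.measurable_coe (hm N)) measurable_const)]
      exact hΦ.ae_count_lt_top (hm N) ((measure_mono (disjointed_subset _ _)).trans_lt
        (measure_spanningSets_lt_top ν N))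
    filter_upwards [h2] with m hm using locallyFinitePart_eq ν hm
  exact Measure.quasiMeasurePreserving_snd.ae h1

theorem IsBistaticModel.ae_load_eq (hE : IsBistaticModel P E R₁ n) :
    ∀ᵐ ω ∂P, E.load (P.map E.clutter) cell R₁ (E.rx ω) ω =
      E.intraClutter cell R₁ ω + E.interTarget ω + E.interClutter cell R₁ ω +
      ENNReal.ofReal (p.KB * p.T * p.Wb) + E.directL ω + E.directN ω := by
  have : IsProbabilityMeasure (P.map E.clutter) :=
    Measure.isProbabilityMeasure_map hE.clutter.measurable.aemeasurable
  filter_upwards [hE.clutter.ae_locallyFinitePart_eq, hE.icTarget.ae_locallyFinitePart_eq,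
    hE.icClutter.ae_locallyFinitePart_eq, hE.dirL.ae_locallyFinitePart_eq,
    hE.dirN.ae_locallyFinitePart_eq, hE.clutter.ae_mark_locallyFinitePart_eq hE.icClutter]
    with ω h1 h2 h3 h4 h5 h6
  have h7 : p.clutterPower cell R₁ (locallyFinitePart p.clutterIntensity) (E.rx ω) (E.icNear ω)
      (E.icAngle ω) (E.icClutter ω) = E.interClutter cell R₁ ω := by
    refine lintegral_congr_ae (ae_restrict_of_ae ?_)
    filter_upwards [h6] with v hv
    rw [hv]
    rfl
  rw [Elements.load, Elements.interLoad, Elements.directLoad, h1, h2, h3, h4, h5, h7]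
  change E.intraClutter cell R₁ ω + (E.interTarget ω + E.interClutter cell R₁ ω +
    (ENNReal.ofReal (p.KB * p.T * p.Wb) + (E.directL ω + E.directN ω))) = _
  ring

end Coverage

/-! ### Laplace transforms of the interference with random protection regions. -/

section Interference

variable {p : Params} {Ω : Type*} [mΩ : MeasurableSpace Ω] {P : Measure Ω}
  {E : Elements p Ω} {cell : ℝ → ℝ → Set ℂ} {R₁ : ℝ} {n : ℕ}

theorem IsBistaticModel.ae_cos_icAngle (hE : IsBistaticModel P E R₁ n) :
    ∀ᵐ ω ∂P, 0 ≤ Real.cos (E.icAngle ω / 2) := by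
  have h1 : ∀ᵐ θ ∂(P.map E.icAngle), θ ∈ Set.Icc 0 Real.pi := by
    rw [hE.icAngle]
    exact Measure.ae_smul_measure (ae_restrict_mem measurableSet_Icc) _
  filter_upwards [ae_of_ae_map hE.icAngle_measurable.aemeasurable h1] with ω hω
  exact Params.cos_half_nonneg hω.1 hω.2

variable [IsProbabilityMeasure P]

/-- With the protection radius and the angle frozen, only two independent processes remain, and the
transform splits into their two transforms. -/
theorem IsBistaticModel.laplace_interLoad_fixed (hE : IsBistaticModel P E R₁ n)
    [SigmaFinite (P.map E.clutter)] (hcell : IsResolutionCell p cell) {z : ℂ} (hz : 0 < ‖z‖)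
    (hβ : InnerProductGeometry.angle (R₁ : ℂ) z < Real.pi) {a s : ℝ} (ha : 0 ≤ a)
    (hs : a * p.radarGain / ‖z‖ ^ p.ηL = s) (w : ℂ) {θ : ℝ} (hθ : 0 ≤ Real.cos (θ / 2)) :
    ∫⁻ ω, expNeg (ENNReal.ofReal a * E.interLoad (P.map E.clutter) cell R₁ z w θ ω) ∂P =
      p.targetLT s ‖w‖ θ *
        p.clutterLT (p.cellArea ‖z‖ (InnerProductGeometry.angle (R₁ : ℂ) z)) s ‖w‖ θ := by
  have hT : Measurable[E.info 7 7] E.icTarget :=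
    Elements.measurable_info 7 rfl (by decide) (by decide)
  have hC : Measurable[E.info 8 8] E.icClutter :=
    Elements.measurable_info 8 rfl (by decide) (by decide)
  simp_rw [Elements.interLoad, mul_add, expNeg_add]
  rw [hE.lintegral_mul (a := 7) (b := 7) (c := 8) (d := 8) (by decide),
    laplace_targetPower hE.icTarget z w hθ ha hs,
    laplace_clutterPower hcell hE.clutter hE.icClutter hz hβ w hθ ha hs]
  · rfl
  · exact measurable_expNeg.comp ((@measurable_targetPower Ω (E.info 7 7) p _ _ _ _
      measurable_const measurable_const _ measurable_const _ hT).const_mul _)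
  · exact measurable_expNeg.comp ((@measurable_clutterPower Ω (E.info 8 8) p _ hcell _ _ _ _ _ _ _
      measurable_const measurable_const _ measurable_const _ hC).const_mul _)

theorem IsBistaticModel.lintegral_interLoad_freeze (hE : IsBistaticModel P E R₁ n)
    [SigmaFinite (P.map E.clutter)] (hcell : IsResolutionCell p cell) (z : ℂ) (a : ℝ) :
    ∫⁻ ω, expNeg (ENNReal.ofReal a *
        E.interLoad (P.map E.clutter) cell R₁ z (E.icNear ω) (E.icAngle ω) ω) ∂P =
      ∫⁻ ω, ∫⁻ ω', expNeg (ENNReal.ofReal a *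
        E.interLoad (P.map E.clutter) cell R₁ z (E.icNear ω) (E.icAngle ω) ω') ∂P ∂P := by
  have hw : Measurable[E.info 5 6] E.icNear :=
    Elements.measurable_info 5 rfl (by decide) (by decide)
  have hθ : Measurable[E.info 5 6] E.icAngle :=
    Elements.measurable_info 6 rfl (by decide) (by decide)
  have hT : Measurable[E.info 7 8] E.icTarget :=
    Elements.measurable_info 7 rfl (by decide) (by decide)
  have hC : Measurable[E.info 7 8] E.icClutter :=
    Elements.measurable_info 8 rfl (by decide) (by decide)
  have hX : Measurable[E.info 5 6] fun ω => (E.icNear ω, E.icAngle ω) := hw.prodMk hθ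
  have hm : Measurable[Prod.instMeasurableSpace (m₂ := E.info 7 8)] fun q : (ℂ × ℝ) × Ω =>
      E.interLoad (P.map E.clutter) cell R₁ z q.1.1 q.1.2 q.2 :=
    @Elements.measurable_interLoad p Ω E cell ((ℂ × ℝ) × Ω)
      (E.info 7 8) (Prod.instMeasurableSpace (m₂ := E.info 7 8)) hcell _ _ R₁ hT hC _ _
      measurable_const (measurable_fst.comp (@measurable_fst (ℂ × ℝ) Ω _ (E.info 7 8))) _
      (measurable_snd.comp (@measurable_fst (ℂ × ℝ) Ω _ (E.info 7 8))) _
      (@measurable_snd (ℂ × ℝ) Ω _ (E.info 7 8))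
  exact hE.lintegral_freeze (a := 5) (b := 6) (c := 7) (d := 8) (by decide) hX
    (F := fun q => expNeg (ENNReal.ofReal a *
      E.interLoad (P.map E.clutter) cell R₁ z q.1.1 q.1.2 q.2))
    (measurable_expNeg.comp (hm.const_mul _))

theorem IsBistaticModel.lintegral_interLT_freeze (hE : IsBistaticModel P E R₁ n) (A s : ℝ) :
    ∫⁻ ω, p.targetLT s ‖E.icNear ω‖ (E.icAngle ω) * p.clutterLT A s ‖E.icNear ω‖ (E.icAngle ω) ∂P =
      ∫⁻ ω, ∫⁻ θ, p.targetLT s ‖E.icNear ω‖ θ * p.clutterLT A s ‖E.icNear ω‖ θ ∂angleLaw ∂P := by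
  have hind : IndepFun E.icNear E.icAngle P :=
    indep_of_indep_of_le_left (indep_of_indep_of_le_right
      (hE.indep_info (a := 5) (b := 5) (c := 6) (d := 6) (by decide))
      (le_iSup₂ (f := fun i (_ : i ∈ Set.Icc (6 : Fin 12) 6) => E.sigma i) 6 ⟨le_rfl, le_rfl⟩))
      (le_iSup₂ (f := fun i (_ : i ∈ Set.Icc (5 : Fin 12) 5) => E.sigma i) 5 ⟨le_rfl, le_rfl⟩)
  have hG : Measurable fun q : ℂ × ℝ => p.targetLT s ‖q.1‖ q.2 * p.clutterLT A s ‖q.1‖ q.2 := by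
    fun_prop
  refine (lintegral_of_indepFun hE.icNear_measurable hE.icAngle_measurable hind hG).trans
    (lintegral_congr fun ω => ?_)
  rw [angleLaw, ← hE.icAngle]
  exact (lintegral_map (f := fun θ => p.targetLT s ‖E.icNear ω‖ θ *
    p.clutterLT A s ‖E.icNear ω‖ θ) (by fun_prop) hE.icAngle_measurable).symm

theorem IsBistaticModel.laplace_interLoad (hE : IsBistaticModel P E R₁ n) (hR₁ : 0 < R₁)
    [SigmaFinite (P.map E.clutter)] (hcell : IsResolutionCell p cell) {z : ℂ} (hz : 0 < ‖z‖)
    (hβ : InnerProductGeometry.angle (R₁ : ℂ) z < Real.pi) {a s : ℝ} (ha : 0 ≤ a)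
    (hs : a * p.radarGain / ‖z‖ ^ p.ηL = s) :
    ∫⁻ ω, expNeg (ENNReal.ofReal a *
        E.interLoad (P.map E.clutter) cell R₁ z (E.icNear ω) (E.icAngle ω) ω) ∂P =
      p.interLT R₁ ‖z‖ (InnerProductGeometry.angle (R₁ : ℂ) z) s := by
  set A := p.cellArea ‖z‖ (InnerProductGeometry.angle (R₁ : ℂ) z) with hA
  have h2 : ∫⁻ ω, ∫⁻ ω', expNeg (ENNReal.ofReal a *
      E.interLoad (P.map E.clutter) cell R₁ z (E.icNear ω) (E.icAngle ω) ω') ∂P ∂P =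
      ∫⁻ ω, p.targetLT s ‖E.icNear ω‖ (E.icAngle ω) *
        p.clutterLT A s ‖E.icNear ω‖ (E.icAngle ω) ∂P := by
    refine lintegral_congr_ae ?_
    filter_upwards [hE.ae_cos_icAngle] with ω hω
    exact hE.laplace_interLoad_fixed hcell hz hβ ha hs _ hω
  rw [hE.lintegral_interLoad_freeze hcell, h2, hE.lintegral_interLT_freeze]
  have hG : Measurable fun q : ℝ × ℝ => p.targetLT s q.1 q.2 * p.clutterLT A s q.1 q.2 := by
    fun_prop
  have h5 := lintegral_nthNearest_other hR₁ hE.icBS hE.icNear_measurable le_rfl hE.icNear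
    (H := fun q => ∫⁻ θ, p.targetLT s q.1 θ * p.clutterLT A s q.1 θ ∂angleLaw)
    ((hG.lintegral_prod_right' (ν := angleLaw)).comp measurable_fst)
  simp only at h5
  rw [h5, Params.interLT_eq]
  refine setLIntegral_congr_fun measurableSet_Ioi fun r hr => ?_
  have hr0 : 0 < r := hR₁.trans hr
  have hlam := p.lamBS_pos
  have hpi := Real.pi_pos
  simp only [setLIntegral_const, Real.volume_Ioo, sub_zero]
  -- The angle of the second-nearest station integrates out. The factor `1 / π` of the law of
  -- `icAngle` cancels the `π` of the distance density for `n = 2`, leaving `2 * lamBS * RIC`.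
  rw [lintegral_angleLaw, lintegral_mul_const _ (by fun_prop),
    mul_assoc _ _ (ENNReal.ofReal Real.pi),
    ← ENNReal.ofReal_mul (by positivity), one_div_mul_cancel Real.pi_ne_zero, ENNReal.ofReal_one,
    mul_one, mul_comm (ENNReal.ofReal (1 / Real.pi)), mul_assoc, ← ENNReal.ofReal_mul (by positivity)]
  congr 2
  simp only [Params.nthDensity, Nat.sub_self, pow_zero, Nat.factorial_zero, Nat.cast_one]
  field_simp
  ring

theorem IsBistaticModel.laplace_directLoad (hE : IsBistaticModel P E R₁ n) {a : ℝ} (ha : 0 ≤ a) :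
    ∫⁻ ω, expNeg (ENNReal.ofReal a * E.directLoad (E.nbrNear ω) ω) ∂P = p.directLT a := by
  have hw : Measurable[E.info 9 9] E.nbrNear :=
    Elements.measurable_info 9 rfl (by decide) (by decide)
  have hL : Measurable[E.info 10 11] E.dirL :=
    Elements.measurable_info 10 rfl (by decide) (by decide)
  have hN : Measurable[E.info 10 11] E.dirN :=
    Elements.measurable_info 11 rfl (by decide) (by decide)
  have hL' : Measurable[E.info 10 10] E.dirL :=
    Elements.measurable_info 10 rfl (by decide) (by decide)
  have hN' : Measurable[E.info 11 11] E.dirN :=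
    Elements.measurable_info 11 rfl (by decide) (by decide)
  have hq : Measurable fun r => 1 - p.pLOS r := by fun_prop
  have h1 := hE.lintegral_freeze (a := 9) (b := 9) (c := 10) (d := 11) (by decide)
    (X := E.nbrNear) hw
    (F := fun q => expNeg (ENNReal.ofReal a * E.directLoad q.1 q.2))
    (measurable_expNeg.comp ((@Elements.measurable_directLoad p Ω E (ℂ × Ω)
      (E.info 10 11) (Prod.instMeasurableSpace (m₂ := E.info 10 11)) hL hN _
      (@measurable_fst ℂ Ω _ (E.info 10 11)) _
      (@measurable_snd ℂ Ω _ (E.info 10 11))).const_mul _))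
  simp only at h1
  rw [h1]
  have h2 (w : ℂ) : ∫⁻ ω', expNeg (ENNReal.ofReal a * E.directLoad w ω') ∂P =
      p.directLinkLT p.pLOS p.CL p.ηL p.mL a ‖w‖ *
        p.directLinkLT (fun r => 1 - p.pLOS r) p.CN p.ηN p.mN a ‖w‖ := by
    simp_rw [Elements.directLoad, mul_add, expNeg_add]
    rw [hE.lintegral_mul (a := 10) (b := 10) (c := 11) (d := 11) (by decide),
      laplace_directPower Params.measurable_pLOS (fun r _ => (p.pLOS_pos r).le) p.mL_pos hE.dirL
        p.CL_nonneg w ha,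
      laplace_directPower hq (fun r hr => sub_nonneg.2 (p.pLOS_le_one hr)) p.mN_pos hE.dirN
        p.CN_nonneg w ha]
    · rfl
    · exact measurable_expNeg.comp ((@measurable_directPower Ω (E.info 10 10) p _ _ _ _ _
        measurable_const _ hL').const_mul _)
    · exact measurable_expNeg.comp ((@measurable_directPower Ω (E.info 11 11) p _ _ _ _ _
        measurable_const _ hN').const_mul _)
  simp_rw [h2]
  rw [lintegral_nearest p.lamBS_pos hE.nbrBS hE.nbrNear_measurable hE.nbrNear
    (H := fun r => p.directLinkLT p.pLOS p.CL p.ηL p.mL a r *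
      p.directLinkLT (fun r => 1 - p.pLOS r) p.CN p.ηN p.mN a r)
    ((Params.measurable_directLinkLT (by fun_prop) _ _ _ measurable_const measurable_id).mul
      (Params.measurable_directLinkLT hq _ _ _ measurable_const measurable_id)),
    Params.directLT_eq]

end Interference

/-! ### Coverage for a fixed receiver. -/

section FixedReceiver

variable {p : Params} {Ω : Type*} [mΩ : MeasurableSpace Ω] {P : Measure Ω}
  {E : Elements p Ω} {cell : ℝ → ℝ → Set ℂ} {R₁ : ℝ} {n : ℕ}

/-- At angle `π` the factor `cos (β / 2)` vanishes, hence the strict bound. -/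
theorem Params.echoGain_pos (hR₁ : 0 < R₁) {z : ℂ} (hz : 0 < ‖z‖)
    (hβ : InnerProductGeometry.angle (R₁ : ℂ) z < Real.pi) : 0 < p.echoGain R₁ z := by
  have hcos := Params.cos_half_pos (InnerProductGeometry.angle_nonneg (R₁ : ℂ) z) hβ
  have hκ := p.radarGain_pos
  rw [Params.echoGain]
  positivity

theorem Elements.measurable_load_info [SigmaFinite (P.map E.clutter)]
    (hcell : IsResolutionCell p cell) (z : ℂ) {c : Fin 12}
    (hc : c ≤ 4) : Measurable[E.info c 11] fun ω => E.load (P.map E.clutter) cell R₁ z ω :=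
  @Elements.measurable_load p Ω E cell Ω (E.info c 11) (E.info c 11) hcell _ _ R₁
    (Elements.measurable_info 4 rfl hc (by decide))
    (Elements.measurable_info 5 rfl (hc.trans (by decide)) (by decide))
    (Elements.measurable_info 6 rfl (hc.trans (by decide)) (by decide))
    (Elements.measurable_info 7 rfl (hc.trans (by decide)) (by decide))
    (Elements.measurable_info 8 rfl (hc.trans (by decide)) (by decide))
    (Elements.measurable_info 9 rfl (hc.trans (by decide)) (by decide))
    (Elements.measurable_info 10 rfl (hc.trans (by decide)) (by decide))
    (Elements.measurable_info 11 rfl (hc.trans (by decide)) (by decide))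
    _ measurable_const _ measurable_id

theorem IsBistaticModel.prob_block (hE : IsBistaticModel P E R₁ n) {r : ℝ} (hr : 0 ≤ r) :
    P {ω | E.block ω < p.pLOS r} = ENNReal.ofReal (p.pLOS r) := by
  have h : P {ω | E.block ω < p.pLOS r} = P.map E.block (Set.Iio (p.pLOS r)) :=
    (Measure.map_apply hE.block_measurable measurableSet_Iio).symm
  have h' : Set.Iio (p.pLOS r) ∩ Set.Icc 0 1 = Set.Ico 0 (p.pLOS r) := by
    ext x
    have := p.pLOS_le_one hr
    simp only [Set.mem_inter_iff, Set.mem_Iio, Set.mem_Icc, Set.mem_Ico]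
    constructor
    · exact fun h => ⟨h.2.1, h.1⟩
    · exact fun h => ⟨h.2, h.1, h.2.le.trans this⟩
  rw [h, hE.block, Measure.restrict_apply measurableSet_Iio, h', Real.volume_Ico, sub_zero]

variable [IsProbabilityMeasure P]

/-- The denominator is built from three independent blocks, indices `4`, `5` to `8` and `9` to `11`,
plus deterministic noise. -/
theorem IsBistaticModel.laplace_load (hE : IsBistaticModel P E R₁ n) (hR₁ : 0 < R₁)
    [SigmaFinite (P.map E.clutter)] (hcell : IsResolutionCell p cell) {z : ℂ} (hz : 0 < ‖z‖)
    (hβ : InnerProductGeometry.angle (R₁ : ℂ) z < Real.pi) {φ : ℝ} (hφ : 0 < φ) {a : ℝ}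
    (ha : a = φ / (p.echoGain R₁ z * p.σt)) :
    ∫⁻ ω, expNeg (ENNReal.ofReal a * E.load (P.map E.clutter) cell R₁ z ω) ∂P =
      ENNReal.ofReal (p.intraLT φ ‖z‖ (InnerProductGeometry.angle (R₁ : ℂ) z)) *
      p.interLT R₁ ‖z‖ (InnerProductGeometry.angle (R₁ : ℂ) z)
        (φ * R₁ ^ p.ηL / (p.σt * Real.cos (InnerProductGeometry.angle (R₁ : ℂ) z / 2))) *
      ENNReal.ofReal (Real.exp
        (-(p.noiseScale φ R₁ ‖z‖ (InnerProductGeometry.angle (R₁ : ℂ) z) * (p.KB * p.T * p.Wb)))) *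
      p.directLT (p.noiseScale φ R₁ ‖z‖ (InnerProductGeometry.angle (R₁ : ℂ) z)) := by
  set β := InnerProductGeometry.angle (R₁ : ℂ) z with hβdef
  have hcos : 0 < Real.cos (β / 2) :=
    Params.cos_half_pos (InnerProductGeometry.angle_nonneg _ _) hβ
  have hκ := p.radarGain_pos
  have hσt := p.σt_pos
  have hσc := p.σc_pos
  have hg : 0 < p.echoGain R₁ z := Params.echoGain_pos hR₁ hz hβ
  have ha0 : 0 ≤ a := by rw [ha]; positivity
  have hPs := p.Ps_pos
  have hGm := p.Gm_pos
  have hwl := p.wl_pos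
  have hpi := Real.pi_pos
  have hR : 0 < R₁ ^ p.ηL := by positivity
  have hZ : 0 < ‖z‖ ^ p.ηL := by positivity
  -- The one scale `a` takes three forms: unchanged for noise and direct interference, without the
  -- receiver path loss for inter-clutter, and `φ / σt` for intra-clutter, whose gain is that of the
  -- echo.
  have hnoise : a = p.noiseScale φ R₁ ‖z‖ β := by
    rw [ha, Params.noiseScale, Params.echoGain, Params.radarGain, ← hβdef]
    field_simp
  have hs : a * p.radarGain / ‖z‖ ^ p.ηL = φ * R₁ ^ p.ηL / (p.σt * Real.cos (β / 2)) := by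
    rw [ha, Params.echoGain, ← hβdef]
    field_simp
  have hb : a * p.echoGain R₁ z = φ / p.σt := by
    rw [ha]
    field_simp
  have hcl : Measurable[E.info 4 4] E.clutter :=
    Elements.measurable_info 4 rfl (by decide) (by decide)
  have hw : Measurable[E.info 5 8] E.icNear :=
    Elements.measurable_info 5 rfl (by decide) (by decide)
  have hθ : Measurable[E.info 5 8] E.icAngle :=
    Elements.measurable_info 6 rfl (by decide) (by decide)
  have hT : Measurable[E.info 5 8] E.icTarget :=
    Elements.measurable_info 7 rfl (by decide) (by decide)
  have hC : Measurable[E.info 5 8] E.icClutter :=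
    Elements.measurable_info 8 rfl (by decide) (by decide)
  have hn : Measurable[E.info 9 11] E.nbrNear :=
    Elements.measurable_info 9 rfl (by decide) (by decide)
  have hL : Measurable[E.info 9 11] E.dirL :=
    Elements.measurable_info 10 rfl (by decide) (by decide)
  have hN : Measurable[E.info 9 11] E.dirN :=
    Elements.measurable_info 11 rfl (by decide) (by decide)
  have m1 : Measurable[E.info 4 4] fun ω => expNeg (ENNReal.ofReal a *
      p.intraPower cell R₁ z (locallyFinitePart p.clutterIntensity (E.clutter ω))) :=
    measurable_expNeg.comp ((@measurable_intraPower Ω (E.info 4 4) p _ hcell _ _ _ _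
      measurable_const _ hcl).const_mul _)
  have m2 {c d : Fin 12} (hc : c ≤ 5) (hd : 8 ≤ d) : Measurable[E.info c d] fun ω =>
      expNeg (ENNReal.ofReal a *
        E.interLoad (P.map E.clutter) cell R₁ z (E.icNear ω) (E.icAngle ω) ω) := by
    have hle : E.info 5 8 ≤ E.info c d :=
      biSup_mono fun i hi => ⟨hc.trans hi.1, hi.2.trans hd⟩
    refine Measurable.mono ?_ hle le_rfl
    exact measurable_expNeg.comp ((@Elements.measurable_interLoad p Ω E cell Ω (E.info 5 8)
      (E.info 5 8) hcell _ _ R₁ hT hC _ _ measurable_const hw _ hθ _ measurable_id).const_mul _)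
  have m3 {c d : Fin 12} (hc : c ≤ 9) (hd : 11 ≤ d) : Measurable[E.info c d] fun ω =>
      expNeg (ENNReal.ofReal a * E.directLoad (E.nbrNear ω) ω) := by
    have hle : E.info 9 11 ≤ E.info c d :=
      biSup_mono fun i hi => ⟨hc.trans hi.1, hi.2.trans hd⟩
    refine Measurable.mono ?_ hle le_rfl
    exact measurable_expNeg.comp ((@Elements.measurable_directLoad p Ω E Ω (E.info 9 11)
      (E.info 9 11) hL hN _ hn _ measurable_id).const_mul _)
  simp_rw [Elements.load, mul_add, expNeg_add]
  rw [hE.lintegral_mul (a := 4) (b := 4) (c := 5) (d := 11) (by decide)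
      (g := fun ω => expNeg (ENNReal.ofReal a *
          E.interLoad (P.map E.clutter) cell R₁ z (E.icNear ω) (E.icAngle ω) ω) *
        (expNeg (ENNReal.ofReal a * ENNReal.ofReal (p.KB * p.T * p.Wb)) *
          expNeg (ENNReal.ofReal a * E.directLoad (E.nbrNear ω) ω))) m1
      ((m2 le_rfl (by decide)).mul (measurable_const.mul (m3 (by decide) le_rfl))),
    hE.lintegral_mul (a := 5) (b := 8) (c := 9) (d := 11) (by decide)
      (g := fun ω => expNeg (ENNReal.ofReal a * ENNReal.ofReal (p.KB * p.T * p.Wb)) *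
          expNeg (ENNReal.ofReal a * E.directLoad (E.nbrNear ω) ω)) (m2 le_rfl le_rfl)
      (measurable_const.mul (m3 le_rfl le_rfl)),
    lintegral_const_mul' _ _ (ne_top_of_le_ne_top ENNReal.one_ne_top (expNeg_le_one _)),
    hE.laplace_interLoad hR₁ hcell hz hβ ha0 hs, hE.laplace_directLoad ha0,
    laplace_intraPower hcell hE.clutter hz hβ ha0 (by positivity) hb,
    ← ENNReal.ofReal_mul ha0, expNeg_ofReal (mul_nonneg ha0
      (mul_pos (mul_pos p.KB_pos p.T_pos) p.Wb_pos).le), ← hnoise, Params.intraLT]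
  have hfrac : φ / p.σt * p.σc / (1 + φ / p.σt * p.σc) = φ * p.σc / (p.σt + φ * p.σc) := by
    field_simp
  rw [hfrac]
  ring

/-- The cross-section is independent of the denominator. Integrating it out first leaves the
exponential tail `expMeasure_signal`, that is, the Laplace transform of the denominator. -/
theorem IsBistaticModel.prob_echo (hE : IsBistaticModel P E R₁ n) (hR₁ : 0 < R₁)
    [SigmaFinite (P.map E.clutter)] (hcell : IsResolutionCell p cell) {z : ℂ} (hz : 0 < ‖z‖)
    (hβ : InnerProductGeometry.angle (R₁ : ℂ) z < Real.pi) {φ : ℝ} (hφ : 0 < φ) :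
    P {ω | ENNReal.ofReal φ * E.load (P.map E.clutter) cell R₁ z ω <
          ENNReal.ofReal (p.echoGain R₁ z * E.rcs ω)} =
      ENNReal.ofReal (p.intraLT φ ‖z‖ (InnerProductGeometry.angle (R₁ : ℂ) z)) *
      p.interLT R₁ ‖z‖ (InnerProductGeometry.angle (R₁ : ℂ) z)
        (φ * R₁ ^ p.ηL / (p.σt * Real.cos (InnerProductGeometry.angle (R₁ : ℂ) z / 2))) *
      ENNReal.ofReal (Real.exp
        (-(p.noiseScale φ R₁ ‖z‖ (InnerProductGeometry.angle (R₁ : ℂ) z) * (p.KB * p.T * p.Wb)))) *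
      p.directLT (p.noiseScale φ R₁ ‖z‖ (InnerProductGeometry.angle (R₁ : ℂ) z)) := by
  have hg : 0 < p.echoGain R₁ z := Params.echoGain_pos hR₁ hz hβ
  have hX : Measurable[E.info 4 11] fun ω => E.load (P.map E.clutter) cell R₁ z ω :=
    Elements.measurable_load_info hcell z (by decide)
  have hX' := hX.mono (hE.info_le 4 11) le_rfl
  have hind : IndepFun (fun ω => E.load (P.map E.clutter) cell R₁ z ω) E.rcs P :=
    indep_of_indep_of_le_left (indep_of_indep_of_le_right
      (hE.indep_info (a := 3) (b := 3) (c := 4) (d := 11) (by decide)).symm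
      (Elements.measurable_info (E := E) 3 rfl (by decide) (by decide)).comap_le) hX.comap_le
  have hS : MeasurableSet {q : ℝ≥0∞ × ℝ | ENNReal.ofReal φ * q.1 <
      ENNReal.ofReal (p.echoGain R₁ z * q.2)} :=
    measurableSet_lt (by fun_prop) (by fun_prop)
  have h1 := lintegral_of_indepFun hX' hE.rcs_measurable hind
    (F := Set.indicator {q : ℝ≥0∞ × ℝ | ENNReal.ofReal φ * q.1 <
      ENNReal.ofReal (p.echoGain R₁ z * q.2)} 1) (measurable_one.indicator hS)
  have h2 : ∫⁻ ω, Set.indicator {q : ℝ≥0∞ × ℝ | ENNReal.ofReal φ * q.1 <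
      ENNReal.ofReal (p.echoGain R₁ z * q.2)} 1
        (E.load (P.map E.clutter) cell R₁ z ω, E.rcs ω) ∂P =
      P {ω | ENNReal.ofReal φ * E.load (P.map E.clutter) cell R₁ z ω <
          ENNReal.ofReal (p.echoGain R₁ z * E.rcs ω)} :=
    lintegral_indicator_one ((hX'.prodMk hE.rcs_measurable) hS)
  have h3 (d : ℝ≥0∞) : ∫⁻ ω, Set.indicator {q : ℝ≥0∞ × ℝ | ENNReal.ofReal φ * q.1 <
      ENNReal.ofReal (p.echoGain R₁ z * q.2)} 1 (d, E.rcs ω) ∂P =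
      expNeg (ENNReal.ofReal (φ / (p.echoGain R₁ z * p.σt)) * d) := by
    have hm : MeasurableSet {x : ℝ | ENNReal.ofReal φ * d <
        ENNReal.ofReal (p.echoGain R₁ z * x)} :=
      measurableSet_lt (by fun_prop) (by fun_prop)
    have e : ENNReal.ofReal (φ / (p.echoGain R₁ z * p.σt)) * d =
        ENNReal.ofReal (1 / (p.echoGain R₁ z * p.σt)) * (ENNReal.ofReal φ * d) := by
      have hσt := p.σt_pos
      rw [← mul_assoc, ← ENNReal.ofReal_mul (by positivity), one_div_mul_eq_div]
    rw [e, ← expMeasure_signal p.σt_pos hg, ← hE.rcs, Measure.map_apply hE.rcs_measurable hm]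
    exact lintegral_indicator_one (hE.rcs_measurable hm)
  rw [← h2, h1]
  simp_rw [h3]
  exact hE.laplace_load hR₁ hcell hz hβ hφ rfl

theorem IsBistaticModel.prob_beam (hE : IsBistaticModel P E R₁ n) :
    P {ω | E.beam ω ≠ E.coBeam} = ENNReal.ofReal (((p.M : ℝ) - 1) / p.M) := by
  have hM : (0 : ℝ) < p.M := by exact_mod_cast p.M_pos
  have hm : MeasurableSet {ω | E.beam ω = E.coBeam} :=
    hE.beam_measurable (measurableSet_singleton _)
  have h : {ω | E.beam ω ≠ E.coBeam} = {ω | E.beam ω = E.coBeam}ᶜ := rfl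
  rw [h, prob_compl_eq_one_sub hm, hE.beam, sub_div, div_self hM.ne',
    ENNReal.ofReal_sub _ (by positivity), ENNReal.ofReal_one, one_div, ENNReal.ofReal_inv_of_pos hM,
    ENNReal.ofReal_natCast]

theorem IsBistaticModel.coverage_fixed (hE : IsBistaticModel P E R₁ n) (hR₁ : 0 < R₁)
    [SigmaFinite (P.map E.clutter)] (hcell : IsResolutionCell p cell) {z : ℂ} (hz : 0 < ‖z‖)
    (hβ : InnerProductGeometry.angle (R₁ : ℂ) z < Real.pi) {φ : ℝ} (hφ : 0 < φ) :
    P {ω | E.block ω < p.pLOS ‖z‖ ∧ E.beam ω ≠ E.coBeam ∧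
        ENNReal.ofReal φ * E.load (P.map E.clutter) cell R₁ z ω <
          ENNReal.ofReal (p.echoGain R₁ z * E.rcs ω)} =
      ENNReal.ofReal (p.pLOS ‖z‖ * ((p.M : ℝ) - 1) / p.M) *
      (ENNReal.ofReal (p.intraLT φ ‖z‖ (InnerProductGeometry.angle (R₁ : ℂ) z)) *
      p.interLT R₁ ‖z‖ (InnerProductGeometry.angle (R₁ : ℂ) z)
        (φ * R₁ ^ p.ηL / (p.σt * Real.cos (InnerProductGeometry.angle (R₁ : ℂ) z / 2))) *
      ENNReal.ofReal (Real.exp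
        (-(p.noiseScale φ R₁ ‖z‖ (InnerProductGeometry.angle (R₁ : ℂ) z) * (p.KB * p.T * p.Wb)))) *
      p.directLT (p.noiseScale φ R₁ ‖z‖ (InnerProductGeometry.angle (R₁ : ℂ) z))) := by
  have hA : MeasurableSet[E.info 1 1] {ω | E.block ω < p.pLOS ‖z‖} :=
    (Elements.measurable_info (E := E) 1 rfl (by decide) (by decide)) measurableSet_Iio
  have hB (d : Fin 12) (hd : 2 ≤ d) : MeasurableSet[E.info 2 d] {ω | E.beam ω ≠ E.coBeam} :=
    (Elements.measurable_info (E := E) 2 rfl (by decide) hd)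
      (measurableSet_singleton E.coBeam).compl
  have hC (c : Fin 12) (hc : c ≤ 3) : MeasurableSet[E.info c 11]
      {ω | ENNReal.ofReal φ * E.load (P.map E.clutter) cell R₁ z ω <
          ENNReal.ofReal (p.echoGain R₁ z * E.rcs ω)} :=
    measurableSet_lt (mδ := E.info c 11)
      ((Elements.measurable_load_info hcell z (hc.trans (by decide))).const_mul _)
      (((Elements.measurable_info (E := E) (b := 11) 3 rfl hc (by decide)).const_mul
        _).ennreal_ofReal)
  have hBC := (hB 11 (by decide)).inter (hC 2 (by decide))
  have h1 := (Indep_iff _ _ P).1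
    (hE.indep_info (a := 1) (b := 1) (c := 2) (d := 11) (by decide)) _ _ hA hBC
  have h2 := (Indep_iff _ _ P).1
    (hE.indep_info (a := 2) (b := 2) (c := 3) (d := 11) (by decide)) _ _ (hB 2 le_rfl) (hC 3 le_rfl)
  refine h1.trans ?_
  rw [h2, hE.prob_block hz.le, hE.prob_beam, hE.prob_echo hR₁ hcell hz hβ hφ, ← mul_assoc,
    ← ENNReal.ofReal_mul (p.pLOS_pos _).le, mul_div_assoc (p.pLOS ‖z‖) ((p.M : ℝ) - 1)]

end FixedReceiver

/-! ### Averaging over the position of the receiver. -/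

/-- The conditional coverage probability, given the distance and the bistatic angle of the
receiver. -/
noncomputable def Params.coverage (p : Params) (R₁ φ r β : ℝ) : ℝ≥0∞ :=
  ENNReal.ofReal (p.pLOS r * ((p.M : ℝ) - 1) / p.M) *
    (ENNReal.ofReal (p.intraLT φ r β) *
      p.interLT R₁ r β (φ * R₁ ^ p.ηL / (p.σt * Real.cos (β / 2))) *
      ENNReal.ofReal (Real.exp (-(p.noiseScale φ R₁ r β * (p.KB * p.T * p.Wb)))) *
      p.directLT (p.noiseScale φ R₁ r β))

theorem Params.measurable_coverage (p : Params) (R₁ φ : ℝ) :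
    Measurable fun q : ℝ × ℝ => p.coverage R₁ φ q.1 q.2 := by
  have hns : Measurable fun q : ℝ × ℝ => p.noiseScale φ R₁ q.1 q.2 := by
    unfold Params.noiseScale
    fun_prop
  have hin : Measurable fun q : ℝ × ℝ => p.intraLT φ q.1 q.2 := by
    unfold Params.intraLT
    fun_prop
  exact Measurable.mul (by fun_prop) (((hin.ennreal_ofReal.mul
    (Params.measurable_interLT R₁ measurable_fst measurable_snd (by fun_prop))).mul
    (by fun_prop)).mul (Params.measurable_directLT hns))

theorem Elements.measurableSet_coverage {p : Params} {Ω : Type*} {E : Elements p Ω}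
    {cell : ℝ → ℝ → Set ℂ} [MeasurableSpace Ω] (hcell : IsResolutionCell p cell)
    (ν : Measure (Measure (ℂ × ℝ))) [SigmaFinite ν] (R₁ φ : ℝ) (hb : Measurable E.block)
    (hbeam : Measurable E.beam) (hr : Measurable E.rcs)
    (hcl : Measurable E.clutter) (hw : Measurable E.icNear) (hθ : Measurable E.icAngle)
    (hT : Measurable E.icTarget) (hC : Measurable E.icClutter) (hn : Measurable E.nbrNear)
    (hL : Measurable E.dirL) (hN : Measurable E.dirN) :
    MeasurableSet {q : ℂ × Ω | E.block q.2 < p.pLOS ‖q.1‖ ∧ E.beam q.2 ≠ E.coBeam ∧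
      ENNReal.ofReal φ * E.load ν cell R₁ q.1 q.2 <
        ENNReal.ofReal (p.echoGain R₁ q.1 * E.rcs q.2)} := by
  have hl : Measurable fun q : ℂ × Ω => E.load ν cell R₁ q.1 q.2 :=
    Elements.measurable_load hcell _ R₁ hcl hw hθ hT hC hn hL hN measurable_fst measurable_snd
  have hg : Measurable fun q : ℂ × Ω => p.echoGain R₁ q.1 := by
    unfold Params.echoGain
    fun_prop
  have h1 : MeasurableSet {q : ℂ × Ω | E.block q.2 < p.pLOS ‖q.1‖} :=
    measurableSet_lt (by fun_prop) (by fun_prop)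
  have h2 : MeasurableSet {q : ℂ × Ω | E.beam q.2 ≠ E.coBeam} :=
    (hbeam.comp measurable_snd) (measurableSet_singleton E.coBeam).compl
  have h3 : MeasurableSet {q : ℂ × Ω | ENNReal.ofReal φ * E.load ν cell R₁ q.1 q.2 <
      ENNReal.ofReal (p.echoGain R₁ q.1 * E.rcs q.2)} :=
    measurableSet_lt (hl.const_mul _) (by fun_prop)
  exact h1.inter (h2.inter h3)

section Receiver

variable {p : Params} {Ω : Type*} [mΩ : MeasurableSpace Ω] {P : Measure Ω} [IsProbabilityMeasure P]
  {E : Elements p Ω} {cell : ℝ → ℝ → Set ℂ} {R₁ : ℝ} {n : ℕ}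

/-- The joint law of distance and angle integrates over the open interval `(0, π)`, so the indicator
of angles at least `π` has mean zero. -/
theorem IsBistaticModel.ae_angle_lt_pi (hE : IsBistaticModel P E R₁ n) (hn : 2 ≤ n)
    (hR₁ : 0 < R₁) : ∀ᵐ ω ∂P, E.angle R₁ ω < Real.pi := by
  have hH : Measurable (Set.indicator {q : ℝ × ℝ | Real.pi ≤ q.2} (1 : ℝ × ℝ → ℝ≥0∞)) :=
    measurable_one.indicator (measurableSet_le measurable_const measurable_snd)
  have h := lintegral_nthNearest_other hR₁ hE.otherBS hE.rx_measurable hn hE.rx hH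
  have h0 : ∫⁻ r in Set.Ioi R₁, ∫⁻ β in Set.Ioo 0 Real.pi,
      Set.indicator {q : ℝ × ℝ | Real.pi ≤ q.2} (1 : ℝ × ℝ → ℝ≥0∞) (r, β) *
        ENNReal.ofReal (p.nthDensity n R₁ r) * ENNReal.ofReal (1 / Real.pi) = 0 := by
    have (r : ℝ) : ∫⁻ β in Set.Ioo 0 Real.pi,
      Set.indicator {q : ℝ × ℝ | Real.pi ≤ q.2} (1 : ℝ × ℝ → ℝ≥0∞) (r, β) *
        ENNReal.ofReal (p.nthDensity n R₁ r) * ENNReal.ofReal (1 / Real.pi) = 0 := by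
      rw [setLIntegral_congr_fun (g := fun _ => 0) measurableSet_Ioo, lintegral_zero]
      intro β hβ
      have hβ' : (r, β) ∉ {q : ℝ × ℝ | Real.pi ≤ q.2} := not_le.2 hβ.2
      simp only [Set.indicator_of_notMem hβ', zero_mul]
    simp_rw [this, lintegral_zero]
  have hX : Measurable fun ω => (‖E.rx ω‖, InnerProductGeometry.angle (R₁ : ℂ) (E.rx ω)) :=
    hE.rx_measurable.norm.prodMk (measurable_angle_comp _ hE.rx_measurable)
  filter_upwards [(lintegral_eq_zero_iff (hH.comp hX)).1 (h.trans h0)] with ω hω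
  by_contra hc
  have hmem : (‖E.rx ω‖, InnerProductGeometry.angle (R₁ : ℂ) (E.rx ω)) ∈
      {q : ℝ × ℝ | Real.pi ≤ q.2} := not_lt.1 hc
  exact one_ne_zero ((Set.indicator_of_mem hmem (1 : ℝ × ℝ → ℝ≥0∞)).symm.trans hω)

/-- Off a null set the SINR event is a condition on the pair of the receiver and the other elements;
the receiver, index `0`, is independent of the block from `1` to `11`. -/
theorem IsBistaticModel.coverage_freeze (hE : IsBistaticModel P E R₁ n)
    [SigmaFinite (P.map E.clutter)] (hcell : IsResolutionCell p cell) {φ : ℝ} (hφ : 0 < φ) :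
    P {ω | ENNReal.ofReal φ < E.SINR cell R₁ ω} =
      ∫⁻ ω, P {ω' | E.block ω' < p.pLOS ‖E.rx ω‖ ∧ E.beam ω' ≠ E.coBeam ∧
        ENNReal.ofReal φ * E.load (P.map E.clutter) cell R₁ (E.rx ω) ω' <
          ENNReal.ofReal (p.echoGain R₁ (E.rx ω) * E.rcs ω')} ∂P := by
  set S : Set (ℂ × Ω) := {q | E.block q.2 < p.pLOS ‖q.1‖ ∧ E.beam q.2 ≠ E.coBeam ∧
    ENNReal.ofReal φ * E.load (P.map E.clutter) cell R₁ q.1 q.2 <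
      ENNReal.ofReal (p.echoGain R₁ q.1 * E.rcs q.2)} with hSdef
  have hS : MeasurableSet[Prod.instMeasurableSpace (m₂ := E.info 1 11)] S :=
    @Elements.measurableSet_coverage p Ω E cell (E.info 1 11) hcell _ _ R₁ φ
      (Elements.measurable_info 1 rfl (by decide) (by decide))
      (Elements.measurable_info 2 rfl (by decide) (by decide))
      (Elements.measurable_info 3 rfl (by decide) (by decide))
      (Elements.measurable_info 4 rfl (by decide) (by decide))
      (Elements.measurable_info 5 rfl (by decide) (by decide))
      (Elements.measurable_info 6 rfl (by decide) (by decide))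
      (Elements.measurable_info 7 rfl (by decide) (by decide))
      (Elements.measurable_info 8 rfl (by decide) (by decide))
      (Elements.measurable_info 9 rfl (by decide) (by decide))
      (Elements.measurable_info 10 rfl (by decide) (by decide))
      (Elements.measurable_info 11 rfl (by decide) (by decide))
  have hm (x : Ω → ℂ) (hx : Measurable x) : MeasurableSet {ω | (x ω, ω) ∈ S} := by
    have hid : Measurable[mΩ, E.info 1 11] (id : Ω → Ω) := measurable_id'' (hE.info_le 1 11)
    exact (@Measurable.prodMk Ω _ ℂ Ω _ (E.info 1 11) x id hx hid) hS
  have hind (m : MeasurableSpace (ℂ × Ω)) (h : MeasurableSet[m] S) :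
      Measurable[m] (S.indicator (1 : ℂ × Ω → ℝ≥0∞)) := measurable_one.indicator h
  have h1 : P {ω | ENNReal.ofReal φ < E.SINR cell R₁ ω} = P {ω | (E.rx ω, ω) ∈ S} := by
    refine measure_congr ?_
    filter_upwards [hE.ae_load_eq (cell := cell)] with ω hω
    exact propext (Elements.lt_SINR_iff hφ hω)
  have h2 : P {ω | (E.rx ω, ω) ∈ S} = ∫⁻ ω, S.indicator 1 (E.rx ω, ω) ∂P :=
    (lintegral_indicator_one (hm _ hE.rx_measurable)).symm
  rw [h1, h2, hE.lintegral_freeze (a := 0) (b := 0) (c := 1) (d := 11) (by decide)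
    (Elements.measurable_info 0 rfl (by decide) (by decide)) (F := S.indicator 1)
    (hind _ hS)]
  exact lintegral_congr fun ω => lintegral_indicator_one (hm _ measurable_const)

end Receiver

end ISAC

theorem theorem2 {Ω : Type*} [MeasurableSpace Ω] (P : Measure Ω) [IsProbabilityMeasure P]
    (p : ISAC.Params) (n : ℕ) (hn : 2 ≤ n) (R₁ : ℝ) (hR₁ : 0 < R₁) (φ : ℝ) (hφ : 0 < φ)
    (cell : ℝ → ℝ → Set ℂ) (hcell : ISAC.IsResolutionCell p cell)
    (E : ISAC.Elements p Ω) (hE : ISAC.IsBistaticModel P E R₁ n) :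
    P {ω | ENNReal.ofReal φ < E.SINR cell R₁ ω} =
      ∫⁻ Rn in Set.Ioi R₁, ∫⁻ β in Set.Ioo 0 Real.pi,
        ENNReal.ofReal (p.pLOS Rn * ((p.M : ℝ) - 1) / p.M) *
        ENNReal.ofReal (p.intraLT φ Rn β) *
        p.interLT R₁ Rn β (φ * R₁ ^ p.ηL / (p.σt * Real.cos (β / 2))) *
        ENNReal.ofReal (Real.exp (-(p.noiseScale φ R₁ Rn β * (p.KB * p.T * p.Wb)))) *
        p.directLT (p.noiseScale φ R₁ Rn β) *
        ENNReal.ofReal (p.nthDensity n R₁ Rn) * ENNReal.ofReal (1 / Real.pi) := by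
  have : IsProbabilityMeasure (P.map E.clutter) :=
    Measure.isProbabilityMeasure_map hE.clutter.measurable.aemeasurable
  have h1 : ∫⁻ ω, P {ω' | E.block ω' < p.pLOS ‖E.rx ω‖ ∧ E.beam ω' ≠ E.coBeam ∧
        ENNReal.ofReal φ * E.load (P.map E.clutter) cell R₁ (E.rx ω) ω' <
          ENNReal.ofReal (p.echoGain R₁ (E.rx ω) * E.rcs ω')} ∂P =
      ∫⁻ ω, p.coverage R₁ φ ‖E.rx ω‖ (InnerProductGeometry.angle (R₁ : ℂ) (E.rx ω)) ∂P := by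
    refine lintegral_congr_ae ?_
    filter_upwards [ISAC.otherIntensity_nthNearest hR₁ hE.otherBS hn hE.rx,
      hE.ae_angle_lt_pi hn hR₁] with ω hω hβ
    exact hE.coverage_fixed hR₁ hcell (hR₁.trans hω.2.2) hβ hφ
  rw [hE.coverage_freeze hcell hφ, h1,
    ISAC.lintegral_nthNearest_other hR₁ hE.otherBS hE.rx_measurable hn hE.rx
      (H := fun q => p.coverage R₁ φ q.1 q.2) (p.measurable_coverage R₁ φ)]
  simp only [ISAC.Params.coverage, mul_assoc]
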